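/- **Setting.** Let $q_s,q_t\ge 1$ be the orders in space and time, $l\ge\max\{q_s,q_t\}+2$, and let $\tau_0,\dots,\tau_{q_t}\in[0,1]$ be distinct reference nodes. On one time slab $\tilde\Omega\times I$, $I=[t_0,t_1]$, $\Delta t=t_1-t_0>0$, let $t_i^*=t_0+\tau_i\Delta t$, let $\ell_i$ be the Lagrange basis of $\mathcal P^{q_t}$ for these nodes, and let $\mathcal T_h$ be a finite, conforming, shape regular triangulation of the open set $\tilde\Omega\subset\mathbb R^d$ into closed simplices, with mesh size $h=\max_T\operatorname{diam}T$. The symbols $\nabla$ and $D$ denote spatial derivatives; $A\lesssim B$ means $A\le CB$. In the assumptions, the hidden constants and $\delta_\Omega,\delta_U,c,\epsilon_0,\epsilon,w_b>0$ are fixed; in the claims, $C$ depends only on these fixed constants, on $d,q_s,q_t,l,(\tau_i)$ and on the shape regularity constant, but not on $h$, $\Delta t$, the mesh, the level set functions or the position of the interface in the mesh. *Exact level set function.* $\phi\in C^0(\tilde\Omega\times I)$, $\Omega(t)=\{x\in\tilde\Omega:\phi(x,t)<0\}$, $\operatorname{dist}(\partial\Omega(t),\partial\tilde\Omega)>\delta_\Omega$,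 $U(t)=\{x\in\tilde\Omega:\operatorname{dist}(x,\partial\Omega(t))<\delta_U\}$, $U=\bigcup_{t\in I}U(t)\times\{t\}$. Let $\mathcal T_h^U$ be the set of elements contained in $U(t)$ for all $t\in I$, and $\bar U$ their union. Assume $\phi\in C^2(U)$; on $U$, $c\le|\nabla\phi|\lesssim1$ and $|\partial_t\phi|,|D^2\phi|,|\partial_t\nabla\phi|\lesssim1$; for $x\in U(t)$ and $|e|,|e'|\le\epsilon_0$ the points $x+e\nabla\phi(x,t)$ lie in $\tilde\Omega$ and $|\phi(x+e\nabla\phi(x,t),t)-\phi(x+e'\nabla\phi(x,t),t)|\simeq|e-e'|$; and $\phi\in W^{l,\infty}(\operatorname{int}\bar U\times I)$ with norm $\lesssim 1$. *Discrete level set functions.* $\phi_h=\sum_{i=0}^{q_t}\ell_i(t)\phi_{h,i}(x)$ with continuous $\phi_{h,i}$ that are polynomials of degree $\le q_s$ on each element, and $|D^{m_s}\partial_t^{m_t}(\phi-\phi_h)|\lesssim h^{q_s+1-m_s}+\Delta t^{q_t+1-m_t}$ on $T\times I$ for $T\in\mathcal T_h^U$ and $(m_s,m_t)\in\{0,\dots,q_s+1\}\times\{0,1\}\cup\{0\}\times\{0,\dots,q_t+1\}$.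 Further $\phi_{\Delta t}=\sum_i\ell_i(t)\phi_{\Delta t,i}(x)$ with $\phi_{\Delta t,i}\in C^0(\tilde\Omega)\cap C^{q_s+1}(\operatorname{int}\bar U)$ and, for $m_s=0,\dots,q_s+1$ and elementwise on $\mathcal T_h^U$, $|D^{m_s}(\phi_{\Delta t,i}-\phi_{h,i})|\lesssim h^{q_s+1-m_s}$ and $|D^{m_s}(\phi_{\Delta t}-\phi)|\lesssim h^{q_s+1-m_s}+\Delta t^{q_t+1}$ (the latter for all $t\in I$). Let $\phi^{\rm lin}_i$ be the continuous piecewise linear nodal interpolant of $\phi_{h,i}$, $\phi^{\rm lin}=\sum_i\ell_i\phi_i^{\rm lin}$, $\Omega^{\rm lin}(t)=\{x\in\tilde\Omega:\phi^{\rm lin}(x,t)<0\}$. *Active elements and blending.* $T$ is cut if $T\cap\partial\Omega^{\rm lin}(t)\ne\emptyset$ for some $t\in I$. Either (finite element blending) $b\equiv0$ and $\mathcal T_h^\Gamma$ is the set of cut elements; or (smooth blending) $b\in C^l(\tilde\Omega\times I;[0,1])$ has all derivatives up to order $l$ bounded $\lesssim 1$, $b=0$ on all cut elements for all $t\in I$,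 $b(x,t)=1$ if $\operatorname{dist}(x,\partial\Omega^{\rm lin}(t))>w_b$, where $0<w_b<\min\{\delta_\Omega,\delta_U\}$, and $\mathcal T_h^\Gamma$ is the set of elements on which $b(\cdot,t)<1$ somewhere for some $t\in I$. Assume $\mathcal T_h^\Gamma\subset\mathcal T_h^U$ and $\Delta t^{q_t+1}\lesssim h^{1+\epsilon}$. Let $\Omega^\Gamma$ be the union of the elements of $\mathcal T_h^\Gamma$, and $Q^\Gamma=\Omega^\Gamma\times I$. *Mappings.* For $x\in\Omega^\Gamma$, $t\in I$ let $G=\nabla\phi$, $G_{\Delta t,i}=\nabla\phi_{\Delta t,i}$, and let $G_{h,i}$ be either the elementwise gradient $\nabla\phi_{h,i}$ or its Oswald interpolant (the continuous piecewise $\mathcal P^{q_s}$ Lagrange interpolant of the nodal averages of $\nabla\phi_{h,i}$ over the elements of $\mathcal T_h^\Gamma$ that contain the node). Let $\mathcal E_T\phi_{h,i}$ be the polynomial extension of $\phi_{h,i}|_T$, and write $b_i=b(\cdot,t_i^*)$. Let $d(x,t)$, $d_{\Delta t,i}(x)$ and, for $x\in T\in\mathcal T_h^\Gamma$, $d_{h,i}(x)$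 be the numbers of smallest absolute value such that $$\phi(x+d\,G(x,t),t)=(1-b)\phi^{\rm lin}+b\,\phi,\quad \phi_{\Delta t,i}(x+d_{\Delta t,i}G_{\Delta t,i}(x))=(1-b_i)\phi^{\rm lin}_i+b_i\phi_{\Delta t,i},\quad \mathcal E_T\phi_{h,i}(x+d_{h,i}G_{h,i}(x))=(1-b_i)\phi_i^{\rm lin}+b_i\phi_{h,i},$$ with right-hand sides evaluated at $(x,t)$, respectively at $x$; in the first two equations the shifted point is required to lie in $\tilde\Omega$. Put $\Psi^\Gamma(x,t)=x+d\,G$, $\Psi^\Gamma_{\Delta t}(x,t)=\sum_i\ell_i(t)\,(x+d_{\Delta t,i}G_{\Delta t,i}(x))$, $\Psi_h^\Gamma(x,t)=\sum_i\ell_i(t)\,(x+d_{h,i}G_{h,i}(x))$ (the last one elementwise, hence possibly double-valued on element boundaries). **Claim.** There are $C,h_0>0$ as above such that, whenever $h\le h_0$, the numbers $d$, $d_{\Delta t,i}$, $d_{h,i}$ exist and are unique, and on $Q^\Gamma$ (on each closed element) $$\|\Psi_h^\Gamma-\Psi^\Gamma\|_\infty\le C(h^{q_s+1}+\Delta t^{q_t+1}),\qquad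 \|\Psi_{\Delta t}^\Gamma-\Psi^\Gamma\|_\infty\le C(h^{q_s+1}+\Delta t^{q_t+1}),\qquad \|\Psi_{\Delta t}^\Gamma-\Psi_h^\Gamma\|_\infty\le C\,h^{q_s+1};$$ moreover $\Psi^\Gamma_{\Delta t}(\cdot,t)$ and $\Psi^\Gamma(\cdot,t)$ are differentiable in the interior of each element of $\mathcal T_h^\Gamma$ for every $t\in I$, and there $\|\nabla(\Psi_{\Delta t}^\Gamma-\Psi^\Gamma)\|_\infty\le C(h^{q_s}+\Delta t^{q_t+1})$. -/

import Mathlib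

open Set Metric

namespace SpaceTimeMapping

/-- The Euclidean space `ℝ^d`. -/
abbrev E (d : ℕ) : Type := EuclideanSpace ℝ (Fin d)

/-- A nondegenerate `d`-simplex with numbered vertices; `T.coord j` are its barycentric
coordinates. -/
abbrev Simplex (d : ℕ) : Type := AffineBasis (Fin (d + 1)) ℝ (E d)

/-- The closed simplex as a point set. -/
def hull {d : ℕ} (T : Simplex d) : Set (E d) := convexHull ℝ (range T)

/-- The fixed orders, reference time nodes and constants. All hidden constants of the estimates
may depend on these quantities and on nothing else. -/
structure Params where
  /-- space dimension -/
  d : ℕ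
  /-- order in space -/
  qs : ℕ
  /-- order in time -/
  qt : ℕ
  /-- regularity index of the level set function -/
  l : ℕ
  /-- time nodes on the reference interval `[0,1]` -/
  τ : Fin (qt + 1) → ℝ
  /-- shape regularity constant -/
  κ : ℝ
  /-- lower bound for the distance of the interface to the boundary of the background domain -/
  δΩ : ℝ
  /-- width of the neighbourhood `U` of the interface -/
  δU : ℝ
  /-- lower and upper bounds for the modulus of the gradient of the level set function -/
  cφ : ℝ
  Cφ : ℝ
  /-- range and constants of the weak signed distance property -/
  ε₀ : ℝ
  cw : ℝ
  Cw : ℝ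
  /-- constant in the regularity and approximation assumptions -/
  M : ℝ
  /-- width and derivative bound of the smooth blending function -/
  wb : ℝ
  Cb : ℝ
  /-- constants of the time step restriction -/
  CΔ : ℝ
  ε : ℝ
  one_le_qs : 1 ≤ qs
  one_le_qt : 1 ≤ qt
  le_l : max qs qt + 2 ≤ l
  τ_inj : Function.Injective τ
  τ_mem : ∀ i, τ i ∈ Icc (0 : ℝ) 1
  δΩ_pos : 0 < δΩ
  δU_pos : 0 < δU
  cφ_pos : 0 < cφ
  ε₀_pos : 0 < ε₀
  cw_pos : 0 < cw
  wb_pos : 0 < wb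
  wb_lt : wb < min δΩ δU
  ε_pos : 0 < ε

/-- The data on one time slab `Ω̃ × [t₀, t₁]`. -/
structure Config (p : Params) where
  /-- background domain -/
  bg : Set (E p.d)
  /-- the elements of the triangulation of `bg` -/
  mesh : Set (Simplex p.d)
  t₀ : ℝ
  t₁ : ℝ
  /-- exact level set function -/
  φ : E p.d → ℝ → ℝ
  /-- the spatial finite element functions `φ_{h,i}` -/
  φhi : Fin (p.qt + 1) → E p.d → ℝ
  /-- the polynomial that represents `φ_{h,i}` on an element, i.e. the polynomial extension of
  the restriction of `φ_{h,i}` to that element -/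
  poly : Simplex p.d → Fin (p.qt + 1) → MvPolynomial (Fin p.d) ℝ
  /-- the nodal values `φ_{Δt,i}` of the semi-discrete level set function -/
  φdti : Fin (p.qt + 1) → E p.d → ℝ
  /-- blending function -/
  b : E p.d → ℝ → ℝ

/-- The two blending strategies. -/
inductive Blending
  | finiteElement
  | smooth

/-- The two choices of the discrete search direction: the elementwise gradient, or its
Oswald-type average. -/
inductive SearchDir
  | gradient
  | averaged

/-- `a` is an element of `S` of smallest absolute value. -/
def IsLeastAbs (S : Set ℝ) (a : ℝ) : Prop := a ∈ S ∧ ∀ a' ∈ S, |a| ≤ |a'|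

/-- The element of smallest absolute value of `S` (meaningful if there is exactly one). -/
noncomputable def leastAbs (S : Set ℝ) : ℝ := Classical.epsilon (IsLeastAbs S)

/-- `f` belongs to `W^{l,∞}(S)`, `1 ≤ l`, and its derivatives up to order `l` are bounded by `M`:
`f` is of class `C^{l-1}`, its derivatives up to order `l - 1` are bounded by `M`, and the
derivative of order `l - 1` is `M`-Lipschitz on convex subsets of `S`. -/
def BoundedW {F : Type*} [NormedAddCommGroup F] [NormedSpace ℝ F] (l : ℕ) (M : ℝ)
    (f : F → ℝ) (S : Set F) : Prop :=
  ContDiffOn ℝ (l - 1 : ℕ) f S ∧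
  (∀ m ≤ l - 1, ∀ x ∈ S, ‖iteratedFDerivWithin ℝ m f S x‖ ≤ M) ∧
  ∀ B ⊆ S, Convex ℝ B → ∀ x ∈ B, ∀ y ∈ B,
    ‖iteratedFDerivWithin ℝ (l - 1) f S x - iteratedFDerivWithin ℝ (l - 1) f S y‖ ≤ M * ‖x - y‖

namespace Config

variable {p : Params} (K : Config p)

/-- time interval -/
def I : Set ℝ := Icc K.t₀ K.t₁

/-- time step size -/
def Δt : ℝ := K.t₁ - K.t₀

/-- mesh size -/
noncomputable def h : ℝ := sSup ((fun T => diam (hull T)) '' K.mesh)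

/-- time nodes -/
def node (i : Fin (p.qt + 1)) : ℝ := K.t₀ + p.τ i * K.Δt

/-- nodal (Lagrange) basis in time -/
noncomputable def ell (i : Fin (p.qt + 1)) (t : ℝ) : ℝ :=
  (Lagrange.basis Finset.univ K.node i).eval t

/-- the domain `Ω(t)` -/
def Om (t : ℝ) : Set (E p.d) := {x ∈ K.bg | K.φ x t < 0}

/-- the spatial neighbourhood `U(t)` of `∂Ω(t)` -/
def U (t : ℝ) : Set (E p.d) := K.bg ∩ thickening p.δU (frontier (K.Om t))

/-- the space-time neighbourhood `U` -/
def Ust : Set (E p.d × ℝ) := {z | z.2 ∈ K.I ∧ z.1 ∈ K.U z.2}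

/-- the elements contained in `U(t)` for all times -/
def meshU : Set (Simplex p.d) := {T ∈ K.mesh | ∀ t ∈ K.I, hull T ⊆ K.U t}

/-- the spatial domain that corresponds to `meshU` -/
def Ubar : Set (E p.d) := ⋃ T ∈ K.meshU, hull T

/-- the discrete level set function `φ_h` -/
noncomputable def φh (x : E p.d) (t : ℝ) : ℝ := ∑ i, K.ell i t * K.φhi i x

/-- the semi-discrete level set function `φ_{Δt}` -/
noncomputable def φdt (x : E p.d) (t : ℝ) : ℝ := ∑ i, K.ell i t * K.φdti i x

open Classical in
/-- the continuous piecewise linear interpolant `φ^lin_i` of `φ_{h,i}` (on a conforming mesh the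
value does not depend on the element that contains the point) -/
noncomputable def φlini (i : Fin (p.qt + 1)) (x : E p.d) : ℝ :=
  if hx : ∃ T ∈ K.mesh, x ∈ hull T then
    ∑ j, hx.choose.coord j x * K.φhi i (hx.choose j)
  else 0

/-- `φ^lin` -/
noncomputable def φlin (x : E p.d) (t : ℝ) : ℝ := ∑ i, K.ell i t * K.φlini i x

/-- the domain `Ω^lin(t)` -/
def Omlin (t : ℝ) : Set (E p.d) := {x ∈ K.bg | K.φlin x t < 0}

/-- the cut elements -/
def cut : Set (Simplex p.d) :=
  {T ∈ K.mesh | ∃ t ∈ K.I, (frontier (K.Omlin t) ∩ hull T).Nonempty}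

/-- the active elements -/
def active : Blending → Set (Simplex p.d)
  | .finiteElement => K.cut
  | .smooth => {T ∈ K.mesh | ∃ t ∈ K.I, ∃ x ∈ hull T ∩ K.bg, K.b x t < 1}

/-! ### The ideal mapping -/

/-- search direction `∇φ` -/
noncomputable def G (x : E p.d) (t : ℝ) : E p.d := gradient (fun y => K.φ y t) x

/-- the solutions of the equation that defines `d(x,t)` -/
def roots (x : E p.d) (t : ℝ) : Set ℝ :=
  {α | x + α • K.G x t ∈ K.bg ∧
    K.φ (x + α • K.G x t) t = (1 - K.b x t) * K.φlin x t + K.b x t * K.φ x t}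

/-- `Ψ^Γ` -/
noncomputable def Ψ (x : E p.d) (t : ℝ) : E p.d := x + leastAbs (K.roots x t) • K.G x t

/-! ### The semi-discrete mapping -/

/-- search direction `∇φ_{Δt,i}` -/
noncomputable def Gdti (i : Fin (p.qt + 1)) (x : E p.d) : E p.d := gradient (K.φdti i) x

/-- the solutions of the equation that defines `d_{Δt,i}(x)` -/
def rootsdti (i : Fin (p.qt + 1)) (x : E p.d) : Set ℝ :=
  {α | x + α • K.Gdti i x ∈ K.bg ∧
    K.φdti i (x + α • K.Gdti i x) =
      (1 - K.b x (K.node i)) * K.φlini i x + K.b x (K.node i) * K.φdti i x}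

/-- `Ψ^Γ_{Δt,i}` -/
noncomputable def Ψdti (i : Fin (p.qt + 1)) (x : E p.d) : E p.d :=
  x + leastAbs (K.rootsdti i x) • K.Gdti i x

/-- `Ψ^Γ_{Δt}` -/
noncomputable def Ψdt (x : E p.d) (t : ℝ) : E p.d := ∑ i, K.ell i t • K.Ψdti i x

/-! ### The discrete mapping -/

/-- the polynomial extension of `φ_{h,i}` from the element `T` -/
noncomputable def ext (T : Simplex p.d) (i : Fin (p.qt + 1)) (x : E p.d) : ℝ :=
  MvPolynomial.eval (fun k => x k) (K.poly T i)

/-- the Lagrange node of order `q_s` of the element `T` with barycentric coordinates `β / q_s` -/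
noncomputable def lagNode (T : Simplex p.d) (β : Fin (p.d + 1) → ℕ) : E p.d :=
  ∑ j, ((β j : ℝ) / p.qs) • T j

/-- the Lagrange basis polynomial of degree `q_s` on `T` that belongs to `lagNode T β` -/
noncomputable def lagBasis (T : Simplex p.d) (β : Fin (p.d + 1) → ℕ) (x : E p.d) : ℝ :=
  ∏ j, ∏ m ∈ Finset.range (β j), (p.qs * T.coord j x - m) / ((β j : ℝ) - m)

/-- the Oswald-type interpolant of degree `q_s` of an elementwise continuous vector field `w` on
the elements of `A`: the Lagrange interpolant of the mean values of `w` over those elements of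
`A` that contain the respective node -/
noncomputable def oswald (A : Set (Simplex p.d)) (w : Simplex p.d → E p.d → E p.d)
    (T : Simplex p.d) (x : E p.d) : E p.d :=
  ∑ β ∈ Finset.piAntidiag Finset.univ p.qs,
    lagBasis T β x •
      ((({S ∈ A | lagNode T β ∈ hull S}.ncard : ℝ))⁻¹ •
        ∑ᶠ S ∈ {S ∈ A | lagNode T β ∈ hull S}, w S (lagNode T β))

/-- the discrete search direction `G_{h,i}` on the element `T` -/
noncomputable def Ghi (bl : Blending) (T : Simplex p.d) (i : Fin (p.qt + 1)) :
    SearchDir → E p.d → E p.d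
  | .gradient => fun x => _root_.gradient (K.ext T i) x
  | .averaged => oswald (K.active bl) (fun S y => _root_.gradient (K.ext S i) y) T

/-- the solutions of the equation that defines `d_{h,i}(x)` on the element `T` -/
def rootshi (bl : Blending) (sd : SearchDir) (T : Simplex p.d) (i : Fin (p.qt + 1))
    (x : E p.d) : Set ℝ :=
  {α | K.ext T i (x + α • K.Ghi bl T i sd x) =
      (1 - K.b x (K.node i)) * K.φlini i x + K.b x (K.node i) * K.φhi i x}

/-- `Ψ^Γ_{h,i}` on the element `T` -/
noncomputable def Ψhi (bl : Blending) (sd : SearchDir) (T : Simplex p.d) (i : Fin (p.qt + 1))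
    (x : E p.d) : E p.d :=
  x + leastAbs (K.rootshi bl sd T i x) • K.Ghi bl T i sd x

/-- `Ψ^Γ_h` on the element `T` -/
noncomputable def Ψh (bl : Blending) (sd : SearchDir) (T : Simplex p.d) (x : E p.d) (t : ℝ) :
    E p.d :=
  ∑ i, K.ell i t • K.Ψhi bl sd T i x

/-! ### Assumptions -/

/-- `mesh` is a conforming, shape regular simplicial triangulation of the open set `bg`. -/
structure IsTriangulation : Prop where
  isOpen : IsOpen K.bg
  finite : K.mesh.Finite
  cover : ⋃ T ∈ K.mesh, hull T = closure K.bg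
  inj : InjOn (fun T : Simplex p.d => range T) K.mesh
  conforming : ∀ T ∈ K.mesh, ∀ S ∈ K.mesh, hull T ∩ hull S = convexHull ℝ (range T ∩ range S)
  shape : ∀ T ∈ K.mesh, ∃ x, ∃ r > 0, closedBall x r ⊆ hull T ∧ diam (hull T) ≤ p.κ * r

/-- Assumptions on the exact level set function. -/
structure LevelSet : Prop where
  cont : ContinuousOn (Function.uncurry K.φ) (K.bg ×ˢ K.I)
  /-- the interface stays away from the boundary of the background domain -/
  dist_lt : ∀ t ∈ K.I, ∀ x ∈ frontier (K.Om t), ∀ y ∈ frontier K.bg, p.δΩ < dist x y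
  contDiff : ContDiffOn ℝ 2 (Function.uncurry K.φ) K.Ust
  grad_lower : ∀ t ∈ K.I, ∀ x ∈ K.U t, p.cφ ≤ ‖K.G x t‖
  grad_upper : ∀ t ∈ K.I, ∀ x ∈ K.U t, ‖K.G x t‖ ≤ p.Cφ
  dt_bound : ∀ t ∈ K.I, ∀ x ∈ K.U t, |derivWithin (fun s => K.φ x s) K.I t| ≤ p.M
  D2_bound : ∀ t ∈ K.I, ∀ x ∈ K.U t, ‖iteratedFDeriv ℝ 2 (fun y => K.φ y t) x‖ ≤ p.M
  dt_grad_bound : ∀ t ∈ K.I, ∀ x ∈ K.U t, ‖derivWithin (fun s => K.G x s) K.I t‖ ≤ p.M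
  /-- weak signed distance property -/
  wsd : ∀ t ∈ K.I, ∀ x ∈ K.U t, ∀ e e' : ℝ, |e| ≤ p.ε₀ → |e'| ≤ p.ε₀ →
    x + e • K.G x t ∈ K.bg ∧
    p.cw * |e - e'| ≤ |K.φ (x + e • K.G x t) t - K.φ (x + e' • K.G x t) t| ∧
    |K.φ (x + e • K.G x t) t - K.φ (x + e' • K.G x t) t| ≤ p.Cw * |e - e'|
  regular : BoundedW p.l p.M (Function.uncurry K.φ) (interior K.Ubar ×ˢ K.I)

/-- Assumptions on the discrete level set function: the `φ_{h,i}` are continuous finite element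
functions of degree `q_s`, and `φ_h` approximates `φ`. -/
structure DiscreteLevelSet : Prop where
  degree : ∀ T ∈ K.mesh, ∀ i, (K.poly T i).totalDegree ≤ p.qs
  eq_poly : ∀ T ∈ K.mesh, ∀ i, ∀ x ∈ hull T, K.φhi i x = K.ext T i x
  accurate : ∀ ms mt : ℕ, (ms ≤ p.qs + 1 ∧ mt ≤ 1) ∨ (ms = 0 ∧ mt ≤ p.qt + 1) →
    ∀ T ∈ K.meshU, ∀ x ∈ interior (hull T), ∀ t ∈ K.I,
      ‖iteratedFDeriv ℝ ms
        (fun y => iteratedDerivWithin mt (fun s => K.φ y s - K.φh y s) K.I t) x‖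
      ≤ p.M * (K.h ^ (p.qs + 1 - ms) + K.Δt ^ (p.qt + 1 - mt))

/-- Assumptions on the semi-discrete level set function. -/
structure SemiDiscreteLevelSet : Prop where
  cont : ∀ i, ContinuousOn (K.φdti i) K.bg
  contDiff : ∀ i, ContDiffOn ℝ (p.qs + 1 : ℕ) (K.φdti i) (interior K.Ubar)
  accurate_h : ∀ ms ≤ p.qs + 1, ∀ i, ∀ T ∈ K.meshU, ∀ x ∈ interior (hull T),
    ‖iteratedFDeriv ℝ ms (fun y => K.φdti i y - K.φhi i y) x‖ ≤ p.M * K.h ^ (p.qs + 1 - ms)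
  accurate : ∀ ms ≤ p.qs + 1, ∀ T ∈ K.meshU, ∀ x ∈ interior (hull T), ∀ t ∈ K.I,
    ‖iteratedFDeriv ℝ ms (fun y => K.φdt y t - K.φ y t) x‖
      ≤ p.M * (K.h ^ (p.qs + 1 - ms) + K.Δt ^ (p.qt + 1))

/-- Assumptions on the blending function. -/
def IsBlending : Blending → Prop
  | .finiteElement => ∀ x t, K.b x t = 0
  | .smooth =>
      (∀ x ∈ K.bg, ∀ t ∈ K.I, K.b x t ∈ Icc (0 : ℝ) 1) ∧
      (∀ T ∈ K.cut, ∀ x ∈ hull T, ∀ t ∈ K.I, K.b x t = 0) ∧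
      (∀ t ∈ K.I, ∀ x ∈ K.bg,
        ENNReal.ofReal p.wb < infEDist x (frontier (K.Omlin t)) → K.b x t = 1) ∧
      ContDiffOn ℝ p.l (Function.uncurry K.b) (K.bg ×ˢ K.I) ∧
      ∀ m ≤ p.l, ∀ z ∈ K.bg ×ˢ K.I,
        ‖iteratedFDerivWithin ℝ m (Function.uncurry K.b) (K.bg ×ˢ K.I) z‖ ≤ p.Cb

/-- All assumptions together. -/
structure Admissible (bl : Blending) : Prop where
  time_lt : K.t₀ < K.t₁
  triangulation : K.IsTriangulation
  levelSet : K.LevelSet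
  discrete : K.DiscreteLevelSet
  semiDiscrete : K.SemiDiscreteLevelSet
  blending : K.IsBlending bl
  /-- the active elements lie in the neighbourhood of the interface -/
  active_subset : K.active bl ⊆ K.meshU
  timeStep : K.Δt ^ (p.qt + 1) ≤ p.CΔ * K.h ^ (1 + p.ε)

end Config

end SpaceTimeMapping

namespace SpaceTimeMapping

open Filter Topology

/-! ### Roots of smallest absolute value -/

/-! Everything rests on the stability of a scalar root problem `f (x + α • V) = g`. If `f` is
C¹-close to φ(·,t) near x and V is close to ∇φ(x,t), the slope of `f` along V is at least cφ²/2 on a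
window |α| ≤ A h. The right-hand side blends f(x) with the linear interpolant, so g − f(x) = O(h).
Hence the window contains exactly one root, and this is the root of smallest absolute value
(`root_of_directional_lower_bound`, `exists_facts`). For this, active elements must stay a fixed
distance inside the region where φ is regular: φ^lin vanishes at a point not much farther than w_b,
so φ is small there at all times, and the weak signed distance property yields a true zero close to
it (`exists_ball_subset`).

At a time node the three mappings solve three such problems. `root_comparison` bounds the distance
of two roots by the errors in `f` and `g`, plus the step length times the error of the search
direction. The direction is one power of h less accurate than the function, but the step length is
O(h) and restores that power; in the difference of the right-hand sides φ^lin cancels. The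
polynomial extension is evaluated outside its element, where its error is recovered by a Taylor
argument from x, because its derivative of order q_s + 1 vanishes (`exists_nodal_comparison`).

Between the nodes there remains the error of interpolating Ψ and ∇Ψ in time. No time derivatives of
Ψ are taken. Instead, `Appr` says that a family of functions of time agrees, up to a tolerance η,
with polynomials in t − t₀ whose coefficients are uniformly bounded. Lagrange interpolation
reproduces powers up to q_t, and all higher powers are O(Δt^(q_t+1)), so such families have
interpolation error O(η) (`Appr.interpolation_error`). The class is closed under bilinear
operations, composition with regular functions (Taylor expansion), reciprocals (truncated geometric
series) and roots (chord iteration, `Appr.root`). Starting from φ and b near x and from the values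
of φ at the vertices of the element, it reaches d and Ψ and, through the explicit formula
`mapDeriv`, also ∇Ψ.

Two terms of ∇Ψ need care. D²φ is one order too rough, but occurs only multiplied by d = O(h). The
gradient of φ^lin is a sum of difference quotients of φ_h, with weights bounded by shape regularity.

The families are indexed by all points of active elements of all admissible configurations on fine
meshes, so a constant of the class is automatically uniform in the mesh, the time step and the level
set functions. -/

theorem leastAbs_eq {S : Set ℝ} {a A : ℝ} (ha : a ∈ S) (haA : |a| ≤ A)
    (huniq : ∀ a' ∈ S, |a'| ≤ A → a' = a) :
    (∃! a, IsLeastAbs S a) ∧ leastAbs S = a := by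
  have h1 : IsLeastAbs S a := by
    refine ⟨ha, fun a' ha' => ?_⟩
    by_contra! hlt
    have := huniq a' ha' (hlt.le.trans haA)
    rw [this] at hlt
    exact lt_irrefl _ hlt
  have h2 : ∀ a', IsLeastAbs S a' → a' = a := fun a' h' =>
    huniq a' h'.1 ((h'.2 a ha).trans haA)
  exact ⟨⟨a, h1, h2⟩, h2 _ (Classical.epsilon_spec (p := IsLeastAbs S) ⟨a, h1⟩)⟩

/-- Existence, uniqueness and size of the root of smallest absolute value along a line on which the
directional derivative is bounded from below. -/
theorem root_of_directional_lower_bound {E : Type*} [NormedAddCommGroup E] [NormedSpace ℝ E]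
    {f : E → ℝ} {f' : E → E →L[ℝ] ℝ} {x V : E} {c A g : ℝ} {D : Set E} (hc : 0 < c) (hA : 0 ≤ A)
    (hD : ∀ α : ℝ, |α| ≤ A → x + α • V ∈ D)
    (hf : ∀ α : ℝ, |α| ≤ A → HasFDerivAt f (f' (x + α • V)) (x + α • V))
    (hlow : ∀ α : ℝ, |α| ≤ A → c ≤ f' (x + α • V) V)
    (hg : |g - f x| ≤ c * A) :
    (∃! a, IsLeastAbs {α | x + α • V ∈ D ∧ f (x + α • V) = g} a) ∧
    f (x + leastAbs {α | x + α • V ∈ D ∧ f (x + α • V) = g} • V) = g ∧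
    c * |leastAbs {α | x + α • V ∈ D ∧ f (x + α • V) = g}| ≤ |g - f x| ∧
    ∀ α α' : ℝ, |α| ≤ A → |α'| ≤ A → c * |α - α'| ≤ |f (x + α • V) - f (x + α' • V)| := by
  have hder : ∀ α : ℝ, |α| ≤ A →
      HasDerivAt (fun α : ℝ => f (x + α • V)) (f' (x + α • V) V) α := by
    intro α hα
    have h1 : HasDerivAt (fun α : ℝ => x + α • V) V α := by
      simpa using ((hasDerivAt_id α).smul_const V).const_add x
    exact (hf α hα).comp_hasDerivAt α h1
  have hcont : ContinuousOn (fun α : ℝ => f (x + α • V)) (Icc (-A) A) := fun α hα =>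
    (hder α (abs_le.2 hα)).continuousAt.continuousWithinAt
  have hmono : ∀ α ∈ Icc (-A) A, ∀ α' ∈ Icc (-A) A, α ≤ α' →
      c * (α' - α) ≤ f (x + α' • V) - f (x + α • V) := by
    apply Convex.mul_sub_le_image_sub_of_le_deriv (convex_Icc _ _) hcont
    · intro α hα
      rw [interior_Icc] at hα
      exact (hder α (abs_le.2 ⟨hα.1.le, hα.2.le⟩)).differentiableAt.differentiableWithinAt
    · intro α hα
      rw [interior_Icc] at hα
      have : |α| ≤ A := abs_le.2 ⟨hα.1.le, hα.2.le⟩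
      rw [(hder α this).deriv]
      exact hlow α this
  have habs : ∀ α α' : ℝ, |α| ≤ A → |α'| ≤ A →
      c * |α - α'| ≤ |f (x + α • V) - f (x + α' • V)| := by
    intro α α' h h'
    rcases le_total α α' with hle | hle
    · have := hmono α (abs_le.1 h) α' (abs_le.1 h') hle
      rw [abs_sub_comm, abs_of_nonneg (sub_nonneg.2 hle), abs_sub_comm]
      exact this.trans (le_abs_self _)
    · have := hmono α' (abs_le.1 h') α (abs_le.1 h) hle
      rw [abs_of_nonneg (sub_nonneg.2 hle)]
      exact this.trans (le_abs_self _)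
  have h0 : (0 : ℝ) ∈ Icc (-A) A := ⟨by linarith, hA⟩
  have hAm : A ∈ Icc (-A) A := ⟨by linarith, le_rfl⟩
  have hAm' : -A ∈ Icc (-A) A := ⟨le_rfl, by linarith⟩
  -- Growth by at least c A on either side of 0 covers the offset |g − f x| ≤ c A.
  have hr : g ∈ Icc (f (x + (-A) • V)) (f (x + A • V)) := by
    have e1 := hmono 0 h0 A hAm hA
    have e2 := hmono (-A) hAm' 0 h0 (by linarith)
    simp only [zero_smul, add_zero] at e1 e2
    have := abs_le.1 hg
    constructor <;> linarith
  obtain ⟨a, ha, hag⟩ := intermediate_value_Icc (by linarith : -A ≤ A) hcont hr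
  simp only at hag
  have haA : |a| ≤ A := abs_le.2 ha
  -- Roots outside the window need no discussion: a competitor of smaller absolute value would lie
  -- in the window, where the slope bound leaves only `a`.
  obtain ⟨hu, heq⟩ := leastAbs_eq (S := {α | x + α • V ∈ D ∧ f (x + α • V) = g}) (a := a) (A := A)
    ⟨hD a haA, hag⟩ haA (by
      rintro a' ⟨-, ha'⟩ ha'A
      have := habs a' a ha'A haA
      rw [ha', hag, sub_self, abs_zero] at this
      have : |a' - a| ≤ 0 := by
        by_contra! hlt
        nlinarith
      exact sub_eq_zero.1 (abs_nonpos_iff.1 this))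
  refine ⟨hu, by rw [heq]; exact hag, ?_, habs⟩
  rw [heq]
  have := habs a 0 haA (by simpa using hA)
  simpa [hag] using this

/-- Comparison of two root problems along different lines. -/
theorem root_comparison {E : Type*} [NormedAddCommGroup E] [NormedSpace ℝ E]
    {f₁ f₂ : E → ℝ} {x V₁ V₂ : E} {g₁ g₂ α₁ α₂ c a b L : ℝ} (hc : 0 < c)
    (hlow : c * |α₁ - α₂| ≤ |f₁ (x + α₁ • V₁) - f₁ (x + α₂ • V₁)|)
    (h₁ : f₁ (x + α₁ • V₁) = g₁) (h₂ : f₂ (x + α₂ • V₂) = g₂) (hg : |g₁ - g₂| ≤ a)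
    (hf : |f₁ (x + α₂ • V₂) - f₂ (x + α₂ • V₂)| ≤ a)
    (hL : |f₁ (x + α₂ • V₂) - f₁ (x + α₂ • V₁)| ≤ L * (|α₂| * ‖V₂ - V₁‖))
    (hb : |α₂| * ‖V₂ - V₁‖ ≤ b) (hL0 : 0 ≤ L) :
    |α₁ - α₂| ≤ (2 * a + L * b) / c ∧
    ‖(x + α₁ • V₁) - (x + α₂ • V₂)‖ ≤ (2 * a + L * b) / c * ‖V₁‖ + b := by
  have h3 : |α₁ - α₂| ≤ (2 * a + L * b) / c := by
    rw [le_div_iff₀ hc]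
    -- The values of `f₁` at the two parameters on the line along V₁ are connected through `g₁`,
    -- `g₂` and the value of `f₁` at the second root point, which lies on the line along V₂.
    have e : f₁ (x + α₁ • V₁) - f₁ (x + α₂ • V₁) = (g₁ - g₂) -
        (f₁ (x + α₂ • V₂) - f₂ (x + α₂ • V₂)) + (f₁ (x + α₂ • V₂) - f₁ (x + α₂ • V₁)) := by
      rw [h₁, h₂]; ring
    have h4 : |f₁ (x + α₁ • V₁) - f₁ (x + α₂ • V₁)| ≤ |g₁ - g₂| +
        |f₁ (x + α₂ • V₂) - f₂ (x + α₂ • V₂)| + |f₁ (x + α₂ • V₂) - f₁ (x + α₂ • V₁)| := by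
      rw [e]
      exact (abs_add_le _ _).trans (add_le_add_left (abs_sub _ _) _)
    have := mul_le_mul_of_nonneg_left hb hL0
    linarith
  refine ⟨h3, ?_⟩
  have e : (x + α₁ • V₁) - (x + α₂ • V₂) = (α₁ - α₂) • V₁ - α₂ • (V₂ - V₁) := by
    module
  rw [e]
  refine (norm_sub_le _ _).trans ?_
  rw [norm_smul, norm_smul, Real.norm_eq_abs, Real.norm_eq_abs]
  gcongr

/-- Differentiability of a root `y ↦ r y` of `f (y + r y • V y) = g y`. -/
theorem hasFDerivAt_root {E : Type*} [NormedAddCommGroup E] [NormedSpace ℝ E]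
    {f g r : E → ℝ} {V : E → E} {x : E} {ℓ γ : E →L[ℝ] ℝ} {V' : E →L[ℝ] E} {c : ℝ} (hc : 0 < c)
    (hf : HasFDerivAt f ℓ (x + r x • V x)) (hV : HasFDerivAt V V' x) (hg : HasFDerivAt g γ x)
    (hroot : ∀ᶠ y in 𝓝 x, f (y + r y • V y) = g y)
    (hlow : ∀ᶠ y in 𝓝 x, c * |r y - r x| ≤ |f (y + r y • V y) - f (y + r x • V y)|)
    (hu : ℓ (V x) ≠ 0) :
    HasFDerivAt r ((ℓ (V x))⁻¹ • (γ - ℓ.comp (ContinuousLinearMap.id ℝ E + r x • V'))) x := by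
  have hx0 : f (x + r x • V x) = g x := hroot.self_of_nhds
  have hk : HasFDerivAt (fun y => g y - f (y + r x • V y))
      (γ - ℓ.comp (ContinuousLinearMap.id ℝ E + r x • V')) x := by
    refine hg.sub ?_
    have h1 : HasFDerivAt (fun y => y + r x • V y) (ContinuousLinearMap.id ℝ E + r x • V') x :=
      (hasFDerivAt_id x).add (hV.const_smul (r x))
    exact HasFDerivAt.comp x hf h1
  -- Differentiability of `f` at the single point x + r x • V x is too weak for the implicit
  -- function theorem. Instead, the lower slope bound controls r y − r x by g y − f (y + r x • V y),
  -- a function differentiable at x and zero there; so r is Lipschitz at x.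
  have hO : (fun y => r y - r x) =O[𝓝 x] (fun y => y - x) := by
    have h1 := hk.isBigO_sub
    simp only [hx0, sub_self, sub_zero] at h1
    refine Asymptotics.IsBigO.trans ?_ h1
    refine Asymptotics.IsBigO.of_bound c⁻¹ ?_
    filter_upwards [hroot, hlow] with y h2 h3
    rw [h2] at h3
    rw [Real.norm_eq_abs, Real.norm_eq_abs, inv_mul_eq_div, le_div_iff₀ hc, mul_comm]
    exact h3
  -- The defect as a function of the pair (y, α). Along y ↦ (y, r y) it vanishes identically, so its
  -- linear part is o(y − x), which determines the derivative of r.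
  have hH : HasFDerivAt (fun z : E × ℝ => f (z.1 + z.2 • V z.1) - g z.1)
      (ℓ.comp (ContinuousLinearMap.fst ℝ E ℝ +
          (r x • V'.comp (ContinuousLinearMap.fst ℝ E ℝ) +
            (ContinuousLinearMap.snd ℝ E ℝ).smulRight (V x)))
        - γ.comp (ContinuousLinearMap.fst ℝ E ℝ)) (x, r x) := by
    have hfst : HasFDerivAt (fun z : E × ℝ => z.1) (ContinuousLinearMap.fst ℝ E ℝ) (x, r x) :=
      hasFDerivAt_fst
    have hsnd : HasFDerivAt (fun z : E × ℝ => z.2) (ContinuousLinearMap.snd ℝ E ℝ) (x, r x) :=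
      hasFDerivAt_snd
    have hV2 : HasFDerivAt (fun z : E × ℝ => V z.1) (V'.comp (ContinuousLinearMap.fst ℝ E ℝ))
        (x, r x) := HasFDerivAt.comp (x, r x) hV hfst
    have hin : HasFDerivAt (fun z : E × ℝ => z.1 + z.2 • V z.1)
        (ContinuousLinearMap.fst ℝ E ℝ +
          (r x • V'.comp (ContinuousLinearMap.fst ℝ E ℝ) +
            (ContinuousLinearMap.snd ℝ E ℝ).smulRight (V x))) (x, r x) :=
      hfst.add (hsnd.smul hV2)
    exact (HasFDerivAt.comp (x, r x) hf hin).sub (HasFDerivAt.comp (x, r x) hg hfst)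
  have htend : Tendsto (fun y => (y, r y)) (𝓝 x) (𝓝 (x, r x)) := by
    refine Tendsto.prodMk_nhds tendsto_id ?_
    have : Tendsto (fun y => r y - r x) (𝓝 x) (𝓝 0) := by
      refine hO.trans_tendsto ?_
      have : Tendsto (fun y => y - x) (𝓝 x) (𝓝 (x - x)) := tendsto_id.sub_const x
      simpa using this
    simpa using this.add_const (r x)
  have h5 := hH.isLittleO.comp_tendsto htend
  have h6 : (fun y => (γ - ℓ.comp (ContinuousLinearMap.id ℝ E + r x • V')) (y - x)
      - (r y - r x) * ℓ (V x)) =o[𝓝 x] (fun y => y - x) := by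
    have hbig : ((fun z : E × ℝ => z - (x, r x)) ∘ fun y => (y, r y)) =O[𝓝 x]
        (fun y => y - x) := by
      have : (fun y => ((y - x, r y - r x) : E × ℝ)) =O[𝓝 x] (fun y => y - x) :=
        (Asymptotics.isBigO_refl _ _).prod_left hO
      exact this
    refine (h5.trans_isBigO hbig).congr' ?_ EventuallyEq.rfl
    filter_upwards [hroot] with y hy
    simp [hy, hx0]
    ring
  refine HasFDerivAt.of_isLittleO ?_
  refine ((h6.const_mul_left (-(ℓ (V x))⁻¹))).congr_left ?_
  intro y
  simp
  field_simp
  ring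

end SpaceTimeMapping

namespace SpaceTimeMapping

open Filter Topology

/-! ### Families of functions that are uniformly close to polynomials in time -/

/-- Bounds on the time step sizes `Δ` and the tolerances `η` of a family. -/
structure Scale {ι : Type} (Δ η : ι → ℝ) : Prop where
  Δ_nonneg : ∀ i, 0 ≤ Δ i
  Δ_le : ∀ i, Δ i ≤ 1
  η_nonneg : ∀ i, 0 ≤ η i
  η_le : ∀ i, η i ≤ 2

/-- The functions `f i` agree on `[0, Δ i]` up to a multiple of `η i` with polynomials whose
coefficients are bounded uniformly in `i`. -/
def Appr {ι : Type} (Δ η : ι → ℝ) {W : Type} [NormedAddCommGroup W] [NormedSpace ℝ W]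
    (f : ι → ℝ → W) : Prop :=
  -- The index set, the exponents and the constant are common to the family; only the coefficients
  -- vary with `i`. Repeated exponents are allowed, so sums and products need no collecting of
  -- terms.
  ∃ (κ : Type) (_ : Fintype κ) (e : κ → ℕ) (C : ℝ), 0 ≤ C ∧ ∀ i, ∃ c : κ → W, (∀ a, ‖c a‖ ≤ C) ∧
    ∀ s ∈ Icc 0 (Δ i), ‖f i s - ∑ a, s ^ e a • c a‖ ≤ C * η i

namespace Appr

variable {ι : Type} {Δ η : ι → ℝ}
  {W : Type} [NormedAddCommGroup W] [NormedSpace ℝ W]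
  {W₁ : Type} [NormedAddCommGroup W₁] [NormedSpace ℝ W₁]
  {W₂ : Type} [NormedAddCommGroup W₂] [NormedSpace ℝ W₂]

theorem norm_poly_le {κ : Type} [Fintype κ] {e : κ → ℕ} {C s : ℝ} {c : κ → W}
    (hc : ∀ a, ‖c a‖ ≤ C) (hs0 : 0 ≤ s) (hs1 : s ≤ 1) :
    ‖∑ a, s ^ e a • c a‖ ≤ Fintype.card κ * C := by
  refine (norm_sum_le _ _).trans ?_
  have : ∀ a ∈ Finset.univ, ‖s ^ e a • c a‖ ≤ C := by
    intro a _
    rw [norm_smul, Real.norm_eq_abs, abs_of_nonneg (pow_nonneg hs0 _)]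
    exact (mul_le_of_le_one_left (norm_nonneg _) (pow_le_one₀ hs0 hs1)).trans (hc a)
  simpa using Finset.sum_le_sum this

theorem bounded (hS : Scale Δ η) {f : ι → ℝ → W} (hf : Appr Δ η f) :
    ∃ C, 0 ≤ C ∧ ∀ i, ∀ s ∈ Icc 0 (Δ i), ‖f i s‖ ≤ C := by
  obtain ⟨κ, _, e, C, hC, h⟩ := hf
  refine ⟨C * 2 + Fintype.card κ * C, by positivity, fun i s hs => ?_⟩
  obtain ⟨c, hc, hf⟩ := h i
  have h1 := hf s hs
  have h2 := norm_poly_le (e := e) hc hs.1 (hs.2.trans (hS.Δ_le i))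
  have h3 : C * η i ≤ C * 2 := mul_le_mul_of_nonneg_left (hS.η_le i) hC
  calc ‖f i s‖ = ‖(f i s - ∑ a, s ^ e a • c a) + ∑ a, s ^ e a • c a‖ := by rw [sub_add_cancel]
    _ ≤ _ := norm_add_le _ _
    _ ≤ _ := by linarith

theorem of_near {f g : ι → ℝ → W} (hf : Appr Δ η f) {C : ℝ} (hη : ∀ i, 0 ≤ η i)
    (h : ∀ i, ∀ s ∈ Icc 0 (Δ i), ‖g i s - f i s‖ ≤ C * η i) : Appr Δ η g := by
  obtain ⟨κ, hκ, e, C', hC', hf⟩ := hf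
  refine ⟨κ, hκ, e, C' + |C|, by positivity, fun i => ?_⟩
  obtain ⟨c, hc, hf⟩ := hf i
  refine ⟨c, fun a => (hc a).trans (by linarith [abs_nonneg C]), fun s hs => ?_⟩
  have h1 := hf s hs
  have h2 := h i s hs
  have h3 : C * η i ≤ |C| * η i := mul_le_mul_of_nonneg_right (le_abs_self C) (hη i)
  calc ‖g i s - ∑ a, s ^ e a • c a‖ = ‖(g i s - f i s) + (f i s - ∑ a, s ^ e a • c a)‖ := by
        rw [sub_add_sub_cancel]
    _ ≤ _ := norm_add_le _ _
    _ ≤ _ := by linarith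

theorem congr {f g : ι → ℝ → W} (hf : Appr Δ η f)
    (h : ∀ i, ∀ s ∈ Icc 0 (Δ i), g i s = f i s) : Appr Δ η g := by
  obtain ⟨κ, hκ, e, C, hC, hf⟩ := hf
  refine ⟨κ, hκ, e, C, hC, fun i => ?_⟩
  obtain ⟨c, hc, hf⟩ := hf i
  exact ⟨c, hc, fun s hs => by rw [h i s hs]; exact hf s hs⟩

theorem mono_tol {η' : ι → ℝ} {f : ι → ℝ → W} (hf : Appr Δ η f) {K : ℝ}
    (h : ∀ i, η i ≤ K * η' i) (hη' : ∀ i, 0 ≤ η' i) : Appr Δ η' f := by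
  obtain ⟨κ, hκ, e, C, hC, hf⟩ := hf
  refine ⟨κ, hκ, e, C + C * |K|, by positivity, fun i => ?_⟩
  obtain ⟨c, hc, hf⟩ := hf i
  refine ⟨c, fun a => (hc a).trans (le_add_of_nonneg_right (by positivity)),
    fun s hs => (hf s hs).trans ?_⟩
  have h1 : C * η i ≤ C * (|K| * η' i) := mul_le_mul_of_nonneg_left
    ((h i).trans (mul_le_mul_of_nonneg_right (le_abs_self K) (hη' i))) hC
  have := mul_nonneg hC (hη' i)
  linarith

theorem const {w : ι → W} {C : ℝ} (hw : ∀ i, ‖w i‖ ≤ C) (hη : ∀ i, 0 ≤ η i) :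
    Appr Δ η (fun i _ => w i) := by
  refine ⟨Unit, inferInstance, fun _ => 0, |C|, abs_nonneg _, fun i => ⟨fun _ => w i, fun _ =>
    (hw i).trans (le_abs_self C), fun s _ => ?_⟩⟩
  simpa using mul_nonneg (abs_nonneg C) (hη i)

theorem time (hη : ∀ i, 0 ≤ η i) : Appr Δ η (fun _ s => s) := by
  refine ⟨Unit, inferInstance, fun _ => 1, 1, zero_le_one, fun i => ⟨fun _ => 1, fun _ => by simp,
    fun s _ => ?_⟩⟩
  simpa using hη i

theorem add {f g : ι → ℝ → W} (hf : Appr Δ η f) (hg : Appr Δ η g) :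
    Appr Δ η (fun i s => f i s + g i s) := by
  obtain ⟨κ, _, e, C, hC, hf⟩ := hf
  obtain ⟨κ', _, e', C', hC', hg⟩ := hg
  refine ⟨κ ⊕ κ', inferInstance, Sum.elim e e', C + C', by positivity, fun i => ?_⟩
  obtain ⟨c, hc, hf⟩ := hf i
  obtain ⟨c', hc', hg⟩ := hg i
  refine ⟨Sum.elim c c', ?_, fun s hs => ?_⟩
  · rintro (a | a)
    · exact (hc a).trans (by linarith)
    · exact (hc' a).trans (by linarith)
  · rw [Fintype.sum_sum_type]
    simp only [Sum.elim_inl, Sum.elim_inr]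
    rw [add_sub_add_comm, add_mul]
    exact (norm_add_le _ _).trans (add_le_add (hf s hs) (hg s hs))

/-- Scalar multiples, evaluations, compositions and rank-one operators are all instances of this.
With P, Q the approximating polynomials, B(f,g) − B(P,Q) = B(f − P, g) + B(P, g − Q), and both g and
P are bounded because Δ ≤ 1 and η ≤ 2. -/
theorem bilin (hS : Scale Δ η) (B : W →L[ℝ] W₁ →L[ℝ] W₂) {f : ι → ℝ → W} {g : ι → ℝ → W₁}
    (hf : Appr Δ η f) (hg : Appr Δ η g) : Appr Δ η (fun i s => B (f i s) (g i s)) := by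
  obtain ⟨G, hG, hgb⟩ := hg.bounded hS
  obtain ⟨κ, _, e, C, hC, hf⟩ := hf
  obtain ⟨κ', _, e', C', hC', hg⟩ := hg
  have hnn : 0 ≤ ‖B‖ * C * C' := by positivity
  have hmm : 0 ≤ ‖B‖ * C * G + ‖B‖ * (Fintype.card κ * C) * C' := by positivity
  refine ⟨κ × κ', inferInstance, fun a => e a.1 + e' a.2,
    ‖B‖ * C * C' + (‖B‖ * C * G + ‖B‖ * (Fintype.card κ * C) * C'), by positivity, fun i => ?_⟩
  obtain ⟨c, hc, hf⟩ := hf i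
  obtain ⟨c', hc', hg⟩ := hg i
  refine ⟨fun a => B (c a.1) (c' a.2), fun a => ?_, fun s hs => ?_⟩
  · have h1 : ‖B (c a.1) (c' a.2)‖ ≤ ‖B‖ * C * C' := (B.le_opNorm₂ _ _).trans (by
      gcongr
      · exact hc _
      · exact hc' _)
    linarith
  · have e1 : ∑ a : κ × κ', s ^ (e a.1 + e' a.2) • B (c a.1) (c' a.2) =
        B (∑ a, s ^ e a • c a) (∑ a, s ^ e' a • c' a) := by
      rw [Fintype.sum_prod_type]
      simp only [map_sum, map_smul, sum_apply, smul_apply]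
      rw [Finset.sum_comm]
      refine Finset.sum_congr rfl fun a _ => ?_
      rw [Finset.smul_sum]
      refine Finset.sum_congr rfl fun b _ => ?_
      rw [smul_smul, pow_add, mul_comm]
    rw [e1]
    have e2 : B (f i s) (g i s) - B (∑ a, s ^ e a • c a) (∑ a, s ^ e' a • c' a) =
        B (f i s - ∑ a, s ^ e a • c a) (g i s) +
          B (∑ a, s ^ e a • c a) (g i s - ∑ a, s ^ e' a • c' a) := by
      simp only [map_sub, sub_apply]
      abel
    rw [e2]
    have hηi := hS.η_nonneg i
    have h1 : ‖B (f i s - ∑ a, s ^ e a • c a) (g i s)‖ ≤ ‖B‖ * (C * η i) * G :=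
      (B.le_opNorm₂ _ _).trans (by
        gcongr
        · exact hf s hs
        · exact hgb i s hs)
    have h2 : ‖B (∑ a, s ^ e a • c a) (g i s - ∑ a, s ^ e' a • c' a)‖ ≤
        ‖B‖ * (Fintype.card κ * C) * (C' * η i) :=
      (B.le_opNorm₂ _ _).trans (by
        gcongr
        · exact norm_poly_le hc hs.1 (hs.2.trans (hS.Δ_le i))
        · exact hg s hs)
    refine (norm_add_le _ _).trans ((add_le_add h1 h2).trans ?_)
    have := mul_nonneg hnn hηi
    linarith

theorem smul (hS : Scale Δ η) {f : ι → ℝ → ℝ} {g : ι → ℝ → W} (hf : Appr Δ η f)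
    (hg : Appr Δ η g) : Appr Δ η (fun i s => f i s • g i s) :=
  bilin hS (ContinuousLinearMap.lsmul ℝ ℝ) hf hg

theorem mul (hS : Scale Δ η) {f g : ι → ℝ → ℝ} (hf : Appr Δ η f)
    (hg : Appr Δ η g) : Appr Δ η (fun i s => f i s * g i s) := hf.smul hS hg

theorem apply (hS : Scale Δ η) {f : ι → ℝ → (W →L[ℝ] W₁)} {g : ι → ℝ → W} (hf : Appr Δ η f)
    (hg : Appr Δ η g) : Appr Δ η (fun i s => f i s (g i s)) :=
  bilin hS (ContinuousLinearMap.id ℝ _) hf hg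

theorem clm (hS : Scale Δ η) (L : W →L[ℝ] W₁) {f : ι → ℝ → W} (hf : Appr Δ η f) :
    Appr Δ η (fun i s => L (f i s)) :=
  apply hS (const (w := fun _ => L) (fun _ => le_rfl) hS.η_nonneg) hf

theorem comp (hS : Scale Δ η) {f : ι → ℝ → (W₁ →L[ℝ] W₂)} {g : ι → ℝ → (W →L[ℝ] W₁)}
    (hf : Appr Δ η f) (hg : Appr Δ η g) : Appr Δ η (fun i s => (f i s).comp (g i s)) :=
  bilin hS (ContinuousLinearMap.compL ℝ W W₁ W₂) hf hg

theorem smulRight (hS : Scale Δ η) {f : ι → ℝ → (W →L[ℝ] ℝ)} {g : ι → ℝ → W₁}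
    (hf : Appr Δ η f) (hg : Appr Δ η g) : Appr Δ η (fun i s => (f i s).smulRight (g i s)) :=
  bilin hS (ContinuousLinearMap.smulRightL ℝ W W₁) hf hg

theorem neg (hS : Scale Δ η) {f : ι → ℝ → W} (hf : Appr Δ η f) : Appr Δ η (fun i s => -f i s) :=
  clm hS (-(ContinuousLinearMap.id ℝ W)) hf

theorem sub (hS : Scale Δ η) {f g : ι → ℝ → W} (hf : Appr Δ η f) (hg : Appr Δ η g) :
    Appr Δ η (fun i s => f i s - g i s) :=
  (hf.add (hg.neg hS)).congr fun _ _ _ => sub_eq_add_neg _ _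

theorem sum (hS : Scale Δ η) {κ : Type*} (A : Finset κ) {f : κ → ι → ℝ → W}
    (hf : ∀ a ∈ A, Appr Δ η (f a)) : Appr Δ η (fun i s => ∑ a ∈ A, f a i s) := by
  classical
  induction A using Finset.induction_on with
  | empty => simpa using const (w := fun _ : ι => (0 : W)) (C := 0) (by simp) hS.η_nonneg
  | insert a A ha ih =>
    refine ((hf a (Finset.mem_insert_self _ _)).add
      (ih fun b hb => hf b (Finset.mem_insert_of_mem hb))).congr fun i s _ => ?_
    rw [Finset.sum_insert ha]

theorem pow (hS : Scale Δ η) {f : ι → ℝ → ℝ} (hf : Appr Δ η f) (n : ℕ) :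
    Appr Δ η (fun i s => f i s ^ n) := by
  induction n with
  | zero => simpa using const (w := fun _ : ι => (1 : ℝ)) (C := 1) (by simp) hS.η_nonneg
  | succ n ih => exact (ih.mul hS hf).congr fun i s _ => pow_succ _ _

theorem prodMk (hS : Scale Δ η) {f : ι → ℝ → W} {g : ι → ℝ → W₁} (hf : Appr Δ η f)
    (hg : Appr Δ η g) : Appr Δ η (fun i s => (f i s, g i s)) :=
  ((hf.clm hS (ContinuousLinearMap.inl ℝ W W₁)).add
    (hg.clm hS (ContinuousLinearMap.inr ℝ W W₁))).congr fun i s _ => by simp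

/-- Inverse of a scalar family that is close to constants. -/
theorem inv (hS : Scale Δ η) {u : ι → ℝ → ℝ} {u₀ θ : ι → ℝ} {c C K : ℝ} {N : ℕ} (hc : 0 < c)
    (hu : Appr Δ η u) (hu₀ : ∀ i, c ≤ u₀ i) (hlow : ∀ i, ∀ s ∈ Icc 0 (Δ i), c ≤ u i s)
    (hnear : ∀ i, ∀ s ∈ Icc 0 (Δ i), |u₀ i - u i s| ≤ C * θ i) (hθ : ∀ i, θ i ^ N ≤ K * η i)
    (hC : 0 ≤ C) (hu₀b : ∀ i, u₀ i ≤ C) : Appr Δ η (fun i s => (u i s)⁻¹) := by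
  have hinv : Appr Δ η (fun i (_ : ℝ) => (u₀ i)⁻¹) := const (C := c⁻¹) (fun i => by
    rw [Real.norm_eq_abs, abs_of_pos (inv_pos.2 (hc.trans_le (hu₀ i)))]
    exact inv_anti₀ hc (hu₀ i)) hS.η_nonneg
  have hconst : Appr Δ η (fun i (_ : ℝ) => u₀ i) := const (C := C) (fun i => by
    rw [Real.norm_eq_abs, abs_of_pos (hc.trans_le (hu₀ i))]; exact hu₀b i) hS.η_nonneg
  have hr : Appr Δ η (fun i s => (u₀ i - u i s) * (u₀ i)⁻¹) :=
    ((hconst.sub hS hu).mul hS hinv)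
  -- Truncated geometric series for 1/u = u₀⁻¹ (1 − r)⁻¹ with r = (u₀ − u)/u₀. The remainder is
  -- exactly r^N / u, so r need not be small: the lower bound on u and the bound on θ^N suffice.
  have hsum : Appr Δ η (fun i s => (u₀ i)⁻¹ *
      ∑ k ∈ Finset.range N, ((u₀ i - u i s) * (u₀ i)⁻¹) ^ k) :=
    hinv.mul hS (Appr.sum hS _ fun k _ => hr.pow hS k)
  refine hsum.of_near (C := (C * c⁻¹) ^ N * K * c⁻¹) hS.η_nonneg fun i s hs => ?_
  have hu0 : 0 < u₀ i := hc.trans_le (hu₀ i)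
  have hus : 0 < u i s := hc.trans_le (hlow i s hs)
  set r := (u₀ i - u i s) * (u₀ i)⁻¹ with hrdef
  have e1 : (u i s)⁻¹ - (u₀ i)⁻¹ * ∑ k ∈ Finset.range N, r ^ k = r ^ N * (u i s)⁻¹ := by
    have hr1 : (1 - r) * u₀ i = u i s := by rw [hrdef]; field_simp; ring
    have hne : 1 - r ≠ 0 := by
      intro h0; rw [h0, zero_mul] at hr1; exact hus.ne hr1
    have hg := mul_neg_geom_sum r N
    have : ∑ k ∈ Finset.range N, r ^ k = (1 - r ^ N) / (1 - r) := by
      rw [eq_div_iff hne, mul_comm]; exact hg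
    rw [this, ← hr1]
    field_simp
    ring
  rw [e1, norm_mul, norm_pow, Real.norm_eq_abs, Real.norm_eq_abs, abs_of_pos (inv_pos.2 hus)]
  have hr2 : |r| ≤ C * c⁻¹ * θ i := by
    rw [hrdef, abs_mul, abs_of_pos (inv_pos.2 hu0)]
    calc _ ≤ C * θ i * c⁻¹ := by
          gcongr
          · exact (abs_nonneg _).trans (hnear i s hs)
          · exact hnear i s hs
          · exact hu₀ i
      _ = _ := by ring
  have h3 : |r| ^ N ≤ (C * c⁻¹) ^ N * (K * η i) := by
    refine (pow_le_pow_left₀ (abs_nonneg _) hr2 N).trans ?_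
    rw [mul_pow]
    gcongr
    exact hθ i
  have h4 : (u i s)⁻¹ ≤ c⁻¹ := inv_anti₀ hc (hlow i s hs)
  calc |r| ^ N * (u i s)⁻¹ ≤ (C * c⁻¹) ^ N * (K * η i) * c⁻¹ := by
        gcongr
        exact (pow_nonneg (abs_nonneg r) N).trans h3
    _ = _ := by ring

end Appr

/-! ### Taylor expansion of regular families -/

/-- The functions `g i` are `n` times differentiable on `B i`, with derivatives up to order `n`
bounded and the derivative of order `n` Lipschitz continuous, uniformly in `i`. -/
def Reg {ι : Type} {F : Type} [NormedAddCommGroup F] [NormedSpace ℝ F] (B : ι → Set F) :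
    ℕ → ∀ {W : Type} [NormedAddCommGroup W] [NormedSpace ℝ W], (ι → F → W) → Prop
  | 0, _, _, _, g => ∃ M, 0 ≤ M ∧ ∀ i, ∀ z ∈ B i, ‖g i z‖ ≤ M ∧
      ∀ z' ∈ B i, ‖g i z - g i z'‖ ≤ M * ‖z - z'‖
  | n + 1, W, _, _, g => (∃ M, ∀ i, ∀ z ∈ B i, ‖g i z‖ ≤ M) ∧
      ∃ g' : ι → F → (F →L[ℝ] W),
        (∀ i, ∀ z ∈ B i, HasFDerivWithinAt (g i) (g' i z) (B i) z) ∧ Reg B n g'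

namespace Reg

variable {ι : Type} {F : Type} [NormedAddCommGroup F] [NormedSpace ℝ F] {B : ι → Set F}
  {W : Type} [NormedAddCommGroup W] [NormedSpace ℝ W]

theorem bounded {n : ℕ} {g : ι → F → W} (hg : Reg B n g) :
    ∃ M, 0 ≤ M ∧ ∀ i, ∀ z ∈ B i, ‖g i z‖ ≤ M := by
  cases n with
  | zero => obtain ⟨M, hM, h⟩ := hg; exact ⟨M, hM, fun i z hz => (h i z hz).1⟩
  | succ n =>
    obtain ⟨⟨M, h⟩, _⟩ := hg
    exact ⟨|M|, abs_nonneg _, fun i z hz => (h i z hz).trans (le_abs_self _)⟩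

theorem lipschitz (hB : ∀ i, Convex ℝ (B i)) {n : ℕ} {g : ι → F → W} (hg : Reg B n g) :
    ∃ M, 0 ≤ M ∧ ∀ i, ∀ z ∈ B i, ∀ z' ∈ B i, ‖g i z - g i z'‖ ≤ M * ‖z - z'‖ := by
  cases n with
  | zero => obtain ⟨M, hM, h⟩ := hg; exact ⟨M, hM, fun i z hz => (h i z hz).2⟩
  | succ n =>
    obtain ⟨_, g', hd, hg'⟩ := hg
    obtain ⟨M, hM, h⟩ := hg'.bounded
    exact ⟨M, hM, fun i z hz z' hz' =>
      (hB i).norm_image_sub_le_of_norm_hasFDerivWithin_le (hd i) (h i) hz' hz⟩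

/-- The iterated derivatives are those within the larger sets `S`, where the hypotheses on the data
are stated and derivatives are unique. Passing to the derivative within `S` lowers the order by one,
matching the recursion of `Reg`. -/
theorem of_bounds {S : ι → Set F} (hS : ∀ i, UniqueDiffOn ℝ (S i)) (hBS : ∀ i, B i ⊆ S i) {M : ℝ}
    (hM : 0 ≤ M) (n : ℕ) {g : ι → F → W} (hc : ∀ i, ContDiffOn ℝ n (g i) (S i))
    (hb : ∀ i, ∀ m ≤ n, ∀ z ∈ B i, ‖iteratedFDerivWithin ℝ m (g i) (S i) z‖ ≤ M)
    (hl : ∀ i, ∀ z ∈ B i, ∀ z' ∈ B i, ‖iteratedFDerivWithin ℝ n (g i) (S i) z -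
      iteratedFDerivWithin ℝ n (g i) (S i) z'‖ ≤ M * ‖z - z'‖) :
    Reg B n g := by
  induction n generalizing W with
  | zero =>
    refine ⟨M, hM, fun i z hz => ⟨?_, fun z' hz' => ?_⟩⟩
    · simpa using hb i 0 le_rfl z hz
    · have := hl i z hz z' hz'
      rw [iteratedFDerivWithin_zero_eq_comp] at this
      simpa only [Function.comp_apply, ← map_sub, LinearIsometryEquiv.norm_map] using this
  | succ n ih =>
    refine ⟨⟨M, fun i z hz => by simpa using hb i 0 (Nat.zero_le _) z hz⟩,
      fun i => fderivWithin ℝ (g i) (S i), fun i z hz => ?_, ih (fun i => ?_) ?_ ?_⟩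
    · exact (((hc i).differentiableOn (by simp)) z (hBS i hz)).hasFDerivWithinAt.mono (hBS i)
    · exact (hc i).fderivWithin (hS i) (by norm_cast)
    · intro i m hm z hz
      rw [norm_iteratedFDerivWithin_fderivWithin (hS i) (hBS i hz)]
      exact hb i (m + 1) (by omega) z hz
    · intro i z hz z' hz'
      have := hl i z hz z' hz'
      rw [iteratedFDerivWithin_succ_eq_comp_right (hS i) (hBS i hz),
        iteratedFDerivWithin_succ_eq_comp_right (hS i) (hBS i hz')] at this
      rw [← dist_eq_norm, Function.comp_apply, Function.comp_apply, LinearIsometryEquiv.dist_map,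
        dist_eq_norm] at this
      exact this

/-- Taylor expansion with remainder, uniformly in the family. -/
theorem taylor {Δ η : ι → ℝ} (hS : Scale Δ η) (hB : ∀ i, Convex ℝ (B i)) (n : ℕ)
    {g : ι → F → W} (hg : Reg B n g) :
    ∃ Q : ℕ → ι → F → F → W,
      (∀ m i z (s : ℝ) w, Q m i z (s • w) = s ^ m • Q m i z w) ∧
      (∀ m ≤ n, ∀ z : ι → F, (∀ i, z i ∈ B i) → ∀ w : ι → ℝ → F, Appr Δ η w →
        Appr Δ η (fun i s => Q m i (z i) (w i s))) ∧
      ∃ C, 0 ≤ C ∧ ∀ i, ∀ z ∈ B i, ∀ w, z + w ∈ B i →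
        ‖g i (z + w) - ∑ m ∈ Finset.range (n + 1), Q m i z w‖ ≤ C * ‖w‖ ^ (n + 1) := by
  induction n generalizing W with
  | zero =>
    obtain ⟨M, hM, h⟩ := hg
    refine ⟨fun m i z w => if m = 0 then g i z else 0, ?_, ?_, M, hM, ?_⟩
    · intro m i z s w
      by_cases hm : m = 0 <;> simp [hm]
    · intro m hm z hz w _
      obtain rfl : m = 0 := by omega
      simp only [if_true]
      exact Appr.const (C := M) (fun i => (h i _ (hz i)).1) hS.η_nonneg
    · intro i z hz w hw
      simpa using (h i _ hw).2 z hz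
  | succ n ih =>
    obtain ⟨⟨M, hM⟩, g', hd, hg'⟩ := hg
    obtain ⟨Q', hhom, happ, C, hC, hrem⟩ := ih hg'
    -- Integrating the degree m term of the expansion of g' along the segment s ↦ z + s w gives the
    -- degree m + 1 term of g, with factor 1/(m + 1).
    refine ⟨fun m i z w => match m with
      | 0 => g i z
      | m + 1 => ((m : ℝ) + 1)⁻¹ • Q' m i z w w, ?_, ?_, C, hC, ?_⟩
    · intro m i z s w
      cases m with
      | zero => simp
      | succ m =>
        simp only [hhom, map_smul, smul_apply]
        module
    · intro m hm z hz w hw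
      cases m with
      | zero => exact Appr.const (C := M) (fun i => hM i _ (hz i)) hS.η_nonneg
      | succ m =>
        exact ((happ m (by omega) z hz w hw).apply hS hw).clm hS
          (((m : ℝ) + 1)⁻¹ • ContinuousLinearMap.id ℝ W)
    · intro i z hz w hw
      rw [Finset.sum_range_succ']
      have hmem : ∀ s ∈ Icc (0 : ℝ) 1, z + s • w ∈ B i := fun s hs =>
        (hB i).add_smul_mem hz hw hs
      -- By homogeneity of the terms, the derivative in s of the remainder along the segment is the
      -- remainder of g' at s w, applied to w; the mean value inequality then gains one power of
      -- ‖w‖.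
      have hder : ∀ s ∈ Icc (0 : ℝ) 1, HasDerivWithinAt
          (fun s : ℝ => g i (z + s • w) - ∑ m ∈ Finset.range (n + 1),
            s ^ (m + 1) • (((m : ℝ) + 1)⁻¹ • Q' m i z w w))
          (g' i (z + s • w) w - ∑ m ∈ Finset.range (n + 1), s ^ m • Q' m i z w w)
          (Icc 0 1) s := by
        intro s hs
        have h1 : HasDerivWithinAt (fun s : ℝ => z + s • w) w (Icc 0 1) s := by
          simpa using (((hasDerivAt_id s).smul_const w).const_add z).hasDerivWithinAt
        refine HasDerivWithinAt.sub ((hd i _ (hmem s hs)).comp_hasDerivWithinAt s h1 hmem) ?_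
        refine HasDerivWithinAt.fun_sum fun m _ => ?_
        have h2 := ((hasDerivAt_pow (m + 1) s).smul_const
          (((m : ℝ) + 1)⁻¹ • Q' m i z w w)).hasDerivWithinAt (s := Icc 0 1)
        convert h2 using 1
        simp only [Nat.add_sub_cancel, Nat.cast_add, Nat.cast_one, smul_smul]
        congr 1
        field_simp
      have hbound : ∀ s ∈ Icc (0 : ℝ) 1,
          ‖g' i (z + s • w) w - ∑ m ∈ Finset.range (n + 1), s ^ m • Q' m i z w w‖ ≤
            C * ‖w‖ ^ (n + 1 + 1) := by
        intro s hs
        have h3 := hrem i z hz (s • w) (hmem s hs)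
        simp only [hhom] at h3
        have e : g' i (z + s • w) w - ∑ m ∈ Finset.range (n + 1), s ^ m • Q' m i z w w =
            (g' i (z + s • w) - ∑ m ∈ Finset.range (n + 1), s ^ m • Q' m i z w) w := by
          simp
        rw [e, pow_succ, ← mul_assoc]
        refine (ContinuousLinearMap.le_opNorm _ _).trans ?_
        gcongr
        refine h3.trans ?_
        gcongr
        rw [norm_smul, Real.norm_eq_abs, abs_of_nonneg hs.1]
        exact mul_le_of_le_one_left (norm_nonneg _) hs.2
      have := (convex_Icc (0 : ℝ) 1).norm_image_sub_le_of_norm_hasDerivWithin_le hder hbound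
        (left_mem_Icc.2 zero_le_one) (right_mem_Icc.2 zero_le_one)
      simp only [one_smul, zero_smul, add_zero, one_pow, sub_zero, norm_one, mul_one] at this
      refine le_trans (le_of_eq ?_) this
      congr 1
      simp
      abel

/-- A regular family composed with curves that are close to polynomials. -/
theorem appr_comp {Δ η : ι → ℝ} (hS : Scale Δ η) (hB : ∀ i, Convex ℝ (B i)) {n : ℕ}
    {g : ι → F → W} (hg : Reg B n g) {z : ι → F} (hz : ∀ i, z i ∈ B i) {w : ι → ℝ → F}
    (hw : Appr Δ η w) (hzw : ∀ i, ∀ s ∈ Icc 0 (Δ i), z i + w i s ∈ B i) {K : ℝ}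
    (hη : ∀ i, ∀ s ∈ Icc 0 (Δ i), ‖w i s‖ ^ (n + 1) ≤ K * η i) :
    Appr Δ η (fun i s => g i (z i + w i s)) := by
  obtain ⟨Q, -, happ, C, hC, hrem⟩ := hg.taylor hS hB n
  have h1 : Appr Δ η (fun i s => ∑ m ∈ Finset.range (n + 1), Q m i (z i) (w i s)) :=
    Appr.sum hS _ fun m hm => happ m (by simpa [Nat.lt_succ_iff] using hm) z hz w hw
  refine h1.of_near (C := C * K) hS.η_nonneg fun i s hs => ?_
  refine (hrem i _ (hz i) _ (hzw i s hs)).trans ?_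
  rw [mul_assoc]
  exact mul_le_mul_of_nonneg_left (hη i s hs) hC

end Reg

end SpaceTimeMapping

namespace SpaceTimeMapping

open Filter Topology

/-! ### Lagrange interpolation in time -/

namespace Config

variable {p : Params} (K : Config p)

theorem node_mem (hK : K.t₀ < K.t₁) (i : Fin (p.qt + 1)) : K.node i ∈ K.I := by
  have h := p.τ_mem i
  have hΔ : 0 < K.Δt := sub_pos.2 hK
  have h1 : p.τ i * K.Δt ≤ 1 * K.Δt := mul_le_mul_of_nonneg_right h.2 hΔ.le
  have h2 : 0 ≤ p.τ i * K.Δt := mul_nonneg h.1 hΔ.le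
  have h3 : K.Δt = K.t₁ - K.t₀ := rfl
  constructor <;> simp only [node] <;> linarith

theorem node_injective (hK : K.t₀ < K.t₁) : Function.Injective K.node := by
  intro i j hij
  have hΔ : K.Δt ≠ 0 := (sub_pos.2 hK).ne'
  apply p.τ_inj
  have : p.τ i * K.Δt = p.τ j * K.Δt := by simpa [node] using hij
  exact mul_right_cancel₀ hΔ this

theorem ell_node_self (hK : K.t₀ < K.t₁) (i : Fin (p.qt + 1)) : K.ell i (K.node i) = 1 :=
  Lagrange.eval_basis_self (K.node_injective hK).injOn (Finset.mem_univ i)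

theorem ell_node_of_ne {i j : Fin (p.qt + 1)} (hij : i ≠ j) : K.ell i (K.node j) = 0 :=
  Lagrange.eval_basis_of_ne hij (Finset.mem_univ j)

theorem sum_ell_node_smul (hK : K.t₀ < K.t₁) {W : Type*} [AddCommGroup W] [Module ℝ W]
    (f : Fin (p.qt + 1) → W) (j : Fin (p.qt + 1)) : ∑ i, K.ell i (K.node j) • f i = f j := by
  rw [Finset.sum_eq_single j]
  · rw [K.ell_node_self hK, one_smul]
  · intro i _ hij
    rw [K.ell_node_of_ne hij, zero_smul]
  · simp

/-- The Lagrange basis reproduces polynomials of degree at most `q_t`. -/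
theorem sum_ell_mul_pow (hK : K.t₀ < K.t₁) (t : ℝ) {e : ℕ} (he : e ≤ p.qt) :
    ∑ i, K.ell i t * (K.node i - K.t₀) ^ e = (t - K.t₀) ^ e := by
  classical
  set P : Polynomial ℝ := (Polynomial.X - Polynomial.C K.t₀) ^ e with hP
  have hdeg : P.degree < (Finset.univ : Finset (Fin (p.qt + 1))).card := by
    rw [hP, Polynomial.degree_pow, Polynomial.degree_X_sub_C]
    simp only [Finset.card_univ, Fintype.card_fin, nsmul_eq_mul, mul_one]
    exact_mod_cast Nat.lt_succ_of_le he
  have h := Lagrange.eq_interpolate (K.node_injective hK).injOn hdeg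
  have h2 := congrArg (Polynomial.eval t) h
  rw [Lagrange.interpolate_apply, Polynomial.eval_finsetSum] at h2
  simp only [hP, Polynomial.eval_mul, Polynomial.eval_C, Polynomial.eval_pow, Polynomial.eval_sub,
    Polynomial.eval_X] at h2
  rw [h2]
  exact Finset.sum_congr rfl fun i _ => mul_comm _ _

theorem sum_ell (hK : K.t₀ < K.t₁) (t : ℝ) : ∑ i, K.ell i t = 1 := by
  simpa using K.sum_ell_mul_pow hK t (Nat.zero_le p.qt)

end Config

/-- In each factor (t − t_j*)/(t_i* − t_j*) the numerator is at most Δt and the denominator is (τ_i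
− τ_j) Δt, so Δt cancels and only the reference nodes remain. -/
theorem exists_ell_bound (p : Params) : ∃ Λ, 0 ≤ Λ ∧ ∀ K : Config p, K.t₀ < K.t₁ →
    ∀ t ∈ K.I, ∀ i, |K.ell i t| ≤ Λ := by
  classical
  refine ⟨∑ i, ∏ j ∈ Finset.univ.erase i, |p.τ i - p.τ j|⁻¹,
    Finset.sum_nonneg fun i _ => Finset.prod_nonneg fun j _ => by positivity,
    fun K hK t ht i => ?_⟩
  have hΔ : 0 < K.Δt := sub_pos.2 hK
  have h1 : |K.ell i t| ≤ ∏ j ∈ Finset.univ.erase i, |p.τ i - p.τ j|⁻¹ := by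
    rw [Config.ell, Lagrange.basis, Polynomial.eval_prod, Finset.abs_prod]
    refine Finset.prod_le_prod (fun _ _ => abs_nonneg _) fun j _ => ?_
    rw [Lagrange.basisDivisor]
    simp only [Polynomial.eval_mul, Polynomial.eval_C, Polynomial.eval_sub, Polynomial.eval_X]
    have e1 : K.node i - K.node j = (p.τ i - p.τ j) * K.Δt := by
      simp only [Config.node]; ring
    rw [e1, mul_inv, abs_mul, abs_mul, abs_inv, abs_inv, abs_of_pos hΔ, mul_assoc]
    refine mul_le_of_le_one_right (by positivity) ?_
    rw [inv_mul_le_iff₀ hΔ, mul_one, abs_le]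
    have h3 := K.node_mem hK j
    have h4 : K.Δt = K.t₁ - K.t₀ := rfl
    constructor <;> linarith [ht.1, ht.2, h3.1, h3.2]
  exact h1.trans (Finset.single_le_sum (f := fun i => ∏ j ∈ Finset.univ.erase i,
    |p.τ i - p.τ j|⁻¹) (fun i _ => Finset.prod_nonneg fun j _ => by positivity)
    (Finset.mem_univ i))

/-- Interpolation error in time for families that are close to polynomials. -/
theorem Appr.interpolation_error {p : Params} {ι : Type} {K : ι → Config p} {η : ι → ℝ}
    (hS : Scale (fun i => (K i).Δt) η) (hK : ∀ i, (K i).t₀ < (K i).t₁)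
    (hη : ∀ i, (K i).Δt ^ (p.qt + 1) ≤ η i)
    {W : Type} [NormedAddCommGroup W] [NormedSpace ℝ W] {f : ι → ℝ → W}
    (hf : Appr (fun i => (K i).Δt) η (fun i s => f i ((K i).t₀ + s))) :
    ∃ C, 0 ≤ C ∧ ∀ i, ∀ t ∈ (K i).I,
      ‖∑ j, (K i).ell j t • f i ((K i).node j) - f i t‖ ≤ C * η i := by
  obtain ⟨Λ, hΛ, hell⟩ := exists_ell_bound p
  obtain ⟨κ, _, e, C, hC, hf⟩ := hf
  set n : ℝ := ((p.qt + 1 : ℕ) : ℝ) with hn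
  have hn0 : 0 ≤ n := by positivity
  refine ⟨n * (Λ * C) + C + Fintype.card κ * ((n * Λ + 1) * C), by positivity, fun i t ht => ?_⟩
  obtain ⟨c, hc, hf⟩ := hf i
  have hηi := hS.η_nonneg i
  set P : ℝ → W := fun s => ∑ a, s ^ e a • c a with hP
  have hmem : ∀ t ∈ (K i).I, t - (K i).t₀ ∈ Icc 0 ((K i).Δt) := fun t ht =>
    ⟨sub_nonneg.2 ht.1, sub_le_sub_right ht.2 _⟩
  have hfP : ∀ t ∈ (K i).I, ‖f i t - P (t - (K i).t₀)‖ ≤ C * η i := by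
    intro t ht
    have := hf _ (hmem t ht)
    simpa using this
  have hsum : ∀ (u : Fin (p.qt + 1) → W) (B : ℝ), (∀ j, ‖u j‖ ≤ B) →
      ‖∑ j, (K i).ell j t • u j‖ ≤ n * (Λ * B) := by
    intro u B hu
    refine (norm_sum_le _ _).trans ?_
    have : ∀ j ∈ Finset.univ, ‖(K i).ell j t • u j‖ ≤ Λ * B := by
      intro j _
      rw [norm_smul, Real.norm_eq_abs]
      exact mul_le_mul (hell _ (hK i) t ht j) (hu j) (norm_nonneg _) hΛ
    refine (Finset.sum_le_sum this).trans ?_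
    simp [hn]
  have hmono : ∀ a, ‖∑ j, (K i).ell j t • (((K i).node j - (K i).t₀) ^ e a • c a) -
      (t - (K i).t₀) ^ e a • c a‖ ≤ (n * Λ + 1) * C * η i := by
    intro a
    -- Powers up to q_t are reproduced exactly. For higher ones both the interpolant and the
    -- function are of size Δt^(q_t+1), as Δt ≤ 1.
    by_cases he : e a ≤ p.qt
    · simp only [smul_smul]
      rw [← Finset.sum_smul, (K i).sum_ell_mul_pow (hK i) t he, sub_self, norm_zero]
      positivity
    · have hpow : ∀ t ∈ (K i).I, ‖(t - (K i).t₀) ^ e a • c a‖ ≤ η i * C := by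
        intro t ht
        have h1 := hmem t ht
        rw [norm_smul, Real.norm_eq_abs, abs_of_nonneg (pow_nonneg h1.1 _)]
        refine mul_le_mul ?_ (hc a) (norm_nonneg _) hηi
        calc (t - (K i).t₀) ^ e a ≤ (K i).Δt ^ e a := pow_le_pow_left₀ h1.1 h1.2 _
          _ ≤ (K i).Δt ^ (p.qt + 1) :=
            pow_le_pow_of_le_one (hS.Δ_nonneg i) (hS.Δ_le i) (by omega)
          _ ≤ η i := hη i
      have h1 := hsum (fun j => ((K i).node j - (K i).t₀) ^ e a • c a) _
        fun j => hpow _ ((K i).node_mem (hK i) j)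
      have h2 := hpow t ht
      refine (norm_sub_le _ _).trans ((add_le_add h1 h2).trans (le_of_eq ?_))
      ring
  have hPP : ‖∑ j, (K i).ell j t • P ((K i).node j - (K i).t₀) - P (t - (K i).t₀)‖ ≤
      Fintype.card κ * ((n * Λ + 1) * C * η i) := by
    have e1 : ∑ j, (K i).ell j t • P ((K i).node j - (K i).t₀) - P (t - (K i).t₀) =
        ∑ a, (∑ j, (K i).ell j t • (((K i).node j - (K i).t₀) ^ e a • c a) -
          (t - (K i).t₀) ^ e a • c a) := by
      rw [Finset.sum_sub_distrib, Finset.sum_comm]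
      simp only [hP, Finset.smul_sum]
    rw [e1]
    refine (norm_sum_le _ _).trans ((Finset.sum_le_sum fun a _ => hmono a).trans ?_)
    simp
  have e2 : ∑ j, (K i).ell j t • f i ((K i).node j) - f i t =
      ∑ j, (K i).ell j t • (f i ((K i).node j) - P ((K i).node j - (K i).t₀)) -
        (f i t - P (t - (K i).t₀)) +
      (∑ j, (K i).ell j t • P ((K i).node j - (K i).t₀) - P (t - (K i).t₀)) := by
    simp only [smul_sub, Finset.sum_sub_distrib]
    abel
  rw [e2]
  have h3 := hsum (fun j => f i ((K i).node j) - P ((K i).node j - (K i).t₀)) _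
    fun j => hfP _ ((K i).node_mem (hK i) j)
  have h4 := hfP t ht
  refine (norm_add_le _ _).trans ((add_le_add ((norm_sub_le _ _).trans (add_le_add h3 h4))
    hPP).trans (le_of_eq ?_))
  ring

/-! ### Lagrange interpolation on a simplex -/

theorem prod_sub_eq_factorial_mul_choose (y : ℝ) (k : ℕ) :
    ∏ m ∈ Finset.range k, (y - m) = k.factorial * Ring.choose y k := by
  induction k with
  | zero => simp
  | succ k ih =>
    have h := Ring.choose_smul_choose y (Nat.le_succ k)
    rw [Nat.succ_eq_add_one, Nat.add_sub_cancel_left, Ring.choose_one_right, nsmul_eq_mul,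
      Nat.choose_succ_self_right] at h
    rw [Finset.prod_range_succ, ih, Nat.factorial_succ]
    push_cast at h ⊢
    linear_combination -(k.factorial : ℝ) * h

/-- In the scaled barycentric coordinates q_s λ_j the factors of a Lagrange basis function are
binomial coefficients. Reproduction of polynomials thereby becomes a Vandermonde identity. -/
theorem prod_div_eq_choose (y : ℝ) (k : ℕ) :
    ∏ m ∈ Finset.range k, (y - m) / ((k : ℝ) - m) = Ring.choose y k := by
  rw [Finset.prod_div_distrib, prod_sub_eq_factorial_mul_choose,
    prod_sub_eq_factorial_mul_choose, Ring.choose_natCast, Nat.choose_self, Nat.cast_one, mul_one,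
    mul_div_cancel_left₀]
  exact_mod_cast Nat.factorial_ne_zero k

/-- The span of the products of binomial coefficients of total order at most `n`. -/
noncomputable def binomSpan (J : Type) [Fintype J] (n : ℕ) : Submodule ℝ ((J → ℝ) → ℝ) :=
  Submodule.span ℝ {q | ∃ γ : J → ℕ, ∑ j, γ j ≤ n ∧ q = fun y => ∏ j, Ring.choose (y j) (γ j)}

section binomSpan

variable {J : Type} [Fintype J]

theorem binomSpan_mono {m n : ℕ} (h : m ≤ n) : binomSpan J m ≤ binomSpan J n :=
  Submodule.span_mono fun _ ⟨γ, hγ, hq⟩ => ⟨γ, hγ.trans h, hq⟩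

theorem one_mem_binomSpan (n : ℕ) : (fun _ => 1) ∈ binomSpan J n :=
  Submodule.subset_span ⟨0, by simp, by ext; simp⟩

/-- From y · C(y,k) = (k+1) · C(y,k+1) + k · C(y,k) in the coordinate `i`. -/
theorem coord_mul_mem_binomSpan (i : J) {n : ℕ} {q : (J → ℝ) → ℝ} (hq : q ∈ binomSpan J n) :
    (fun y => y i * q y) ∈ binomSpan J (n + 1) := by
  classical
  induction hq using Submodule.span_induction with
  | mem q hq =>
    obtain ⟨γ, hγ, rfl⟩ := hq
    have key : (fun y : J → ℝ => y i * ∏ j, Ring.choose (y j) (γ j)) =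
        ((γ i : ℝ) + 1) • (fun y : J → ℝ =>
          ∏ j, Ring.choose (y j) (Function.update γ i (γ i + 1) j)) +
        (γ i : ℝ) • (fun y : J → ℝ => ∏ j, Ring.choose (y j) (γ j)) := by
      ext y
      simp only [Pi.add_apply, Pi.smul_apply, smul_eq_mul]
      rw [← Finset.mul_prod_erase _ _ (Finset.mem_univ i),
        ← Finset.mul_prod_erase _ (fun j => Ring.choose (y j) (Function.update γ i (γ i + 1) j))
          (Finset.mem_univ i)]
      have h1 : ∏ j ∈ Finset.univ.erase i, Ring.choose (y j) (Function.update γ i (γ i + 1) j) =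
          ∏ j ∈ Finset.univ.erase i, Ring.choose (y j) (γ j) :=
        Finset.prod_congr rfl fun j hj => by
          rw [Function.update_of_ne (Finset.ne_of_mem_erase hj)]
      rw [h1, Function.update_self]
      have h := Ring.choose_smul_choose (y i) (Nat.le_succ (γ i))
      rw [Nat.succ_eq_add_one, Nat.add_sub_cancel_left, Ring.choose_one_right, nsmul_eq_mul,
        Nat.choose_succ_self_right] at h
      push_cast at h
      linear_combination -(∏ j ∈ Finset.univ.erase i, Ring.choose (y j) (γ j)) * h
    rw [key]
    refine Submodule.add_mem _ (Submodule.smul_mem _ _ (Submodule.subset_span ⟨_, ?_, rfl⟩))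
      (Submodule.smul_mem _ _ (Submodule.subset_span ⟨γ, by omega, rfl⟩))
    rw [Finset.sum_update_of_mem (Finset.mem_univ i)]
    have := Finset.add_sum_erase Finset.univ γ (Finset.mem_univ i)
    rw [Finset.sdiff_singleton_eq_erase]
    omega
  | zero =>
    convert Submodule.zero_mem (binomSpan J (n + 1)) using 1
    ext y
    simp
  | add q q' _ _ h h' =>
    convert Submodule.add_mem _ h h' using 1
    ext y
    simp [mul_add]
  | smul a q _ h =>
    have := Submodule.smul_mem _ a h
    convert this using 1
    ext y
    simp
    ring

theorem linear_mul_mem_binomSpan (a : J → ℝ) {n : ℕ} {q : (J → ℝ) → ℝ} (hq : q ∈ binomSpan J n) :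
    (fun y => (∑ j, y j * a j) * q y) ∈ binomSpan J (n + 1) := by
  have : (fun y : J → ℝ => (∑ j, y j * a j) * q y) = ∑ j, a j • (fun y : J → ℝ => y j * q y) := by
    ext y
    simp only [Finset.sum_apply, Pi.smul_apply, smul_eq_mul, Finset.sum_mul]
    exact Finset.sum_congr rfl fun j _ => by ring
  rw [this]
  exact Submodule.sum_mem _ fun j _ => Submodule.smul_mem _ _ (coord_mul_mem_binomSpan j hq)

theorem linear_pow_mul_mem_binomSpan (a : J → ℝ) {n : ℕ} {q : (J → ℝ) → ℝ}
    (hq : q ∈ binomSpan J n) (k : ℕ) :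
    (fun y => (∑ j, y j * a j) ^ k * q y) ∈ binomSpan J (k + n) := by
  induction k with
  | zero => simpa using hq
  | succ k ih =>
    have h := linear_mul_mem_binomSpan a ih
    have e : (fun y : J → ℝ => (∑ j, y j * a j) ^ (k + 1) * q y) =
        fun y => (∑ j, y j * a j) * ((∑ j, y j * a j) ^ k * q y) := by
      ext y; ring
    rw [e, Nat.add_right_comm]
    exact h

theorem eval_mem_binomSpan {d n : ℕ} (a : Fin d → J → ℝ) (P : MvPolynomial (Fin d) ℝ)
    (hP : P.totalDegree ≤ n) :
    (fun y => MvPolynomial.eval (fun k => ∑ j, y j * a k j) P) ∈ binomSpan J n := by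
  classical
  have hprod : ∀ (s : Fin d → ℕ) (A : Finset (Fin d)),
      (fun y : J → ℝ => ∏ k ∈ A, (∑ j, y j * a k j) ^ s k) ∈ binomSpan J (∑ k ∈ A, s k) := by
    intro s A
    induction A using Finset.induction_on with
    | empty => simpa using one_mem_binomSpan (J := J) 0
    | insert k A hk ih =>
      simp only [Finset.prod_insert hk, Finset.sum_insert hk]
      exact linear_pow_mul_mem_binomSpan (a k) ih (s k)
  have : (fun y : J → ℝ => MvPolynomial.eval (fun k => ∑ j, y j * a k j) P) =
      ∑ s ∈ P.support, P.coeff s • (fun y : J → ℝ => ∏ k, (∑ j, y j * a k j) ^ s k) := by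
    ext y
    rw [MvPolynomial.eval_eq']
    simp
  rw [this]
  refine Submodule.sum_mem _ fun s hs => Submodule.smul_mem _ _
    (binomSpan_mono ?_ (hprod s Finset.univ))
  have h1 := MvPolynomial.le_totalDegree hs
  rw [Finsupp.sum_fintype _ _ (fun _ => rfl)] at h1
  exact h1.trans hP

/-- Generating function form of a sum over multi-indices of fixed order; it lets the Vandermonde sum
be computed as a product of binomial series. -/
theorem sum_piAntidiag_eq_coeff [DecidableEq J] (n : ℕ) (a : J → ℕ → ℝ) :
    ∑ β ∈ Finset.piAntidiag Finset.univ n, ∏ j, a j (β j) =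
      PowerSeries.coeff n (∏ j, PowerSeries.mk (a j)) := by
  rw [PowerSeries.coeff_prod]
  symm
  refine Finset.sum_bij (fun l _ => (l : J → ℕ)) ?_ ?_ ?_ ?_
  · intro l hl
    rw [Finset.mem_finsuppAntidiag] at hl
    simpa using hl.1
  · intro l _ l' _ h
    exact DFunLike.coe_injective h
  · intro β hβ
    refine ⟨Finsupp.equivFunOnFinite.symm β, ?_, by simp⟩
    rw [Finset.mem_piAntidiag] at hβ
    simpa using hβ.1
  · intro l _
    simp

/-- Multivariate Vandermonde identity. -/
theorem sum_choose_mul_eq [DecidableEq J] {n : ℕ} {q : (J → ℝ) → ℝ} (hq : q ∈ binomSpan J n)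
    {y : J → ℝ} (hy : ∑ j, y j = n) :
    ∑ β ∈ Finset.piAntidiag Finset.univ n,
      (∏ j, Ring.choose (y j) (β j)) * q (fun j => (β j : ℝ)) = q y := by
  induction hq using Submodule.span_induction with
  | mem q hq =>
    obtain ⟨γ, hγ, rfl⟩ := hq
    simp only [← Finset.prod_mul_distrib]
    rw [sum_piAntidiag_eq_coeff n (fun j k => Ring.choose (y j) k * Ring.choose (k : ℝ) (γ j))]
    -- C(y,k) C(k,γ) = C(y,γ) C(y−γ, k−γ), so each generating series is C(y,γ) X^γ (1+X)^(y−γ).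
    have h1 : ∀ j, PowerSeries.mk (fun k => Ring.choose (y j) k * Ring.choose (k : ℝ) (γ j)) =
        PowerSeries.C (Ring.choose (y j) (γ j)) * (PowerSeries.X ^ γ j *
          PowerSeries.binomialSeries ℝ (y j - γ j)) := by
      intro j
      ext k
      rw [PowerSeries.coeff_mk, PowerSeries.coeff_C_mul, PowerSeries.coeff_X_pow_mul',
        Ring.choose_natCast]
      split_ifs with hk
      · rw [PowerSeries.binomialSeries_coeff, smul_eq_mul, mul_one, mul_comm, ← nsmul_eq_mul]
        exact Ring.choose_smul_choose (y j) hk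
      · rw [Nat.choose_eq_zero_of_lt (not_le.1 hk)]
        simp
    have h2 : ∀ A : Finset J, ∏ j ∈ A, PowerSeries.binomialSeries ℝ (y j - γ j) =
        PowerSeries.binomialSeries ℝ (∑ j ∈ A, (y j - γ j)) := by
      intro A
      induction A using Finset.induction_on with
      | empty => simp
      | insert j A hj ih =>
        rw [Finset.prod_insert hj, Finset.sum_insert hj, ih, PowerSeries.binomialSeries_add]
    simp only [h1]
    -- The exponents add up to n − |γ|, since the coordinates of y sum to n. The coefficient of
    -- X^(n−|γ|) in (1+X)^(n−|γ|) is 1, which leaves ∏ C(y_j, γ_j).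
    rw [Finset.prod_mul_distrib, Finset.prod_mul_distrib, h2, ← map_prod,
      Finset.prod_pow_eq_pow_sum, PowerSeries.coeff_C_mul, PowerSeries.coeff_X_pow_mul',
      if_pos hγ, PowerSeries.binomialSeries_coeff, Finset.sum_sub_distrib, hy, ← Nat.cast_sum,
      ← Nat.cast_sub hγ, Ring.choose_natCast, Nat.choose_self]
    simp
  | zero => simp
  | add q q' _ _ h h' => simp only [Pi.add_apply, mul_add, Finset.sum_add_distrib, h, h']
  | smul a q _ h =>
    simp only [Pi.smul_apply, smul_eq_mul]
    rw [← h, Finset.mul_sum]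
    exact Finset.sum_congr rfl fun β _ => by ring

end binomSpan

theorem sum_coord_smul {d : ℕ} (T : Simplex d) (x : E d) : ∑ j, T.coord j x • T j = x :=
  T.linear_combination_coord_eq_self x

theorem sum_coord {d : ℕ} (T : Simplex d) (x : E d) : ∑ j, T.coord j x = 1 :=
  T.sum_coord_apply_eq_one x

theorem mem_hull_iff {d : ℕ} (T : Simplex d) (x : E d) : x ∈ hull T ↔ ∀ j, 0 ≤ T.coord j x := by
  rw [hull, T.convexHull_eq_nonneg_coord]
  rfl

theorem coord_le_one {d : ℕ} {T : Simplex d} {x : E d} (hx : x ∈ hull T) (j : Fin (d + 1)) :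
    T.coord j x ≤ 1 := by
  rw [← sum_coord T x]
  exact Finset.single_le_sum (f := fun j => T.coord j x)
    (fun j _ => (mem_hull_iff T x).1 hx j) (Finset.mem_univ j)

theorem coord_sum_smul {d : ℕ} (T : Simplex d) {w : Fin (d + 1) → ℝ} (hw : ∑ j, w j = 1)
    (j : Fin (d + 1)) : T.coord j (∑ i, w i • T i) = w j := by
  rw [← Finset.affineCombination_eq_linear_combination Finset.univ T w hw]
  exact T.coord_apply_combination_of_mem (Finset.mem_univ j) hw

namespace Config

variable {p : Params}

theorem lagBasis_eq (T : Simplex p.d) (β : Fin (p.d + 1) → ℕ) (x : E p.d) :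
    lagBasis T β x = ∏ j, Ring.choose (p.qs * T.coord j x) (β j) :=
  Finset.prod_congr rfl fun _ _ => prod_div_eq_choose _ _

theorem coord_lagNode (T : Simplex p.d) {β : Fin (p.d + 1) → ℕ}
    (hβ : β ∈ Finset.piAntidiag Finset.univ p.qs) (j : Fin (p.d + 1)) :
    T.coord j (lagNode T β) = (β j : ℝ) / p.qs := by
  refine coord_sum_smul T ?_ j
  have hq : (p.qs : ℝ) ≠ 0 := by
    have := p.one_le_qs
    positivity
  rw [Finset.mem_piAntidiag] at hβ
  rw [← Finset.sum_div, ← Nat.cast_sum, hβ.1, div_self hq]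

theorem lagNode_mem (T : Simplex p.d) {β : Fin (p.d + 1) → ℕ}
    (hβ : β ∈ Finset.piAntidiag Finset.univ p.qs) : lagNode T β ∈ hull T := by
  rw [mem_hull_iff]
  intro j
  rw [coord_lagNode T hβ]
  positivity

/-- Reproduction of polynomials by Lagrange interpolation on a simplex. -/
theorem eval_eq_sum_lagBasis (T : Simplex p.d) (P : MvPolynomial (Fin p.d) ℝ)
    (hP : P.totalDegree ≤ p.qs) (x : E p.d) :
    MvPolynomial.eval (fun k => x k) P = ∑ β ∈ Finset.piAntidiag Finset.univ p.qs,
      lagBasis T β x * MvPolynomial.eval (fun k => lagNode T β k) P := by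
  have hq : (p.qs : ℝ) ≠ 0 := by
    have := p.one_le_qs
    positivity
  -- The polynomial is read in the scaled coordinates y_j = q_s λ_j(x), which sum to q_s and take
  -- the integer values β_j at the Lagrange node with index β.
  have hmem := eval_mem_binomSpan (fun k (j : Fin (p.d + 1)) => T j k / (p.qs : ℝ)) P hP
  have hy : ∑ j, (p.qs : ℝ) * T.coord j x = p.qs := by
    rw [← Finset.mul_sum, sum_coord, mul_one]
  have h := sum_choose_mul_eq hmem hy
  have e1 : (fun k => ∑ j, (p.qs : ℝ) * T.coord j x * (T j k / (p.qs : ℝ))) = fun k => x k := by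
    ext k
    conv_rhs => rw [← sum_coord_smul T x]
    rw [WithLp.ofLp_sum, Finset.sum_apply]
    refine Finset.sum_congr rfl fun j _ => ?_
    rw [PiLp.smul_apply, smul_eq_mul]
    field_simp
  have e2 : ∀ β : Fin (p.d + 1) → ℕ,
      (fun k => ∑ j, (β j : ℝ) * (T j k / (p.qs : ℝ))) = fun k => lagNode T β k := by
    intro β
    ext k
    rw [lagNode, WithLp.ofLp_sum, Finset.sum_apply]
    refine Finset.sum_congr rfl fun j _ => ?_
    rw [PiLp.smul_apply, smul_eq_mul]
    ring
  rw [e1] at h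
  rw [← h]
  refine Finset.sum_congr rfl fun β _ => ?_
  rw [lagBasis_eq, e2]

/-- There are Σ β_j = q_s factors in total; each has numerator at most q_s in absolute value and
denominator at least 1. -/
theorem abs_lagBasis_le {T : Simplex p.d} {x : E p.d} (hx : x ∈ hull T) {β : Fin (p.d + 1) → ℕ}
    (hβ : β ∈ Finset.piAntidiag Finset.univ p.qs) : |lagBasis T β x| ≤ (p.qs : ℝ) ^ p.qs := by
  rw [lagBasis, Finset.abs_prod]
  have hsum := (Finset.mem_piAntidiag.1 hβ).1
  calc _ ≤ ∏ j, (p.qs : ℝ) ^ β j := by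
        refine Finset.prod_le_prod (fun _ _ => abs_nonneg _) fun j _ => ?_
        rw [Finset.abs_prod]
        have : ∀ m ∈ Finset.range (β j),
            |(p.qs * T.coord j x - m) / ((β j : ℝ) - m)| ≤ (p.qs : ℝ) := by
          intro m hm
          rw [Finset.mem_range] at hm
          have h1 : β j ≤ p.qs := by
            rw [← hsum]; exact Finset.single_le_sum (fun _ _ => Nat.zero_le _) (Finset.mem_univ j)
          have h2 : (m : ℝ) + 1 ≤ β j := by exact_mod_cast hm
          have h3 : (β j : ℝ) ≤ p.qs := by exact_mod_cast h1
          have h4 : (0 : ℝ) ≤ m := Nat.cast_nonneg m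
          have h5 := (mem_hull_iff T x).1 hx j
          have h6 := coord_le_one hx j
          have h7 : (p.qs : ℝ) * T.coord j x ≤ p.qs :=
            mul_le_of_le_one_right (by positivity) h6
          have h8 : 0 ≤ (p.qs : ℝ) * T.coord j x := by positivity
          rw [abs_div, abs_of_pos (by linarith : (0 : ℝ) < β j - m), div_le_iff₀ (by linarith)]
          have h9 : |p.qs * T.coord j x - m| ≤ p.qs := abs_le.2 ⟨by linarith, by linarith⟩
          exact h9.trans (le_mul_of_one_le_right (by positivity) (by linarith))
        refine (Finset.prod_le_prod (fun _ _ => abs_nonneg _) this).trans ?_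
        simp
    _ = (p.qs : ℝ) ^ p.qs := by rw [Finset.prod_pow_eq_pow_sum, hsum]

end Config

end SpaceTimeMapping

namespace SpaceTimeMapping

open Filter Topology

/-! ### Polynomial functions -/

section Polynomial

variable {d : ℕ}

theorem totalDegree_pderiv_le {P : MvPolynomial (Fin d) ℝ} {n : ℕ} (hP : P.totalDegree ≤ n)
    (k : Fin d) : (MvPolynomial.pderiv k P).totalDegree ≤ n - 1 := by
  conv_lhs => rw [P.as_sum]
  rw [map_sum]
  refine MvPolynomial.totalDegree_finsetSum_le fun s hs => ?_
  rw [MvPolynomial.pderiv_monomial]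
  by_cases hsk : s k = 0
  · simp [hsk]
  · refine (MvPolynomial.totalDegree_monomial_le _ _).trans ?_
    have h1 := (MvPolynomial.le_totalDegree hs).trans hP
    rw [Finsupp.sum_fintype _ _ (fun _ => rfl)] at h1 ⊢
    have h2 : ∑ j, (s - Finsupp.single k 1 : Fin d →₀ ℕ) j + 1 = ∑ j, s j := by
      rw [← Finset.add_sum_erase _ _ (Finset.mem_univ k),
        ← Finset.add_sum_erase _ (fun j => s j) (Finset.mem_univ k)]
      have h3 : ∑ j ∈ Finset.univ.erase k, (s - Finsupp.single k 1 : Fin d →₀ ℕ) j =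
          ∑ j ∈ Finset.univ.erase k, s j :=
        Finset.sum_congr rfl fun j hj => by
          simp [(Finset.ne_of_mem_erase hj).symm]
      rw [h3]
      simp only [Finsupp.coe_tsub, Pi.sub_apply, Finsupp.single_eq_same]
      omega
    simp only [id]
    omega

theorem hasFDerivAt_eval (P : MvPolynomial (Fin d) ℝ) (x : E d) :
    HasFDerivAt (fun y : E d => MvPolynomial.eval (fun k => y k) P)
      (∑ k, MvPolynomial.eval (fun k => x k) (MvPolynomial.pderiv k P) •
        (EuclideanSpace.proj k : E d →L[ℝ] ℝ)) x := by
  induction P using MvPolynomial.induction_on with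
  | C a => simpa using hasFDerivAt_const a x
  | add P Q hP hQ =>
    simp only [map_add, add_smul, Finset.sum_add_distrib]
    exact hP.add hQ
  | mul_X P j hP =>
    have hX : HasFDerivAt (fun y : E d => y j) (EuclideanSpace.proj j : E d →L[ℝ] ℝ) x :=
      (EuclideanSpace.proj j : E d →L[ℝ] ℝ).hasFDerivAt
    simp only [map_mul, MvPolynomial.eval_X]
    refine (hP.mul hX).congr_fderiv ?_
    simp only [MvPolynomial.pderiv_mul, MvPolynomial.pderiv_X, map_add, map_mul,
      MvPolynomial.eval_X, add_smul, Finset.sum_add_distrib]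
    rw [add_comm]
    congr 1
    · rw [Finset.smul_sum]
      exact Finset.sum_congr rfl fun k _ => by rw [smul_smul, mul_comm]
    · rw [Finset.sum_eq_single j]
      · simp
      · intro k _ hk
        simp [hk.symm]
      · simp

theorem contDiff_eval (P : MvPolynomial (Fin d) ℝ) {n : WithTop ℕ∞} :
    ContDiff ℝ n (fun y : E d => MvPolynomial.eval (fun k => y k) P) := by
  induction P using MvPolynomial.induction_on with
  | C a => simpa using contDiff_const
  | add P Q hP hQ => simpa using hP.add hQ
  | mul_X P j hP =>
    simpa using hP.mul (EuclideanSpace.proj j : E d →L[ℝ] ℝ).contDiff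

/-- Consequently the derivative of order q_s + 1 of the difference between φ_{Δt,i} and a polynomial
extension does not depend on the element from which the extension is made. -/
theorem iteratedFDeriv_eval_eq_zero {P : MvPolynomial (Fin d) ℝ} {n : ℕ}
    (hP : P.totalDegree ≤ n) (x : E d) :
    iteratedFDeriv ℝ (n + 1) (fun y : E d => MvPolynomial.eval (fun k => y k) P) x = 0 := by
  induction n generalizing P with
  | zero =>
    have h0 : P.totalDegree = 0 := by omega
    rw [MvPolynomial.totalDegree_eq_zero_iff_eq_C] at h0
    rw [h0]
    simp only [MvPolynomial.eval_C]
    rw [iteratedFDeriv_succ_const]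
    rfl
  | succ n ih =>
    rw [← norm_eq_zero, ← norm_iteratedFDeriv_fderiv]
    have h1 : fderiv ℝ (fun y : E d => MvPolynomial.eval (fun k => y k) P) =
        fun y => ∑ k, (ContinuousLinearMap.toSpanSingleton ℝ
          (EuclideanSpace.proj k : E d →L[ℝ] ℝ))
          (MvPolynomial.eval (fun k => y k) (MvPolynomial.pderiv k P)) := by
      ext1 y
      rw [(hasFDerivAt_eval P y).fderiv]
      simp
    rw [norm_eq_zero, h1]
    have hc : ∀ k, ContDiff ℝ (n + 1 : ℕ) (fun y : E d => (ContinuousLinearMap.toSpanSingleton ℝ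
          (EuclideanSpace.proj k : E d →L[ℝ] ℝ))
          (MvPolynomial.eval (fun k => y k) (MvPolynomial.pderiv k P))) := fun k =>
      (ContinuousLinearMap.contDiff _).comp (contDiff_eval _)
    rw [iteratedFDeriv_sum fun k _ => (hc k), Finset.sum_apply]
    refine Finset.sum_eq_zero fun k _ => ?_
    rw [show (fun y : E d => (ContinuousLinearMap.toSpanSingleton ℝ
          (EuclideanSpace.proj k : E d →L[ℝ] ℝ))
          (MvPolynomial.eval (fun k => y k) (MvPolynomial.pderiv k P))) =
        (ContinuousLinearMap.toSpanSingleton ℝ (EuclideanSpace.proj k : E d →L[ℝ] ℝ)) ∘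
          (fun y : E d => MvPolynomial.eval (fun k => y k) (MvPolynomial.pderiv k P)) from rfl,
      ContinuousLinearMap.iteratedFDeriv_comp_left _ (contDiff_eval _ (n := (n + 1 : ℕ))).contDiffAt
        le_rfl, ih (totalDegree_pderiv_le hP k)]
    ext
    simp

theorem gradient_eval_apply (P : MvPolynomial (Fin d) ℝ) (x : E d) (k : Fin d) :
    gradient (fun y : E d => MvPolynomial.eval (fun k => y k) P) x k =
      MvPolynomial.eval (fun k => x k) (MvPolynomial.pderiv k P) := by
  have h1 : gradient (fun y : E d => MvPolynomial.eval (fun k => y k) P) x k =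
      inner ℝ (gradient (fun y : E d => MvPolynomial.eval (fun k => y k) P) x)
        (EuclideanSpace.single k (1 : ℝ)) := by
    rw [EuclideanSpace.inner_single_right]
    simp
  rw [h1, ← InnerProductSpace.toDual_apply_apply, toDual_gradient, (hasFDerivAt_eval P x).fderiv]
  simp

end Polynomial

theorem norm_gradient {d : ℕ} (f : E d → ℝ) (x : E d) : ‖gradient f x‖ = ‖fderiv ℝ f x‖ := by
  rw [← toDual_gradient, LinearIsometryEquiv.norm_map]

theorem norm_gradient_sub {d : ℕ} (f g : E d → ℝ) (x : E d) :
    ‖gradient f x - gradient g x‖ = ‖fderiv ℝ f x - fderiv ℝ g x‖ := by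
  rw [← toDual_gradient, ← toDual_gradient, ← map_sub, LinearIsometryEquiv.norm_map]

/-! ### Oswald interpolation of elementwise gradients -/

namespace Config

variable {p : Params} (K : Config p)

/-- The Oswald interpolant is close to the polynomial gradient on `T` if the gradients on the
neighbouring elements are close to it at the Lagrange nodes of `T`. -/
theorem norm_oswald_sub_gradient_le {A : Set (Simplex p.d)} (hA : A.Finite) {T : Simplex p.d}
    (hT : T ∈ A) (i : Fin (p.qt + 1)) (hdeg : (K.poly T i).totalDegree ≤ p.qs) {ε : ℝ}
    (hε : ∀ β ∈ Finset.piAntidiag Finset.univ p.qs, ∀ S ∈ A, lagNode T β ∈ hull S →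
      ‖gradient (K.ext S i) (lagNode T β) - gradient (K.ext T i) (lagNode T β)‖ ≤ ε)
    {x : E p.d} (hx : x ∈ hull T) :
    ‖oswald A (fun S y => gradient (K.ext S i) y) T x - gradient (K.ext T i) x‖ ≤
      (Finset.piAntidiag (Finset.univ : Finset (Fin (p.d + 1))) p.qs).card *
        ((p.qs : ℝ) ^ p.qs * ε) := by
  classical
  -- The components of the gradient are polynomials of degree at most q_s, hence equal to their own
  -- Lagrange interpolants. The error is thus the interpolant of averaged jumps at the nodes.
  have hrep : gradient (K.ext T i) x = ∑ β ∈ Finset.piAntidiag Finset.univ p.qs,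
      lagBasis T β x • gradient (K.ext T i) (lagNode T β) := by
    ext k
    rw [WithLp.ofLp_sum, Finset.sum_apply]
    change gradient (fun y : E p.d => MvPolynomial.eval (fun k => y k) (K.poly T i)) x k = _
    rw [gradient_eval_apply, eval_eq_sum_lagBasis T _
      ((totalDegree_pderiv_le hdeg k).trans (Nat.sub_le _ _))]
    refine Finset.sum_congr rfl fun β _ => ?_
    rw [PiLp.smul_apply, smul_eq_mul]
    congr 1
    exact (gradient_eval_apply _ _ k).symm
  rw [hrep, oswald, ← Finset.sum_sub_distrib]
  refine (norm_sum_le _ _).trans ?_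
  rw [← nsmul_eq_mul]
  refine Finset.sum_le_card_nsmul _ _ _ fun β hβ => ?_
  rw [← smul_sub, norm_smul, Real.norm_eq_abs]
  set N : Set (Simplex p.d) := {S ∈ A | lagNode T β ∈ hull S} with hN
  have hNfin : N.Finite := hA.subset fun S hS => hS.1
  have hTN : T ∈ N := ⟨hT, lagNode_mem T hβ⟩
  have hcard : (0 : ℝ) < N.ncard := by
    exact_mod_cast (Set.ncard_pos hNfin).2 ⟨T, hTN⟩
  refine mul_le_mul (abs_lagBasis_le hx hβ) ?_ (norm_nonneg _) (by positivity)
  rw [finsum_mem_eq_finite_toFinset_sum _ hNfin]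
  have e1 : gradient (K.ext T i) (lagNode T β) = (N.ncard : ℝ)⁻¹ •
      ∑ S ∈ hNfin.toFinset, gradient (K.ext T i) (lagNode T β) := by
    rw [Finset.sum_const, ← Set.ncard_eq_toFinset_card _ hNfin, ← Nat.cast_smul_eq_nsmul ℝ,
      smul_smul, inv_mul_cancel₀ hcard.ne', one_smul]
  rw [e1, ← smul_sub, ← Finset.sum_sub_distrib, norm_smul, norm_inv, Real.norm_eq_abs,
    abs_of_pos hcard, inv_mul_le_iff₀ hcard]
  refine (norm_sum_le _ _).trans ((Finset.sum_le_card_nsmul _ _ ε fun S hS => ?_).trans ?_)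
  · have hS' : S ∈ N := by simpa using hS
    exact hε β hβ S hS'.1 hS'.2
  · rw [Set.ncard_eq_toFinset_card _ hNfin, nsmul_eq_mul]

end Config

/-! ### Simplices -/

section Simplex

variable {d : ℕ} (T : Simplex d)

theorem convex_hull : Convex ℝ (hull T) := convex_convexHull ℝ _

theorem isCompact_hull : IsCompact (hull T) := (finite_range T).isCompact_convexHull ℝ

theorem isClosed_hull : IsClosed (hull T) := (isCompact_hull T).isClosed

theorem vertex_mem_hull (j : Fin (d + 1)) : T j ∈ hull T :=
  subset_convexHull ℝ _ (mem_range_self j)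

theorem interior_hull_nonempty : (interior (hull T)).Nonempty :=
  ⟨_, T.centroid_mem_interior_convexHull⟩

theorem closure_interior_hull : closure (interior (hull T)) = hull T := by
  rw [(convex_hull T).closure_interior_eq_closure_of_nonempty_interior (interior_hull_nonempty T),
    (isClosed_hull T).closure_eq]

theorem norm_le_of_interior_hull {F : Type*} [NormedAddCommGroup F] {u : E d → F} {B : ℝ}
    (hu : ContinuousOn u (hull T)) (h : ∀ x ∈ interior (hull T), ‖u x‖ ≤ B) :
    ∀ x ∈ hull T, ‖u x‖ ≤ B := by
  intro x hx
  rw [← closure_interior_hull T] at hx hu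
  exact le_on_closure h hu.norm continuousOn_const hx

/-- The affine interpolant on `T` of the values of `f` at the vertices. -/
noncomputable def linInterp (f : E d → ℝ) (x : E d) : ℝ := ∑ j, T.coord j x * f (T j)

/-- The linear part of a barycentric coordinate. -/
noncomputable def coordCLM (j : Fin (d + 1)) : E d →L[ℝ] ℝ :=
  LinearMap.toContinuousLinearMap (T.coord j).linear

theorem coord_eq_add (j : Fin (d + 1)) (x y : E d) :
    T.coord j y = T.coord j x + coordCLM T j (y - x) := by
  have := (T.coord j).map_vadd x (y - x)
  simp only [vadd_eq_add, sub_add_cancel] at this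
  rw [this, add_comm]
  rfl

theorem hasFDerivAt_coord (j : Fin (d + 1)) (x : E d) :
    HasFDerivAt (fun y => T.coord j y) (coordCLM T j) x := by
  have h : (fun y => T.coord j y) = fun y => T.coord j 0 + coordCLM T j y := by
    ext y
    simpa using coord_eq_add T j 0 y
  rw [h]
  exact (coordCLM T j).hasFDerivAt.const_add _

theorem sum_coordCLM : ∑ j, coordCLM T j = 0 := by
  ext v
  have h : ∀ j, coordCLM T j v = T.coord j v - T.coord j 0 := by
    intro j
    rw [coord_eq_add T j 0 v]
    simp
  simp only [sum_apply, h, Finset.sum_sub_distrib, sum_coord]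
  simp

theorem hasFDerivAt_linInterp (f : E d → ℝ) (x : E d) :
    HasFDerivAt (linInterp T f) (∑ j, f (T j) • coordCLM T j) x := by
  have : HasFDerivAt (fun y => ∑ j, T.coord j y * f (T j)) (∑ j, f (T j) • coordCLM T j) x :=
    HasFDerivAt.fun_sum fun j _ => (hasFDerivAt_coord T j x).mul_const (f (T j))
  exact this

theorem continuous_linInterp (f : E d → ℝ) : Continuous (linInterp T f) :=
  continuous_iff_continuousAt.2 fun x => (hasFDerivAt_linInterp T f x).continuousAt

theorem linInterp_sub_eq (f : E d → ℝ) (x : E d) (a : ℝ) :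
    linInterp T f x - a = ∑ j, T.coord j x * (f (T j) - a) := by
  simp only [linInterp, mul_sub, Finset.sum_sub_distrib, ← Finset.sum_mul, sum_coord, one_mul]

theorem abs_linInterp_sub_le {f : E d → ℝ} {x : E d} (hx : x ∈ hull T) {a B : ℝ}
    (h : ∀ j, |f (T j) - a| ≤ B) : |linInterp T f x - a| ≤ B := by
  rw [linInterp_sub_eq]
  calc _ ≤ ∑ j, |T.coord j x * (f (T j) - a)| := Finset.abs_sum_le_sum_abs _ _
    _ ≤ ∑ j, T.coord j x * B := Finset.sum_le_sum fun j _ => by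
        have h0 := (mem_hull_iff T x).1 hx j
        rw [abs_mul, abs_of_nonneg h0]
        exact mul_le_mul_of_nonneg_left (h j) h0
    _ = B := by rw [← Finset.sum_mul, sum_coord, one_mul]

/-- On a shape regular simplex the barycentric coordinates have gradients of size `1 / diam`. -/
theorem diam_mul_norm_coordCLM_le {κ r : ℝ} {c : E d} (hr : 0 < r) (hb : closedBall c r ⊆ hull T)
    (hd : diam (hull T) ≤ κ * r) (j : Fin (d + 1)) : diam (hull T) * ‖coordCLM T j‖ ≤ κ := by
  have hκ : 0 ≤ κ := by
    by_contra! h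
    have := hd.trans_lt (mul_neg_of_neg_of_pos h hr)
    exact absurd diam_nonneg (not_le.2 this)
  have h1 : ‖coordCLM T j‖ ≤ r⁻¹ := by
    refine (coordCLM T j).opNorm_le_bound (by positivity) fun v => ?_
    -- The coordinate stays in [0,1] on the inscribed ball, so its linear part changes by at most 1
    -- over a displacement of length up to r.
    have := LinearMap.bound_of_ball_bound' hr 1 (coordCLM T j).toLinearMap (fun v hv => ?_) v
    · simpa using this
    · have h2 : c + v ∈ hull T := hb (by simpa using hv)
      have h3 : c ∈ hull T := hb (by simpa using hr.le)
      have h4 := coord_eq_add T j c (c + v)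
      rw [add_sub_cancel_left] at h4
      have h5 := (mem_hull_iff T _).1 h2 j
      have h6 := (mem_hull_iff T _).1 h3 j
      have h7 := coord_le_one h2 j
      have h8 := coord_le_one h3 j
      rw [Real.norm_eq_abs]
      exact abs_le.2 ⟨by simp only [ContinuousLinearMap.coe_coe]; linarith,
        by simp only [ContinuousLinearMap.coe_coe]; linarith⟩
  calc diam (hull T) * ‖coordCLM T j‖ ≤ κ * r * r⁻¹ := by gcongr
    _ = κ := by field_simp

end Simplex

end SpaceTimeMapping

namespace SpaceTimeMapping

open Filter Topology

/-! ### Consequences of the assumptions on one time slab -/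

namespace Config

variable {p : Params} {K : Config p}

theorem h_nonneg : 0 ≤ K.h := by
  refine Real.sSup_nonneg ?_
  rintro _ ⟨T, -, rfl⟩
  exact diam_nonneg

theorem IsTriangulation.diam_le (hK : K.IsTriangulation) {T : Simplex p.d} (hT : T ∈ K.mesh) :
    diam (hull T) ≤ K.h :=
  le_csSup (hK.finite.image _).bddAbove (mem_image_of_mem _ hT)

theorem IsTriangulation.dist_le (hK : K.IsTriangulation) {T : Simplex p.d} (hT : T ∈ K.mesh)
    {x y : E p.d} (hx : x ∈ hull T) (hy : y ∈ hull T) : dist x y ≤ K.h :=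
  (dist_le_diam_of_mem (isCompact_hull T).isBounded hx hy).trans (hK.diam_le hT)

/-- On a conforming mesh the piecewise linear interpolant can be computed on every element. -/
theorem IsTriangulation.φlini_eq (hK : K.IsTriangulation) {T : Simplex p.d} (hT : T ∈ K.mesh)
    (i : Fin (p.qt + 1)) {x : E p.d} (hx : x ∈ hull T) :
    K.φlini i x = linInterp T (K.φhi i) x := by
  have hex : ∃ T ∈ K.mesh, x ∈ hull T := ⟨T, hT, hx⟩
  rw [φlini, dif_pos hex]
  set S := hex.choose with hS
  obtain ⟨hSm, hSx⟩ : S ∈ K.mesh ∧ x ∈ hull S := hex.choose_spec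
  change linInterp S (K.φhi i) x = _
  have hvert : ∀ R : Simplex p.d, ∀ j, linInterp R (K.φhi i) (R j) = K.φhi i (R j) := by
    intro R j
    rw [linInterp, Finset.sum_eq_single j]
    · simp
    · intro k _ hk
      simp [hk]
    · simp
  have hcombo : ∀ R : Simplex p.d, ∀ (y z : E p.d) (a b : ℝ), a + b = 1 →
      linInterp R (K.φhi i) (a • y + b • z) =
        a * linInterp R (K.φhi i) y + b * linInterp R (K.φhi i) z := by
    intro R y z a b hab
    simp only [linInterp, Finset.mul_sum, ← Finset.sum_add_distrib]
    refine Finset.sum_congr rfl fun j _ => ?_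
    rw [Convex.combo_affine_apply hab]
    simp only [smul_eq_mul]
    ring
  -- Two affine interpolants that agree at the common vertices agree on their convex hull, which by
  -- conformity is all of the intersection. So the element chosen in the definition is immaterial.
  have hconv : Convex ℝ {y | linInterp S (K.φhi i) y = linInterp T (K.φhi i) y} := by
    intro y hy z hz a b _ _ hab
    simp only [mem_ofPred_eq] at hy hz ⊢
    rw [hcombo S _ _ _ _ hab, hcombo T _ _ _ _ hab, hy, hz]
  have hsub : range T ∩ range S ⊆ {y | linInterp S (K.φhi i) y = linInterp T (K.φhi i) y} := by
    rintro y ⟨⟨j, rfl⟩, k, hk⟩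
    simp only [mem_ofPred_eq]
    rw [hvert T j, ← hk, hvert S k]
  have : x ∈ convexHull ℝ (range T ∩ range S) := by
    rw [← hK.conforming T hT S hSm]
    exact ⟨hx, hSx⟩
  exact convexHull_min hsub hconv this

theorem linInterp_sum (T : Simplex p.d) (t : ℝ) (x : E p.d) :
    ∑ i, K.ell i t * linInterp T (K.φhi i) x = linInterp T (fun y => K.φh y t) x := by
  simp only [linInterp, φh, Finset.mul_sum]
  rw [Finset.sum_comm]
  exact Finset.sum_congr rfl fun j _ => Finset.sum_congr rfl fun i _ => by ring

theorem IsTriangulation.φlin_eq (hK : K.IsTriangulation) {T : Simplex p.d} (hT : T ∈ K.mesh)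
    (t : ℝ) {x : E p.d} (hx : x ∈ hull T) :
    K.φlin x t = linInterp T (fun y => K.φh y t) x := by
  rw [← linInterp_sum, φlin]
  exact Finset.sum_congr rfl fun i _ => by rw [hK.φlini_eq hT i hx]

theorem IsTriangulation.continuousOn_φlin (hK : K.IsTriangulation) (t : ℝ) :
    ContinuousOn (fun x => K.φlin x t) (closure K.bg) := by
  rw [← hK.cover, biUnion_eq_iUnion]
  have : Finite K.mesh := hK.finite
  refine (locallyFinite_of_finite _).continuousOn_iUnion (fun T => isClosed_hull T.1) fun T => ?_
  exact (continuous_linInterp T.1 (fun y => K.φh y t)).continuousOn.congr fun x hx =>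
    hK.φlin_eq T.2 t hx

theorem exists_mem_mesh (hK : K.IsTriangulation) {x : E p.d} (hx : x ∈ closure K.bg) :
    ∃ T ∈ K.mesh, x ∈ hull T := by
  rw [← hK.cover] at hx
  simpa using hx

theorem isOpen_U (hK : K.IsTriangulation) (t : ℝ) : IsOpen (K.U t) :=
  hK.isOpen.inter isOpen_thickening

theorem Ubar_subset_U {t : ℝ} (ht : t ∈ K.I) : K.Ubar ⊆ K.U t := by
  intro x hx
  simp only [Ubar, mem_iUnion] at hx
  obtain ⟨T, hT, hx⟩ := hx
  exact hT.2 t ht hx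

theorem contDiffOn_slice (hφ : K.LevelSet) {t : ℝ} (ht : t ∈ K.I) :
    ContDiffOn ℝ 2 (fun y => K.φ y t) (K.U t) := by
  have h : ContDiffOn ℝ 2 (fun y : E p.d => (y, t)) (K.U t) :=
    (contDiff_id.prodMk contDiff_const).contDiffOn
  exact hφ.contDiff.comp h fun y hy => ⟨ht, hy⟩

theorem differentiableAt_slice (hK : K.IsTriangulation) (hφ : K.LevelSet) {t : ℝ} (ht : t ∈ K.I)
    {x : E p.d} (hx : x ∈ K.U t) : DifferentiableAt ℝ (fun y => K.φ y t) x :=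
  ((contDiffOn_slice hφ ht).contDiffAt ((isOpen_U hK t).mem_nhds hx)).differentiableAt (by simp)

theorem norm_fderiv_slice_le (hφ : K.LevelSet) {t : ℝ} (ht : t ∈ K.I) {x : E p.d}
    (hx : x ∈ K.U t) : ‖fderiv ℝ (fun y => K.φ y t) x‖ ≤ p.Cφ := by
  rw [← norm_gradient]
  exact hφ.grad_upper t ht x hx

/-- `φ(·,t)` is Lipschitz continuous on convex subsets of `U(t)`. -/
theorem abs_φ_sub_le (hK : K.IsTriangulation) (hφ : K.LevelSet) {t : ℝ} (ht : t ∈ K.I)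
    {B : Set (E p.d)} (hB : Convex ℝ B) (hBU : B ⊆ K.U t) {x y : E p.d} (hx : x ∈ B) (hy : y ∈ B) :
    |K.φ x t - K.φ y t| ≤ p.Cφ * dist x y := by
  rw [dist_eq_norm, ← Real.norm_eq_abs]
  exact hB.norm_image_sub_le_of_norm_fderiv_le
    (fun z hz => differentiableAt_slice hK hφ ht (hBU hz))
    (fun z hz => norm_fderiv_slice_le hφ ht (hBU hz)) hy hx

theorem abs_φ_time_sub_le (hφ : K.LevelSet) {x : E p.d}
    (hx : ∀ t ∈ K.I, x ∈ K.U t) {s t : ℝ} (hs : s ∈ K.I) (ht : t ∈ K.I) :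
    |K.φ x s - K.φ x t| ≤ p.M * K.Δt := by
  have hd : DifferentiableOn ℝ (fun s => K.φ x s) K.I := by
    have h : ContDiffOn ℝ 2 (fun s : ℝ => (x, s)) K.I :=
      (contDiff_const.prodMk contDiff_id).contDiffOn
    exact (hφ.contDiff.comp h fun s hs => ⟨hs, hx s hs⟩).differentiableOn (by simp)
  have h1 := (convex_Icc K.t₀ K.t₁).norm_image_sub_le_of_norm_derivWithin_le hd
    (fun u hu => hφ.dt_bound u hu x (hx u hu)) ht hs
  have hM : 0 ≤ p.M := (abs_nonneg _).trans (hφ.dt_bound s hs x (hx s hs))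
  refine h1.trans (mul_le_mul_of_nonneg_left ?_ hM)
  rw [Real.norm_eq_abs, abs_le, Δt]
  constructor <;> linarith [hs.1, hs.2, ht.1, ht.2]

/-- The weak signed distance property yields a point of the interface in the vicinity. -/
theorem exists_mem_frontier (hφ : K.LevelSet) {t : ℝ} (ht : t ∈ K.I) {x : E p.d}
    (hx : x ∈ K.U t) (hsmall : |K.φ x t| < p.cw * p.ε₀) :
    ∃ z ∈ frontier (K.Om t), dist x z ≤ p.Cφ * (|K.φ x t| / p.cw) := by
  set g := K.G x t with hg
  have hε := p.ε₀_pos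
  have hcw := p.cw_pos
  have hmem : ∀ e : ℝ, |e| ≤ p.ε₀ → x + e • g ∈ K.bg := fun e he =>
    (hφ.wsd t ht x hx e e he he).1
  set ψ : ℝ → ℝ := fun e => K.φ (x + e • g) t with hψ
  have hlow : ∀ e e' : ℝ, |e| ≤ p.ε₀ → |e'| ≤ p.ε₀ → p.cw * |e - e'| ≤ |ψ e - ψ e'| :=
    fun e e' he he' => (hφ.wsd t ht x hx e e' he he').2.1
  have hcont : ContinuousOn ψ (Icc (-p.ε₀) p.ε₀) := by
    have h : ContinuousOn (fun e : ℝ => (x + e • g, t)) (Icc (-p.ε₀) p.ε₀) := by fun_prop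
    exact hφ.cont.comp h fun e he => ⟨hmem e (abs_le.2 he), ht⟩
  have hinj : InjOn ψ (Icc (-p.ε₀) p.ε₀) := by
    intro e he e' he' heq
    have := hlow e e' (abs_le.2 he) (abs_le.2 he')
    rw [heq, sub_self, abs_zero] at this
    have : |e - e'| ≤ 0 := by
      by_contra! hlt
      nlinarith
    exact sub_eq_zero.1 (abs_nonpos_iff.1 this)
  have hψ0 : ψ 0 = K.φ x t := by simp [hψ]
  have h0 : (0 : ℝ) ∈ Icc (-p.ε₀) p.ε₀ := ⟨by linarith, hε.le⟩
  have hl : -p.ε₀ ∈ Icc (-p.ε₀) p.ε₀ := ⟨le_rfl, by linarith⟩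
  have hr : p.ε₀ ∈ Icc (-p.ε₀) p.ε₀ := ⟨by linarith, le_rfl⟩
  have hel := hlow (-p.ε₀) 0 (abs_le.2 hl) (abs_le.2 h0)
  have her := hlow p.ε₀ 0 (abs_le.2 hr) (abs_le.2 h0)
  rw [hψ0] at hel her
  rw [sub_zero, abs_neg, abs_of_pos hε] at hel
  rw [sub_zero, abs_of_pos hε] at her
  have hab := abs_lt.1 hsmall
  -- Being continuous and injective, ψ is strictly monotone, and it changes by at least cw ε₀ >
  -- |φ(x,t)| on either side of 0, so it vanishes in the open interval. Negative values arbitrarily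
  -- near the zero are recorded because a boundary point of the set where φ < 0 is wanted, not just
  -- a zero.
  have hzero : ∃ e ∈ Ioo (-p.ε₀) p.ε₀, ψ e = 0 ∧
      ∃ᶠ e' in 𝓝 e, x + e' • g ∈ K.Om t := by
    have hneg : ∀ e ∈ Ioo (-p.ε₀) p.ε₀, (∃ᶠ e' in 𝓝 e, ψ e' < 0) →
        ∃ᶠ e' in 𝓝 e, x + e' • g ∈ K.Om t := by
      intro e he hf
      refine (hf.and_eventually (Ioo_mem_nhds he.1 he.2)).mono ?_
      rintro e' ⟨h1, h2⟩
      exact ⟨hmem e' (abs_le.2 ⟨h2.1.le, h2.2.le⟩), h1⟩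
    rcases hcont.strictMonoOn_of_injOn_Icc' (by linarith) hinj with hm | hm
    · have h1 : ψ (-p.ε₀) < ψ 0 := hm hl h0 (by linarith)
      have h2 : ψ 0 < ψ p.ε₀ := hm h0 hr hε
      rw [hψ0] at h1 h2
      rw [abs_of_neg (by linarith)] at hel
      rw [abs_of_pos (by linarith)] at her
      obtain ⟨e, he, he0⟩ := intermediate_value_Ioo (by linarith : -p.ε₀ ≤ p.ε₀) hcont
        (show (0 : ℝ) ∈ Ioo (ψ (-p.ε₀)) (ψ p.ε₀) from ⟨by linarith, by linarith⟩)
      refine ⟨e, he, he0, hneg e he ?_⟩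
      have h3 : ∀ᶠ e' in 𝓝[<] e, ψ e' < 0 := by
        filter_upwards [Ioo_mem_nhdsLT he.1] with e' he'
        rw [← he0]
        exact hm ⟨he'.1.le, (he'.2.trans he.2).le⟩ ⟨he.1.le, he.2.le⟩ he'.2
      exact h3.frequently.filter_mono nhdsWithin_le_nhds
    · have h1 : ψ 0 < ψ (-p.ε₀) := hm hl h0 (by linarith)
      have h2 : ψ p.ε₀ < ψ 0 := hm h0 hr hε
      rw [hψ0] at h1 h2
      rw [abs_of_pos (by linarith)] at hel
      rw [abs_of_neg (by linarith)] at her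
      obtain ⟨e, he, he0⟩ := intermediate_value_Ioo' (by linarith : -p.ε₀ ≤ p.ε₀) hcont
        (show (0 : ℝ) ∈ Ioo (ψ p.ε₀) (ψ (-p.ε₀)) from ⟨by linarith, by linarith⟩)
      refine ⟨e, he, he0, hneg e he ?_⟩
      have h3 : ∀ᶠ e' in 𝓝[>] e, ψ e' < 0 := by
        filter_upwards [Ioo_mem_nhdsGT he.2] with e' he'
        rw [← he0]
        exact hm ⟨he.1.le, he.2.le⟩ ⟨(he.1.trans he'.1).le, he'.2.le⟩ he'.1
      exact h3.frequently.filter_mono nhdsWithin_le_nhds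
  obtain ⟨e, he, he0, hfreq⟩ := hzero
  have heε : |e| ≤ p.ε₀ := abs_le.2 ⟨he.1.le, he.2.le⟩
  refine ⟨x + e • g, ⟨?_, fun hint => ?_⟩, ?_⟩
  · rw [mem_closure_iff_frequently]
    have hc : Tendsto (fun e' : ℝ => x + e' • g) (𝓝 e) (𝓝 (x + e • g)) := by
      have : Continuous (fun e' : ℝ => x + e' • g) := by fun_prop
      exact this.tendsto e
    exact hc.frequently hfreq
  · have := (interior_subset hint).2
    simp only [hψ] at he0
    rw [he0] at this
    exact lt_irrefl _ this
  · have h1 := hlow 0 e (abs_le.2 h0) heε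
    rw [hψ0, he0, sub_zero, zero_sub, abs_neg] at h1
    have h2 : |e| ≤ |K.φ x t| / p.cw := by
      rw [le_div_iff₀ hcw, mul_comm]; exact h1
    rw [dist_eq_norm, sub_add_cancel_left, norm_neg, norm_smul, Real.norm_eq_abs, mul_comm]
    have h3 := hφ.grad_upper t ht x hx
    exact mul_le_mul h3 h2 (abs_nonneg _) ((norm_nonneg _).trans h3)

/-! Accuracy of the discrete level set function on closed elements. -/

theorem continuousOn_φh (hh : K.DiscreteLevelSet) {T : Simplex p.d} (hT : T ∈ K.mesh) (t : ℝ) :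
    ContinuousOn (fun y => K.φh y t) (hull T) := by
  have h : Continuous (fun y => ∑ i, K.ell i t * K.ext T i y) :=
    continuous_finsetSum _ fun i _ => continuous_const.mul
      (contDiff_eval (K.poly T i) (n := 0)).continuous
  refine h.continuousOn.congr fun y hy => ?_
  simp only [φh]
  exact Finset.sum_congr rfl fun i _ => by rw [hh.eq_poly T hT i y hy]

theorem differentiableAt_φh (hh : K.DiscreteLevelSet) {T : Simplex p.d} (hT : T ∈ K.mesh) (t : ℝ)
    {x : E p.d} (hx : x ∈ interior (hull T)) : DifferentiableAt ℝ (fun y => K.φh y t) x := by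
  have h : DifferentiableAt ℝ (fun y => ∑ i, K.ell i t * K.ext T i y) x :=
    DifferentiableAt.fun_sum fun i _ => ((contDiff_eval (K.poly T i) (n := 1)).differentiable
      (by simp) x).const_mul _
  refine h.congr_of_eventuallyEq ?_
  filter_upwards [isOpen_interior.mem_nhds hx] with y hy
  simp only [φh]
  exact Finset.sum_congr rfl fun i _ => by rw [hh.eq_poly T hT i y (interior_subset hy)]

theorem continuousOn_φ_slice (hφ : K.LevelSet) {t : ℝ} (ht : t ∈ K.I) :
    ContinuousOn (fun y => K.φ y t) K.bg := by
  have h : ContinuousOn (fun y : E p.d => (y, t)) K.bg := by fun_prop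
  exact hφ.cont.comp h fun y hy => ⟨hy, ht⟩

theorem abs_φ_sub_φh_le (hφ : K.LevelSet) (hh : K.DiscreteLevelSet) {T : Simplex p.d}
    (hT : T ∈ K.meshU) {t : ℝ} (ht : t ∈ K.I) {x : E p.d} (hx : x ∈ hull T) :
    |K.φ x t - K.φh x t| ≤ p.M * (K.h ^ (p.qs + 1) + K.Δt ^ (p.qt + 1)) := by
  have hc : ContinuousOn (fun y => K.φ y t - K.φh y t) (hull T) :=
    ((continuousOn_φ_slice hφ ht).mono fun y hy => (hT.2 t ht hy).1).sub
      (continuousOn_φh hh hT.1 t)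
  refine norm_le_of_interior_hull T hc (fun y hy => ?_) x hx
  simpa using hh.accurate 0 0 (Or.inl ⟨Nat.zero_le _, Nat.zero_le _⟩) T hT y hy t ht

/-- The gradient error is integrated over the convex open element, then extended to the closed
element by continuity, one argument at a time. Used for differences between vertices, this avoids
dividing the value error by the diameter, which would cost a term Δt^(q_t+1) / h. -/
theorem abs_φ_sub_φh_sub_le (hK : K.IsTriangulation) (hφ : K.LevelSet) (hh : K.DiscreteLevelSet)
    {T : Simplex p.d} (hT : T ∈ K.meshU) {t : ℝ} (ht : t ∈ K.I) {x y : E p.d} (hx : x ∈ hull T)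
    (hy : y ∈ hull T) :
    |(K.φ x t - K.φh x t) - (K.φ y t - K.φh y t)| ≤
      p.M * (K.h ^ p.qs + K.Δt ^ (p.qt + 1)) * dist x y := by
  set u : E p.d → ℝ := fun y => K.φ y t - K.φh y t with hu
  set B := p.M * (K.h ^ p.qs + K.Δt ^ (p.qt + 1)) with hB
  have hc : ContinuousOn u (hull T) :=
    ((continuousOn_φ_slice hφ ht).mono fun y hy => (hT.2 t ht hy).1).sub
      (continuousOn_φh hh hT.1 t)
  have hint : ∀ x ∈ interior (hull T), ∀ y ∈ interior (hull T), |u x - u y| ≤ B * dist x y := by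
    intro x hx y hy
    rw [dist_eq_norm, ← Real.norm_eq_abs]
    refine (convex_hull T).interior.norm_image_sub_le_of_norm_fderiv_le (𝕜 := ℝ) (fun z hz => ?_)
      (fun z hz => ?_) hy hx
    · exact (differentiableAt_slice hK hφ ht (hT.2 t ht (interior_subset hz))).sub
        (differentiableAt_φh hh hT.1 t hz)
    · have := hh.accurate 1 0 (Or.inl ⟨by omega, Nat.zero_le _⟩) T hT z hz t ht
      rw [norm_iteratedFDeriv_one] at this
      simpa using this
  have hcl := closure_interior_hull T
  have h1 : ∀ y ∈ interior (hull T), ∀ x ∈ hull T, |u x - u y| ≤ B * dist x y := by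
    intro y hy x hx
    rw [← hcl] at hx hc
    exact le_on_closure (fun x hx => hint x hx y hy) ((hc.sub continuousOn_const).abs)
      (by fun_prop) hx
  rw [← hcl] at hy
  exact le_on_closure (f := fun y => |u x - u y|) (g := fun y => B * dist x y)
    (fun y hy => h1 y hy x hx) (by rw [hcl]; exact (continuousOn_const.sub hc).abs)
    (by fun_prop) hy

/-- First order approximation of `φ` by `φ^lin`. -/
theorem abs_φlin_sub_φ_le (hK : K.IsTriangulation) (hφ : K.LevelSet) (hh : K.DiscreteLevelSet)
    {T : Simplex p.d} (hT : T ∈ K.meshU) {t : ℝ} (ht : t ∈ K.I) {x : E p.d} (hx : x ∈ hull T) :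
    |K.φlin x t - K.φ x t| ≤
      p.Cφ * K.h + p.M * (K.h ^ (p.qs + 1) + K.Δt ^ (p.qt + 1)) := by
  rw [hK.φlin_eq hT.1 t hx]
  refine abs_linInterp_sub_le T hx fun j => ?_
  have hv := vertex_mem_hull T j
  have h1 := abs_φ_sub_φh_le hφ hh hT ht hv
  have h2 := abs_φ_sub_le hK hφ ht (convex_hull T) (hT.2 t ht) hv hx
  have hC : 0 ≤ p.Cφ := (norm_nonneg _).trans (hφ.grad_upper t ht x (hT.2 t ht hx))
  have h3 := mul_le_mul_of_nonneg_left (hK.dist_le hT.1 hv hx) hC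
  have h4 : K.φh (T j) t - K.φ x t = (K.φ (T j) t - K.φ x t) - (K.φ (T j) t - K.φh (T j) t) := by
    ring
  rw [h4]
  refine (abs_sub _ _).trans ?_
  linarith

/-! ### The discrete interface and the cut elements -/

namespace Admissible

variable {bl : Blending}

theorem Δt_pos (hK : K.Admissible bl) : 0 < K.Δt := sub_pos.2 hK.time_lt

theorem h_pos (hK : K.Admissible bl) : 0 < K.h := by
  -- With h = 0 the time step restriction would force Δt = 0.
  refine lt_of_le_of_ne h_nonneg fun h0 => ?_
  have h1 := hK.timeStep
  rw [← h0, Real.zero_rpow (by linarith [p.ε_pos]), mul_zero] at h1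
  exact absurd (pow_pos hK.Δt_pos _) (not_lt.2 h1)

theorem Δt_pow_le (hK : K.Admissible bl) (h1 : K.h ≤ 1) :
    K.Δt ^ (p.qt + 1) ≤ |p.CΔ| * K.h := by
  refine hK.timeStep.trans ?_
  have h2 : K.h ^ (1 + p.ε) ≤ K.h := by
    have := Real.rpow_le_rpow_of_exponent_ge hK.h_pos h1 (by linarith [p.ε_pos] : 1 ≤ 1 + p.ε)
    simpa using this
  exact mul_le_mul (le_abs_self _) h2 (Real.rpow_nonneg h_nonneg _) (abs_nonneg _)

theorem active_subset_mesh : K.active bl ⊆ K.mesh := by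
  cases bl with
  | finiteElement => exact fun T hT => hT.1
  | smooth => exact fun T hT => hT.1

/-- For smooth blending, b = 0 on a cut element makes it active once the element is known to meet
the open domain; it does, since its interior is a nonempty open subset of the closure of the domain.
-/
theorem cut_subset_active (hK : K.Admissible bl) : K.cut ⊆ K.active bl := by
  cases bl with
  | finiteElement => exact subset_rfl
  | smooth =>
    intro T hT
    have hb := hK.blending
    simp only [IsBlending] at hb
    have ht : K.t₀ ∈ K.I := left_mem_Icc.2 hK.time_lt.le
    have h1 : (interior (hull T) ∩ K.bg).Nonempty := by
      obtain ⟨x, hx⟩ := interior_hull_nonempty T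
      have hx' : x ∈ closure K.bg := by
        rw [← hK.triangulation.cover]
        exact mem_biUnion hT.1 (interior_subset hx)
      exact mem_closure_iff.1 hx' _ isOpen_interior hx
    obtain ⟨x, hx, hxb⟩ := h1
    refine ⟨hT.1, K.t₀, ht, x, ⟨interior_subset hx, hxb⟩, ?_⟩
    rw [hb.2.1 T hT x (interior_subset hx) K.t₀ ht]
    exact zero_lt_one

theorem b_mem (hK : K.Admissible bl) {x : E p.d} (hx : x ∈ K.bg) {t : ℝ} (ht : t ∈ K.I) :
    K.b x t ∈ Icc (0 : ℝ) 1 := by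
  have hb := hK.blending
  cases bl with
  | finiteElement =>
    simp only [IsBlending] at hb
    rw [hb]
    simp
  | smooth => exact hb.1 x hx t ht

/-- A point of the discrete interface lies in a cut element, and `φ^lin` vanishes there. -/
theorem exists_cut (hK : K.Admissible bl) {t : ℝ} (ht : t ∈ K.I) {y : E p.d}
    (hy : y ∈ frontier (K.Omlin t)) : ∃ S ∈ K.meshU, y ∈ hull S ∧ K.φlin y t = 0 := by
  have hsub : K.Omlin t ⊆ K.bg := fun x hx => hx.1
  have hyc : y ∈ closure K.bg := closure_mono hsub hy.1
  obtain ⟨S, hS, hyS⟩ := exists_mem_mesh hK.triangulation hyc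
  -- The element S is cut, hence active, hence contained in U(t). This places y inside the open
  -- domain, so that φ^lin is continuous on a full neighbourhood of y.
  have hSU : S ∈ K.meshU := hK.active_subset (hK.cut_subset_active ⟨hS, t, ht, y, hy, hyS⟩)
  refine ⟨S, hSU, hyS, ?_⟩
  have hyb : y ∈ K.bg := (hSU.2 t ht hyS).1
  have hcont : ContinuousAt (fun x => K.φlin x t) y :=
    (hK.triangulation.continuousOn_φlin t).continuousAt
      (mem_of_superset (hK.triangulation.isOpen.mem_nhds hyb) subset_closure)
  refine le_antisymm ?_ ?_
  · have hfr : ∃ᶠ x in 𝓝 y, x ∈ K.Omlin t := mem_closure_iff_frequently.1 hy.1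
    by_contra! hpos
    have h1 : ∀ᶠ x in 𝓝 y, 0 < K.φlin x t := hcont.eventually (lt_mem_nhds hpos)
    obtain ⟨x, hx1, hx2⟩ := (hfr.and_eventually h1).exists
    exact lt_asymm hx2 hx1.2
  · by_contra! hneg
    apply hy.2
    rw [mem_interior_iff_mem_nhds]
    filter_upwards [hcont.eventually (gt_mem_nhds hneg),
      hK.triangulation.isOpen.mem_nhds hyb] with x h1 h2
    exact ⟨h2, h1⟩

end Admissible

end Config

/-! ### Points in active elements -/

/-- A point in an active element of an admissible configuration. -/
structure Loc (p : Params) where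
  K : Config p
  bl : Blending
  T : Simplex p.d
  x : E p.d
  adm : K.Admissible bl
  active : T ∈ K.active bl
  mem : x ∈ hull T

/-- The filter of vanishing mesh size. -/
noncomputable def small (p : Params) : Filter (Loc p) := comap (fun a => a.K.h) (𝓝 0)

theorem eventually_h_le (p : Params) {δ : ℝ} (hδ : 0 < δ) : ∀ᶠ a in small p, a.K.h ≤ δ :=
  (eventually_le_nhds hδ).comap _

/-- The time step restriction gives Δt^(q_t+1) ≤ |CΔ| h for h ≤ 1, so Δt tends to zero with h. -/
theorem eventually_Δt_le (p : Params) {δ : ℝ} (hδ : 0 < δ) : ∀ᶠ a in small p, a.K.Δt ≤ δ := by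
  have hC : 0 < |p.CΔ| + 1 := by positivity
  have h2 : 0 < δ ^ (p.qt + 1) / (|p.CΔ| + 1) := by positivity
  filter_upwards [eventually_h_le p one_pos, eventually_h_le p h2] with a h1 h2
  by_contra! hlt
  have h3 := a.adm.Δt_pow_le h1
  have h4 : δ ^ (p.qt + 1) < a.K.Δt ^ (p.qt + 1) := pow_lt_pow_left₀ hlt hδ.le (by omega)
  rw [le_div_iff₀ hC] at h2
  have := a.adm.h_pos
  nlinarith

namespace Loc

variable {p : Params} (a : Loc p)

theorem meshU : a.T ∈ a.K.meshU := a.adm.active_subset a.active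

theorem mesh : a.T ∈ a.K.mesh := a.meshU.1

theorem mem_U {t : ℝ} (ht : t ∈ a.K.I) : a.x ∈ a.K.U t := a.meshU.2 t ht a.mem

/-- A point of the discrete interface close to an active element. -/
theorem exists_interface_near : ∃ t ∈ a.K.I, ∃ y ∈ frontier (a.K.Omlin t),
    dist a.x y ≤ p.wb + 2 * a.K.h := by
  obtain ⟨K, bl, T, x, adm, active, mem⟩ := a
  have hh := adm.h_pos
  have hw := p.wb_pos
  cases bl with
  | finiteElement =>
    obtain ⟨hT, t, ht, y, hy, hyT⟩ := active
    refine ⟨t, ht, y, hy, ?_⟩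
    have := adm.triangulation.dist_le hT mem hyT
    simp only
    linarith
  | smooth =>
    obtain ⟨hT, t, ht, x', ⟨hx'T, hx'b⟩, hb⟩ := active
    have hbl := adm.blending
    have h1 : ¬ ENNReal.ofReal p.wb < infEDist x' (frontier (K.Omlin t)) := fun hlt =>
      hb.ne (hbl.2.2.1 t ht x' hx'b hlt)
    -- Distances to the interface beyond w_b are excluded by b < 1. The extra h makes the inequality
    -- strict, so that an actual interface point can be picked.
    have h2 : infEDist x' (frontier (K.Omlin t)) < ENNReal.ofReal (p.wb + K.h) :=
      (not_lt.1 h1).trans_lt ((ENNReal.ofReal_lt_ofReal_iff (by positivity)).2 (by linarith))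
    obtain ⟨y, hy, hyd⟩ := infEDist_lt_iff.1 h2
    rw [edist_dist, ENNReal.ofReal_lt_ofReal_iff (by positivity)] at hyd
    refine ⟨t, ht, y, hy, ?_⟩
    have := adm.triangulation.dist_le hT mem hx'T
    have h3 := dist_triangle x x' y
    simp only
    linarith

end Loc

/-- The ball is connected and misses the boundary of `D`, so it cannot leave `D`. -/
theorem ball_subset_of_dist_frontier {d : ℕ} {D : Set (E d)} (hD : IsOpen D) {z : E d} {δ : ℝ}
    (hδ : 0 < δ) (hz : z ∈ closure D) (h : ∀ y ∈ frontier D, δ < dist z y) : ball z δ ⊆ D := by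
  have hzD : z ∈ D := by
    by_contra hn
    have : z ∈ frontier D := ⟨hz, fun hi => hn (interior_subset hi)⟩
    have := h z this
    rw [dist_self] at this
    exact lt_asymm this hδ
  refine (isPreconnected_ball (x := z) (r := δ)).subset_left_of_subset_union hD
    isClosed_closure.isOpen_compl
    (disjoint_compl_right.mono_left subset_closure) ?_ ⟨z, mem_ball_self hδ, hzD⟩
  intro w hw
  by_contra hn
  rw [mem_union, not_or, mem_compl_iff, not_not] at hn
  have : w ∈ frontier D := ⟨hn.2, fun hi => hn.1 (interior_subset hi)⟩
  have := h w this
  rw [mem_ball, dist_comm] at hw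
  exact lt_asymm this hw

/-- Active elements stay away from the boundary of the region where `φ` is regular. -/
theorem exists_ball_subset (p : Params) :
    ∃ ρ, 0 < ρ ∧ ∀ᶠ a in small p, ball a.x ρ ⊆ interior a.K.Ubar := by
  -- A quarter of the gap between w_b and min(δΩ, δU): one ρ is spent on reaching a zero of φ, two
  -- on the radius of the ball placed in U(s), and one is left for strictness.
  set δ := min p.δΩ p.δU with hδ
  set ρ := (δ - p.wb) / 4 with hρ
  have hρ0 : 0 < ρ := by
    have := p.wb_lt
    rw [hρ]
    linarith
  refine ⟨ρ, hρ0, ?_⟩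
  have hcw := p.cw_pos
  have hε := p.ε₀_pos
  set A : ℝ := |p.Cφ| + |p.M| * (1 + |p.CΔ|) with hA
  have hA0 : 0 ≤ A := by positivity
  -- The first bound keeps φ within the range cw ε₀ of the weak signed distance property; the second
  -- makes the resulting zero lie within ρ/2.
  set ε := min (p.cw * p.ε₀ / 2) (p.cw * ρ / (2 * (|p.Cφ| + 1))) with hεd
  have hε0 : 0 < ε := by positivity
  filter_upwards [eventually_h_le p one_pos, eventually_h_le p (show 0 < ρ / 4 by positivity),
    eventually_h_le p (show 0 < ε / (2 * (A + 1)) by positivity),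
    eventually_Δt_le p (show 0 < ε / (2 * (|p.M| + 1)) by positivity)] with a h1 hhρ hhε hΔε
  obtain ⟨t, ht, y, hy, hxy⟩ := a.exists_interface_near
  obtain ⟨S, hS, hyS, hy0⟩ := a.adm.exists_cut ht hy
  have hh0 := a.adm.h_pos
  have hΔ0 := a.adm.Δt_pos
  have hφ := a.adm.levelSet
  have htri := a.adm.triangulation
  -- φ^lin vanishes at y for one time only, but φ is then O(h) at that time and O(h + Δt) at every
  -- other time.
  have hval : ∀ s ∈ a.K.I, |a.K.φ y s| ≤ ε := by
    intro s hs
    have e1 := Config.abs_φlin_sub_φ_le htri hφ a.adm.discrete hS ht hyS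
    rw [hy0, zero_sub, abs_neg] at e1
    have e2 := Config.abs_φ_time_sub_le hφ (fun s hs => hS.2 s hs hyS) hs ht
    have e3 : a.K.h ^ (p.qs + 1) ≤ a.K.h := by
      simpa using pow_le_pow_of_le_one hh0.le h1 (show 1 ≤ p.qs + 1 by omega)
    have e4 := a.adm.Δt_pow_le h1
    have e5 : p.Cφ * a.K.h ≤ |p.Cφ| * a.K.h :=
      mul_le_mul_of_nonneg_right (le_abs_self _) hh0.le
    have e6 : p.M * (a.K.h ^ (p.qs + 1) + a.K.Δt ^ (p.qt + 1)) ≤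
        |p.M| * (a.K.h + |p.CΔ| * a.K.h) :=
      mul_le_mul (le_abs_self _) (add_le_add e3 e4) (by positivity) (abs_nonneg _)
    have e7 : p.M * a.K.Δt ≤ |p.M| * a.K.Δt :=
      mul_le_mul_of_nonneg_right (le_abs_self _) hΔ0.le
    have e8 : |a.K.φ y t| ≤ A * a.K.h := by
      rw [hA]; linarith
    have e9 : A * a.K.h ≤ ε / 2 := by
      rw [le_div_iff₀ (by positivity)] at hhε
      nlinarith
    have e10 : |p.M| * a.K.Δt ≤ ε / 2 := by
      rw [le_div_iff₀ (by positivity)] at hΔε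
      nlinarith
    have e11 : |a.K.φ y s| ≤ |a.K.φ y s - a.K.φ y t| + |a.K.φ y t| := by
      have := abs_add_le (a.K.φ y s - a.K.φ y t) (a.K.φ y t)
      rwa [sub_add_cancel] at this
    linarith
  have hnear : ∀ s ∈ a.K.I, ∃ z ∈ frontier (a.K.Om s), dist a.x z ≤ p.wb + ρ := by
    intro s hs
    have e1 := hval s hs
    have e2 : ε ≤ p.cw * p.ε₀ / 2 := min_le_left _ _
    obtain ⟨z, hz, hd⟩ := Config.exists_mem_frontier hφ hs (hS.2 s hs hyS)
      (by nlinarith [mul_pos hcw hε])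
    refine ⟨z, hz, ?_⟩
    have e3 : p.Cφ * (|a.K.φ y s| / p.cw) ≤ ρ / 2 := by
      have e4 : |a.K.φ y s| / p.cw ≤ ρ / (2 * (|p.Cφ| + 1)) := by
        rw [div_le_iff₀ hcw]
        refine e1.trans ((min_le_right _ _).trans (le_of_eq ?_))
        ring
      have e5 : p.Cφ * (|a.K.φ y s| / p.cw) ≤ (|p.Cφ| + 1) * (ρ / (2 * (|p.Cφ| + 1))) :=
        mul_le_mul (by linarith [le_abs_self p.Cφ]) e4 (by positivity) (by positivity)
      refine e5.trans (le_of_eq ?_)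
      field_simp
    have := dist_triangle a.x y z
    linarith
  have hball : ∀ s ∈ a.K.I, ball a.x (2 * ρ) ⊆ a.K.U s := by
    intro s hs w hw
    obtain ⟨z, hz, hd⟩ := hnear s hs
    have hwz : dist w z < δ := by
      have e1 := dist_triangle w a.x z
      rw [mem_ball] at hw
      have e2 : δ = p.wb + 4 * ρ := by rw [hρ]; ring
      linarith
    have hsub : a.K.Om s ⊆ a.K.bg := fun x hx => hx.1
    have hzb : ball z p.δΩ ⊆ a.K.bg := ball_subset_of_dist_frontier htri.isOpen p.δΩ_pos
      (closure_mono hsub hz.1) (hφ.dist_lt s hs z hz)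
    refine ⟨hzb ?_, ?_⟩
    · rw [mem_ball]; exact hwz.trans_le (min_le_left _ _)
    · rw [mem_thickening_iff]
      exact ⟨z, hz, hwz.trans_le (min_le_right _ _)⟩
  -- A mesh element that meets the ball of radius ρ stays in the ball of radius 2ρ, hence in U(s)
  -- for all s, so the smaller ball is covered by elements of `meshU`.
  refine interior_maximal ?_ isOpen_ball
  intro w hw
  rw [mem_ball] at hw
  have hI : a.K.t₀ ∈ a.K.I := left_mem_Icc.2 a.adm.time_lt.le
  have hwb : w ∈ a.K.bg := (hball _ hI (by rw [mem_ball]; linarith)).1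
  obtain ⟨R, hR, hwR⟩ := Config.exists_mem_mesh htri (subset_closure hwb)
  simp only [Config.Ubar, mem_iUnion]
  refine ⟨R, ⟨hR, fun s hs v hv => hball s hs ?_⟩, hwR⟩
  have e1 := htri.dist_le hR hv hwR
  have e2 := dist_triangle v w a.x
  rw [mem_ball]
  linarith

end SpaceTimeMapping

namespace SpaceTimeMapping

open Filter Topology

/-! ### Bounds on the region covered by the elements of `meshU` -/

theorem norm_fderiv_fderiv {d : ℕ} (u : E d → ℝ) (x : E d) :
    ‖fderiv ℝ (fderiv ℝ u) x‖ = ‖iteratedFDeriv ℝ 2 u x‖ := by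
  rw [← norm_iteratedFDeriv_fderiv, norm_iteratedFDeriv_one]

/-- Bounds for lower derivatives in a small ball from bounds in the center. -/
theorem norm_iteratedFDeriv_le_of_center {d : ℕ} {w : E d → ℝ} {O : Set (E d)} (hO : IsOpen O)
    {n : ℕ} (hw : ContDiffOn ℝ n w O) {x : E d} {M δ R : ℝ} (hR : 0 ≤ R) (hδ : 0 ≤ δ)
    (hball : closedBall x (R * δ) ⊆ O)
    (htop : ∀ y ∈ closedBall x (R * δ), ‖iteratedFDeriv ℝ n w y‖ ≤ M)
    (hx : ∀ m ≤ n, ‖iteratedFDeriv ℝ m w x‖ ≤ M * δ ^ (n - m)) {k : ℕ} (hk : k ≤ n) :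
    ∀ y ∈ closedBall x (R * δ), ‖iteratedFDeriv ℝ (n - k) w y‖ ≤ M * (1 + R) ^ k * δ ^ k := by
  have hxm : x ∈ closedBall x (R * δ) := mem_closedBall_self (by positivity)
  have hM : 0 ≤ M := (norm_nonneg _).trans (htop x hxm)
  induction k with
  | zero => simpa using htop
  | succ k ih =>
    intro y hy
    have hm : n - k = n - (k + 1) + 1 := by omega
    -- Descent by one order: the mean value inequality from the centre costs a factor R δ, and the
    -- value at the centre is already of the right order.
    have h1 := (convex_closedBall x (R * δ)).norm_image_sub_le_of_norm_fderiv_le (𝕜 := ℝ)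
      (f := iteratedFDeriv ℝ (n - (k + 1)) w) (C := M * (1 + R) ^ k * δ ^ k)
      (fun z hz => ((hw.contDiffAt (hO.mem_nhds (hball hz))).differentiableAt_iteratedFDeriv
        (by norm_cast; omega)))
      (fun z hz => by
        rw [norm_fderiv_iteratedFDeriv, ← hm]
        exact ih (by omega) z hz) hxm hy
    have h2 := hx (n - (k + 1)) (by omega)
    rw [show n - (n - (k + 1)) = k + 1 by omega] at h2
    have h3 : ‖y - x‖ ≤ R * δ := by rw [← dist_eq_norm]; exact hy
    have h4 : ‖iteratedFDeriv ℝ (n - (k + 1)) w y‖ ≤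
        M * (1 + R) ^ k * δ ^ k * (R * δ) + M * δ ^ (k + 1) := by
      have h5 := norm_le_norm_sub_add (iteratedFDeriv ℝ (n - (k + 1)) w y)
        (iteratedFDeriv ℝ (n - (k + 1)) w x)
      have h6 : M * (1 + R) ^ k * δ ^ k * ‖y - x‖ ≤ M * (1 + R) ^ k * δ ^ k * (R * δ) := by
        gcongr
      linarith
    refine h4.trans ?_
    have h7 : 1 ≤ (1 + R) ^ k := one_le_pow₀ (by linarith)
    have h8 : M * δ ^ (k + 1) ≤ M * δ ^ (k + 1) * (1 + R) ^ k :=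
      le_mul_of_one_le_right (by positivity) h7
    calc _ ≤ M * (1 + R) ^ k * δ ^ k * (R * δ) + M * δ ^ (k + 1) * (1 + R) ^ k := by linarith
      _ = _ := by ring

namespace Config

variable {p : Params} {K : Config p}

theorem interior_hull_subset {T : Simplex p.d} (hT : T ∈ K.meshU) :
    interior (hull T) ⊆ interior K.Ubar :=
  interior_mono fun _ hx => mem_biUnion hT hx

theorem norm_le_at_hull {F : Type*} [NormedAddCommGroup F] {u : E p.d → F} {B : ℝ}
    (hu : ContinuousOn u (interior K.Ubar)) {T : Simplex p.d} (hT : T ∈ K.meshU)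
    (h : ∀ y ∈ interior (hull T), ‖u y‖ ≤ B) {y : E p.d} (hy : y ∈ hull T)
    (hyO : y ∈ interior K.Ubar) : ‖u y‖ ≤ B := by
  rw [← closure_interior_hull T] at hy
  exact ContinuousWithinAt.closure_le hy
    ((hu y hyO).norm.mono (interior_hull_subset hT)) continuousWithinAt_const h

/-- The accuracy hypotheses are stated in open elements only. For a function continuous on the
interior of the union they extend across the faces. -/
theorem norm_le_of_interior_elements {F : Type*} [NormedAddCommGroup F] {u : E p.d → F} {B : ℝ}
    (hu : ContinuousOn u (interior K.Ubar))
    (h : ∀ T ∈ K.meshU, ∀ y ∈ interior (hull T), ‖u y‖ ≤ B) :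
    ∀ y ∈ interior K.Ubar, ‖u y‖ ≤ B := by
  intro y hy
  have := interior_subset hy
  simp only [Ubar, mem_iUnion] at this
  obtain ⟨T, hT, hyT⟩ := this
  exact norm_le_at_hull hu hT (h T hT) hyT hy

theorem interior_Ubar_subset_U {t : ℝ} (ht : t ∈ K.I) : interior K.Ubar ⊆ K.U t :=
  interior_subset.trans (Ubar_subset_U ht)

theorem contDiffOn_φ_interior (hφ : K.LevelSet) {t : ℝ} (ht : t ∈ K.I) :
    ContDiffOn ℝ 2 (fun y => K.φ y t) (interior K.Ubar) :=
  (contDiffOn_slice hφ ht).mono (interior_Ubar_subset_U ht)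

theorem contDiffOn_φdti_interior (hd : K.SemiDiscreteLevelSet) (i : Fin (p.qt + 1)) :
    ContDiffOn ℝ 2 (K.φdti i) (interior K.Ubar) :=
  (hd.contDiff i).of_le (by exact_mod_cast (by have := p.one_le_qs; omega : 2 ≤ p.qs + 1))

section deriv

variable {O : Set (E p.d)} {f : E p.d → ℝ}

theorem _root_.ContDiffOn.hasFDerivAt_of_isOpen (hf : ContDiffOn ℝ 2 f O) (hO : IsOpen O)
    {y : E p.d} (hy : y ∈ O) : HasFDerivAt f (fderiv ℝ f y) y :=
  ((hf.contDiffAt (hO.mem_nhds hy)).differentiableAt (by simp)).hasFDerivAt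

theorem _root_.ContDiffOn.hasFDerivAt_fderiv_of_isOpen (hf : ContDiffOn ℝ 2 f O) (hO : IsOpen O)
    {y : E p.d} (hy : y ∈ O) : HasFDerivAt (fderiv ℝ f) (fderiv ℝ (fderiv ℝ f) y) y :=
  (((hf.contDiffAt (hO.mem_nhds hy)).fderiv_right (m := 1) (by norm_num)).differentiableAt
    (by simp)).hasFDerivAt

end deriv

theorem continuousOn_iteratedFDeriv_of_isOpen {O : Set (E p.d)} (hO : IsOpen O) {f : E p.d → ℝ}
    {n m : ℕ} (hf : ContDiffOn ℝ n f O) (hm : m ≤ n) :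
    ContinuousOn (iteratedFDeriv ℝ m f) O :=
  (hf.continuousOn_iteratedFDerivWithin (by exact_mod_cast hm) hO.uniqueDiffOn).congr fun y hy =>
    (iteratedFDerivWithin_of_isOpen m hO hy).symm

theorem φdt_node (hK : K.t₀ < K.t₁) (x : E p.d) (i : Fin (p.qt + 1)) :
    K.φdt x (K.node i) = K.φdti i x :=
  K.sum_ell_node_smul hK (fun i => K.φdti i x) i

theorem φh_node (hK : K.t₀ < K.t₁) (x : E p.d) (i : Fin (p.qt + 1)) :
    K.φh x (K.node i) = K.φhi i x :=
  K.sum_ell_node_smul hK (fun i => K.φhi i x) i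

theorem φlin_node (hK : K.t₀ < K.t₁) (x : E p.d) (i : Fin (p.qt + 1)) :
    K.φlin x (K.node i) = K.φlini i x :=
  K.sum_ell_node_smul hK (fun i => K.φlini i x) i

/-! ### Accuracy of the semi-discrete functions and of the polynomial extensions -/

namespace Admissible

variable {bl : Blending}

/-- Accuracy of `φ_{Δt,i}` in the region where `φ` is regular. -/
theorem φdti_sub_φ_bounds (hK : K.Admissible bl) (i : Fin (p.qt + 1)) {y : E p.d}
    (hy : y ∈ interior K.Ubar) :
    |K.φdti i y - K.φ y (K.node i)| ≤ p.M * (K.h ^ (p.qs + 1) + K.Δt ^ (p.qt + 1)) ∧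
    ‖fderiv ℝ (K.φdti i) y - fderiv ℝ (fun y => K.φ y (K.node i)) y‖ ≤
      p.M * (K.h ^ p.qs + K.Δt ^ (p.qt + 1)) ∧
    ‖fderiv ℝ (fderiv ℝ (K.φdti i)) y - fderiv ℝ (fderiv ℝ (fun y => K.φ y (K.node i))) y‖ ≤
      p.M * (K.h ^ (p.qs - 1) + K.Δt ^ (p.qt + 1)) := by
  have hn := K.node_mem hK.time_lt i
  have hf : ContDiffOn ℝ 2 (K.φdti i) (interior K.Ubar) :=
    contDiffOn_φdti_interior hK.semiDiscrete i
  have hg : ContDiffOn ℝ 2 (fun y => K.φ y (K.node i)) (interior K.Ubar) :=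
    contDiffOn_φ_interior hK.levelSet hn
  have hu : ContDiffOn ℝ (2 : ℕ) (fun y => K.φdti i y - K.φ y (K.node i)) (interior K.Ubar) :=
    hf.sub hg
  have hO : IsOpen (interior K.Ubar) := isOpen_interior
  have hb : ∀ m ≤ 2, ‖iteratedFDeriv ℝ m (fun y => K.φdti i y - K.φ y (K.node i)) y‖ ≤
      p.M * (K.h ^ (p.qs + 1 - m) + K.Δt ^ (p.qt + 1)) := by
    intro m hm
    refine norm_le_of_interior_elements (continuousOn_iteratedFDeriv_of_isOpen hO hu hm)
      (fun T hT z hz => ?_) y hy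
    have := hK.semiDiscrete.accurate m (by have := p.one_le_qs; omega) T hT z hz _ hn
    simpa only [φdt_node hK.time_lt] using this
  have hsub : ∀ z ∈ interior K.Ubar, fderiv ℝ (fun y => K.φdti i y - K.φ y (K.node i)) z =
      fderiv ℝ (K.φdti i) z - fderiv ℝ (fun y => K.φ y (K.node i)) z := fun z hz =>
    fderiv_fun_sub (hf.hasFDerivAt_of_isOpen hO hz).differentiableAt
      (hg.hasFDerivAt_of_isOpen hO hz).differentiableAt
  refine ⟨by simpa using hb 0 (by omega), ?_, ?_⟩
  · have := hb 1 (by omega)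
    rw [norm_iteratedFDeriv_one, hsub y hy] at this
    simpa using this
  · have := hb 2 le_rfl
    rw [← norm_fderiv_fderiv] at this
    have e : fderiv ℝ (fun y => K.φdti i y - K.φ y (K.node i)) =ᶠ[𝓝 y]
        fun z => fderiv ℝ (K.φdti i) z - fderiv ℝ (fun y => K.φ y (K.node i)) z := by
      filter_upwards [hO.mem_nhds hy] with z hz using hsub z hz
    rw [e.fderiv_eq, fderiv_fun_sub (hf.hasFDerivAt_fderiv_of_isOpen hO hy).differentiableAt
      (hg.hasFDerivAt_fderiv_of_isOpen hO hy).differentiableAt] at this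
    rwa [show p.qs + 1 - 2 = p.qs - 1 by omega] at this

theorem contDiffOn_φdti_sub_ext (hK : K.Admissible bl) (S : Simplex p.d) (i : Fin (p.qt + 1)) :
    ContDiffOn ℝ (p.qs + 1 : ℕ) (fun y => K.φdti i y - K.ext S i y) (interior K.Ubar) :=
  (hK.semiDiscrete.contDiff i).sub (contDiff_eval (K.poly S i)).contDiffOn

/-- Accuracy of the polynomial `φ_{h,i}` on a closed element. -/
theorem norm_iteratedFDeriv_φdti_sub_ext_le (hK : K.Admissible bl) {S : Simplex p.d}
    (hS : S ∈ K.meshU)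
    (i : Fin (p.qt + 1)) {m : ℕ} (hm : m ≤ p.qs + 1) {y : E p.d} (hy : y ∈ hull S)
    (hyO : y ∈ interior K.Ubar) :
    ‖iteratedFDeriv ℝ m (fun y => K.φdti i y - K.ext S i y) y‖ ≤
      p.M * K.h ^ (p.qs + 1 - m) := by
  refine norm_le_at_hull (continuousOn_iteratedFDeriv_of_isOpen isOpen_interior
    (hK.contDiffOn_φdti_sub_ext S i) hm) hS (fun z hz => ?_) hy hyO
  have e : (fun y => K.φdti i y - K.φhi i y) =ᶠ[𝓝 z] fun y => K.φdti i y - K.ext S i y := by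
    filter_upwards [isOpen_interior.mem_nhds hz] with w hw
    rw [hK.discrete.eq_poly S hS.1 i w (interior_subset hw)]
  rw [← e.iteratedFDeriv ℝ m |>.eq_of_nhds]
  exact hK.semiDiscrete.accurate_h m hm i S hS z hz

/-- The top derivative is the same for all elements because that of the polynomial vanishes, so it
may be bounded using an element that contains y instead of `T`. This is what allows leaving `T`. -/
theorem norm_iteratedFDeriv_top_le (hK : K.Admissible bl) {T : Simplex p.d} (hT : T ∈ K.mesh)
    (i : Fin (p.qt + 1))
    {y : E p.d} (hy : y ∈ interior K.Ubar) :
    ‖iteratedFDeriv ℝ (p.qs + 1) (fun y => K.φdti i y - K.ext T i y) y‖ ≤ p.M := by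
  have hsub : ∀ S ∈ K.mesh, ∀ z ∈ interior K.Ubar,
      iteratedFDeriv ℝ (p.qs + 1) (fun y => K.φdti i y - K.ext S i y) z =
        iteratedFDeriv ℝ (p.qs + 1) (K.φdti i) z := by
    intro S hS z hz
    have h1 : ContDiffAt ℝ (p.qs + 1 : ℕ) (K.φdti i) z :=
      (hK.semiDiscrete.contDiff i).contDiffAt (isOpen_interior.mem_nhds hz)
    have h2 : ContDiffAt ℝ (p.qs + 1 : ℕ) (K.ext S i) z := (contDiff_eval (K.poly S i)).contDiffAt
    have h3 : iteratedFDeriv ℝ (p.qs + 1) (K.ext S i) z = 0 :=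
      iteratedFDeriv_eval_eq_zero (hK.discrete.degree S hS i) z
    have h4 := iteratedFDeriv_sub_apply h1 h2
    rw [h3, sub_zero] at h4
    exact h4
  have := interior_subset hy
  simp only [Ubar, mem_iUnion] at this
  obtain ⟨S, hS, hyS⟩ := this
  rw [hsub T hT y hy, ← hsub S hS.1 y hy]
  simpa using hK.norm_iteratedFDeriv_φdti_sub_ext_le hS i le_rfl hyS hy

/-- Accuracy of the polynomial extension in a ball of radius proportional to `h`. -/
theorem φdti_sub_ext_bounds (hK : K.Admissible bl) {T : Simplex p.d} (hT : T ∈ K.meshU)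
    (i : Fin (p.qt + 1)) {x : E p.d}
    (hx : x ∈ hull T) {R : ℝ} (hR : 0 ≤ R) (hball : closedBall x (R * K.h) ⊆ interior K.Ubar)
    {y : E p.d} (hy : y ∈ closedBall x (R * K.h)) :
    |K.φdti i y - K.ext T i y| ≤ p.M * (1 + R) ^ (p.qs + 1) * K.h ^ (p.qs + 1) ∧
    ‖fderiv ℝ (K.φdti i) y - fderiv ℝ (K.ext T i) y‖ ≤ p.M * (1 + R) ^ p.qs * K.h ^ p.qs := by
  have hh := hK.h_pos.le
  have hxO := hball (mem_closedBall_self (x := x) (by positivity))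
  have key := fun k (hk : k ≤ p.qs + 1) => norm_iteratedFDeriv_le_of_center isOpen_interior
    (hK.contDiffOn_φdti_sub_ext T i) hR hh hball
    (fun y hy => hK.norm_iteratedFDeriv_top_le hT.1 i (hball hy))
    (fun m hm => hK.norm_iteratedFDeriv_φdti_sub_ext_le hT i hm hx hxO) hk y hy
  constructor
  · have := key (p.qs + 1) le_rfl
    rw [Nat.sub_self] at this
    simpa using this
  · have := key p.qs (Nat.le_succ _)
    rw [Nat.add_sub_cancel_left, norm_iteratedFDeriv_one, fderiv_fun_sub] at this
    · exact this
    · exact ((contDiffOn_φdti_interior hK.semiDiscrete i).hasFDerivAt_of_isOpen isOpen_interior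
        (hball hy)).differentiableAt
    · exact (hasFDerivAt_eval _ _).differentiableAt

end Admissible

end Config

/-- The filter only sees the mesh size, which belongs to the configuration. Hence a property that
holds on fine meshes holds at all active points of the same configuration at once. -/
theorem eventually_all {p : Params} {P : Loc p → Prop} (h : ∀ᶠ a in small p, P a) :
    ∀ᶠ a in small p, ∀ b : Loc p, b.K = a.K → P b := by
  rw [small, eventually_comap] at h ⊢
  filter_upwards [h] with r hr a ha b hb
  exact hr b (by rw [hb]; exact ha)

/-- Both choices of the discrete search direction are close to the polynomial gradient. -/
theorem exists_norm_Ghi_sub_le (p : Params) : ∃ C, 0 ≤ C ∧ ∀ᶠ a in small p, ∀ i sd,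
    ‖a.K.Ghi a.bl a.T i sd a.x - gradient (a.K.ext a.T i) a.x‖ ≤ C * a.K.h ^ p.qs := by
  obtain ⟨ρ, hρ, hball⟩ := exists_ball_subset p
  refine ⟨(Finset.piAntidiag (Finset.univ : Finset (Fin (p.d + 1))) p.qs).card *
    ((p.qs : ℝ) ^ p.qs * (2 * |p.M|)), by positivity, ?_⟩
  filter_upwards [eventually_all hball] with a ha i sd
  have hh := a.adm.h_pos
  cases sd with
  | gradient =>
    simp only [Config.Ghi, sub_self, norm_zero]
    positivity
  | averaged =>
    have hfin : (a.K.active a.bl).Finite :=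
      a.adm.triangulation.finite.subset Config.Admissible.active_subset_mesh
    -- Gradients from different elements at a shared node are compared through the single-valued
    -- gradient of φ_{Δt,i}; the node is itself an active point, so the regular region contains it.
    have hnode : ∀ S ∈ a.K.active a.bl, ∀ y ∈ hull S,
        ‖gradient (a.K.φdti i) y - gradient (a.K.ext S i) y‖ ≤ |p.M| * a.K.h ^ p.qs := by
      intro S hS y hy
      have hyO : y ∈ interior a.K.Ubar :=
        ha ⟨a.K, a.bl, S, y, a.adm, hS, hy⟩ rfl (mem_ball_self hρ)
      have h1 := a.adm.norm_iteratedFDeriv_φdti_sub_ext_le (a.adm.active_subset hS) i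
        (show 1 ≤ p.qs + 1 by omega) hy hyO
      rw [norm_iteratedFDeriv_one, fderiv_fun_sub] at h1
      · rw [norm_gradient_sub]
        refine h1.trans (mul_le_mul_of_nonneg_right (le_abs_self _) (by positivity))
      · exact ((Config.contDiffOn_φdti_interior a.adm.semiDiscrete i).hasFDerivAt_of_isOpen
          isOpen_interior hyO).differentiableAt
      · exact (hasFDerivAt_eval _ _).differentiableAt
    have := a.K.norm_oswald_sub_gradient_le hfin a.active i
      (a.adm.discrete.degree a.T a.mesh i) (ε := 2 * |p.M| * a.K.h ^ p.qs)
      (fun β hβ S hS hn => by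
        have h1 := hnode S hS _ hn
        have h2 := hnode a.T a.active _ (Config.lagNode_mem a.T hβ)
        rw [norm_sub_rev] at h1
        have h3 := norm_sub_le_norm_sub_add_norm_sub (gradient (a.K.ext S i)
          (Config.lagNode a.T β)) (gradient (a.K.φdti i) (Config.lagNode a.T β))
          (gradient (a.K.ext a.T i) (Config.lagNode a.T β))
        linarith) a.mem
    refine this.trans (le_of_eq ?_)
    ring

end SpaceTimeMapping

namespace SpaceTimeMapping

open Filter Topology

/-! ### Existence, uniqueness and size of the step lengths -/

/-- The facts about the root problem `f (x + α V) = g`, `x + α V ∈ D`. -/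
structure RootFacts {d : ℕ} (c B : ℝ) (x V : E d) (f : E d → ℝ) (D : Set (E d)) (g : ℝ) :
    Prop where
  existsUnique : ∃! a, IsLeastAbs {α | x + α • V ∈ D ∧ f (x + α • V) = g} a
  eq : f (x + leastAbs {α | x + α • V ∈ D ∧ f (x + α • V) = g} • V) = g
  abs_le : |leastAbs {α | x + α • V ∈ D ∧ f (x + α • V) = g}| ≤ B
  low : ∀ α α' : ℝ, |α| ≤ B → |α'| ≤ B → c * |α - α'| ≤ |f (x + α • V) - f (x + α' • V)|
  slope_le : ∀ α : ℝ, |α| ≤ B → c ≤ fderiv ℝ f (x + α • V) V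

/-- The lower bound for the slope of the level set functions along the search directions. -/
noncomputable def slope (p : Params) : ℝ := p.cφ ^ 2 / 2

theorem slope_pos (p : Params) : 0 < slope p := by
  have := p.cφ_pos
  unfold slope
  positivity

/-- ℓ V differs from ‖G₀‖² ≥ c² by at most Cδ + δ(C + 1), which is at most c²/2 by the choice of δ.
-/
theorem slope_le_apply {d : ℕ} {ℓ₀ ℓ : E d →L[ℝ] ℝ} {G₀ V : E d} {c C δ : ℝ}
    (hG : ℓ₀ G₀ = ‖G₀‖ ^ 2) (hc : c ≤ ‖G₀‖) (hc0 : 0 < c) (hC : ‖ℓ₀‖ ≤ C) (hGC : ‖G₀‖ ≤ C)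
    (hδ1 : δ ≤ 1) (hδ : δ * (2 * C + 1) ≤ c ^ 2 / 2) (hℓ : ‖ℓ - ℓ₀‖ ≤ δ) (hV : ‖V - G₀‖ ≤ δ) :
    c ^ 2 / 2 ≤ ℓ V := by
  have hδ0 : 0 ≤ δ := (norm_nonneg _).trans hV
  have hC0 : 0 ≤ C := (norm_nonneg _).trans hC
  have e : ℓ V = ℓ₀ G₀ + ℓ₀ (V - G₀) + (ℓ - ℓ₀) V := by
    simp only [map_sub, sub_apply]
    ring
  have h1 : |ℓ₀ (V - G₀)| ≤ C * δ := (ℓ₀.le_opNorm _).trans (by gcongr)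
  have hVn : ‖V‖ ≤ C + 1 := by
    have := norm_le_norm_sub_add V G₀
    linarith
  have h2 : |(ℓ - ℓ₀) V| ≤ δ * (C + 1) := ((ℓ - ℓ₀).le_opNorm _).trans (by gcongr)
  have h3 : c ^ 2 ≤ ‖G₀‖ ^ 2 := pow_le_pow_left₀ hc0.le hc 2
  rw [e, hG]
  have := (abs_le.1 h1).1
  have := (abs_le.1 h2).1
  nlinarith

theorem fderiv_apply_G {p : Params} (K : Config p) (x : E p.d) (t : ℝ) :
    fderiv ℝ (fun y => K.φ y t) x (K.G x t) = ‖K.G x t‖ ^ 2 := by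
  rw [← toDual_gradient, InnerProductSpace.toDual_apply_apply]
  exact real_inner_self_eq_norm_sq _

/-- Root problems for functions close to `φ` along directions close to `∇φ`. -/
theorem eventually_rootFacts (p : Params) {A C : ℝ} (hA : 0 ≤ A) (hC : 0 ≤ C) :
    ∀ᶠ a in small p, ∀ t ∈ a.K.I, ∀ (f : E p.d → ℝ) (V : E p.d) (g : ℝ) (D : Set (E p.d)),
      (∀ y ∈ closedBall a.x (A * (|p.Cφ| + 1) * a.K.h), HasFDerivAt f (fderiv ℝ f y) y ∧
        ‖fderiv ℝ f y - fderiv ℝ (fun y => a.K.φ y t) a.x‖ ≤ C * a.K.h ∧ y ∈ D) →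
      ‖V - a.K.G a.x t‖ ≤ C * a.K.h → |g - f a.x| ≤ slope p * (A * a.K.h) →
      ‖V‖ ≤ |p.Cφ| + 1 ∧ RootFacts (slope p) (A * a.K.h) a.x V f D g := by
  have hc := p.cφ_pos
  filter_upwards [eventually_h_le p (show 0 < 1 / (C + 1) by positivity),
    eventually_h_le p (show 0 < p.cφ ^ 2 / 2 / ((C + 1) * (2 * |p.Cφ| + 1)) by positivity)]
    with a h1 h2 t ht f V g D hf hV hg
  have hh := a.adm.h_pos
  have hδ1 : C * a.K.h ≤ 1 := by
    rw [le_div_iff₀ (by positivity)] at h1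
    nlinarith
  have hδ2 : C * a.K.h * (2 * |p.Cφ| + 1) ≤ p.cφ ^ 2 / 2 := by
    rw [le_div_iff₀ (by positivity)] at h2
    have : 0 ≤ a.K.h * (2 * |p.Cφ| + 1) := by positivity
    nlinarith
  have hx := a.mem_U ht
  have hφ := a.adm.levelSet
  have hG : ‖a.K.G a.x t‖ ≤ |p.Cφ| := (hφ.grad_upper t ht _ hx).trans (le_abs_self _)
  have hVn : ‖V‖ ≤ |p.Cφ| + 1 := by
    have := norm_le_norm_sub_add V (a.K.G a.x t)
    linarith
  have hin : ∀ α : ℝ, |α| ≤ A * a.K.h →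
      a.x + α • V ∈ closedBall a.x (A * (|p.Cφ| + 1) * a.K.h) := by
    intro α hα
    rw [mem_closedBall, dist_eq_norm, add_sub_cancel_left, norm_smul, Real.norm_eq_abs]
    calc |α| * ‖V‖ ≤ A * a.K.h * (|p.Cφ| + 1) := by gcongr
      _ = _ := by ring
  have hAh : 0 ≤ A * a.K.h := by positivity
  have hslope : ∀ α : ℝ, |α| ≤ A * a.K.h → slope p ≤ fderiv ℝ f (a.x + α • V) V := fun α hα =>
    slope_le_apply (fderiv_apply_G a.K a.x t) (hφ.grad_lower t ht _ hx) hc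
      ((Config.norm_fderiv_slice_le hφ ht hx).trans (le_abs_self _)) hG hδ1 hδ2
      (hf _ (hin α hα)).2.1 hV
  obtain ⟨r1, r2, r3, r4⟩ := root_of_directional_lower_bound (f := f) (f' := fderiv ℝ f)
    (x := a.x) (V := V) (D := D) (g := g) (slope_pos p) hAh
    (fun α hα => (hf _ (hin α hα)).2.2) (fun α hα => (hf _ (hin α hα)).1)
    hslope hg
  refine ⟨hVn, r1, r2, ?_, r4, hslope⟩
  exact le_of_mul_le_mul_left (r3.trans hg) (slope_pos p)

/-! ### The three root problems in a common form -/

namespace Config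

variable {p : Params} (K : Config p)

/-- The right-hand side in the definition of `d(x,t)`. -/
noncomputable def rhs (x : E p.d) (t : ℝ) : ℝ :=
  (1 - K.b x t) * K.φlin x t + K.b x t * K.φ x t

/-- The right-hand side in the definition of `d_{Δt,i}(x)`. -/
noncomputable def rhsdti (i : Fin (p.qt + 1)) (x : E p.d) : ℝ :=
  (1 - K.b x (K.node i)) * K.φlini i x + K.b x (K.node i) * K.φdti i x

/-- The right-hand side in the definition of `d_{h,i}(x)`. -/
noncomputable def rhshi (i : Fin (p.qt + 1)) (x : E p.d) : ℝ :=
  (1 - K.b x (K.node i)) * K.φlini i x + K.b x (K.node i) * K.φhi i x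

/-- `d(x,t)` -/
noncomputable def stepLen (x : E p.d) (t : ℝ) : ℝ := leastAbs (K.roots x t)

/-- `d_{Δt,i}(x)` -/
noncomputable def stepLenDti (i : Fin (p.qt + 1)) (x : E p.d) : ℝ := leastAbs (K.rootsdti i x)

theorem rootshi_eq (bl : Blending) (sd : SearchDir) (T : Simplex p.d) (i : Fin (p.qt + 1))
    (x : E p.d) : K.rootshi bl sd T i x = {α | x + α • K.Ghi bl T i sd x ∈ univ ∧
      K.ext T i (x + α • K.Ghi bl T i sd x) = K.rhshi i x} := by
  ext α
  simp [rootshi, rhshi]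

end Config

theorem pow_le_self_of_le_one {h : ℝ} (h0 : 0 ≤ h) (h1 : h ≤ 1) {n : ℕ} (hn : 1 ≤ n) :
    h ^ n ≤ h := by
  simpa using pow_le_pow_of_le_one h0 h1 hn

theorem norm_fderiv_sub_le_of_ball {p : Params} {K : Config p} (hφ : K.LevelSet) {t : ℝ}
    (ht : t ∈ K.I) {B : Set (E p.d)} (hB : Convex ℝ B) (hBO : B ⊆ interior K.Ubar) {x y : E p.d}
    (hx : x ∈ B) (hy : y ∈ B) :
    ‖fderiv ℝ (fun y => K.φ y t) y - fderiv ℝ (fun y => K.φ y t) x‖ ≤ p.M * ‖y - x‖ :=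
  hB.norm_image_sub_le_of_norm_fderiv_le (𝕜 := ℝ)
    (fun _ hz => ((Config.contDiffOn_φ_interior hφ ht).hasFDerivAt_fderiv_of_isOpen
      isOpen_interior (hBO hz)).differentiableAt)
    (fun z hz => by
      rw [norm_fderiv_fderiv]
      exact hφ.D2_bound t ht z (Config.interior_Ubar_subset_U ht (hBO hz))) hx hy

/-- The constants and facts about the three root problems. -/
structure Facts {p : Params} (A ρ CG : ℝ) (a : Loc p) : Prop where
  h_le : a.K.h ≤ 1
  Δt_le : a.K.Δt ≤ 1
  Δt_pow_le : a.K.Δt ^ (p.qt + 1) ≤ |p.CΔ| * a.K.h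
  ball : ball a.x ρ ⊆ interior a.K.Ubar
  -- The factor 2 leaves room for iterates up to twice the window, and the summand 1 for the
  -- vertices of the element, at distance at most h.
  radius : (2 * A + 1) * (|p.Cφ| + 1) * a.K.h < ρ
  ideal : ∀ t ∈ a.K.I, RootFacts (slope p) (A * a.K.h) a.x (a.K.G a.x t) (fun y => a.K.φ y t)
    a.K.bg (a.K.rhs a.x t)
  semi : ∀ i, ‖a.K.Gdti i a.x‖ ≤ |p.Cφ| + 1 ∧ RootFacts (slope p) (A * a.K.h) a.x
    (a.K.Gdti i a.x) (a.K.φdti i) a.K.bg (a.K.rhsdti i a.x)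
  discrete : ∀ i sd, ‖a.K.Ghi a.bl a.T i sd a.x‖ ≤ |p.Cφ| + 1 ∧ RootFacts (slope p) (A * a.K.h)
    a.x (a.K.Ghi a.bl a.T i sd a.x) (a.K.ext a.T i) univ (a.K.rhshi i a.x)
  Ghi_close : ∀ i sd, ‖a.K.Ghi a.bl a.T i sd a.x - gradient (a.K.ext a.T i) a.x‖ ≤
    CG * a.K.h ^ p.qs

/-- All three problems are perturbations of size O(h) of φ along ∇φ at the same point, so one window
constant `A` and one slope serve them all. -/
theorem exists_facts (p : Params) :
    ∃ A ρ CG, 0 ≤ A ∧ 0 < ρ ∧ 0 ≤ CG ∧ ∀ᶠ a in small p, Facts A ρ CG a := by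
  obtain ⟨ρ, hρ, hball⟩ := exists_ball_subset p
  obtain ⟨CG, hCG, hGhi⟩ := exists_norm_Ghi_sub_le p
  set D : ℝ := |p.M| * (1 + |p.CΔ|) with hD
  have hD0 : 0 ≤ D := by positivity
  -- slope · A h must dominate |g − f(x)|: (|Cφ| + D) h for φ^lin against φ, and another D h for
  -- replacing φ by φ_{Δt,i} or φ_{h,i}.
  set A : ℝ := (|p.Cφ| + D + D) / slope p with hA
  have hsl := slope_pos p
  have hA0 : 0 ≤ A := by positivity
  set R : ℝ := A * (|p.Cφ| + 1) with hR
  have hR0 : 0 ≤ R := by positivity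
  -- Sum of the derivative deviations divided by h: moving within radius R h, replacing φ by
  -- φ_{Δt,i}, replacing that by the polynomial extension, and averaging the search direction.
  set C : ℝ := |p.M| * R + D + |p.M| * (1 + R) ^ p.qs + CG with hC
  have hC0 : 0 ≤ C := by positivity
  refine ⟨A, ρ, CG, hA0, hρ, hCG, ?_⟩
  filter_upwards [hball, hGhi, eventually_rootFacts p hA0 hC0, eventually_h_le p one_pos,
    eventually_Δt_le p one_pos,
    eventually_h_le p (show 0 < ρ / (2 * ((2 * A + 1) * (|p.Cφ| + 1))) by positivity)]
    with a hball hGhi hroot h1 hΔ1 hhρ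
  have hh := a.adm.h_pos
  have hΔ := a.adm.Δt_pos
  have htri := a.adm.triangulation
  have hφ := a.adm.levelSet
  have hdis := a.adm.discrete
  have hΔp := a.adm.Δt_pow_le h1
  have hRρ' : (2 * A + 1) * (|p.Cφ| + 1) * a.K.h < ρ := by
    rw [le_div_iff₀ (by positivity)] at hhρ
    have : 0 < (2 * A + 1) * (|p.Cφ| + 1) * a.K.h := by positivity
    linarith
  have hRρ : R * a.K.h < ρ := by
    refine lt_of_le_of_lt ?_ hRρ'
    rw [hR]
    gcongr
    linarith
  have hxO : a.x ∈ interior a.K.Ubar := hball (mem_ball_self hρ)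
  have hcb : closedBall a.x (R * a.K.h) ⊆ interior a.K.Ubar :=
    (closedBall_subset_ball hRρ).trans hball
  have hxc : a.x ∈ closedBall a.x (R * a.K.h) := mem_closedBall_self (by positivity)
  have hq := p.one_le_qs
  have hpow : a.K.h ^ p.qs ≤ a.K.h := pow_le_self_of_le_one hh.le h1 hq
  have hpow' : a.K.h ^ (p.qs + 1) ≤ a.K.h := pow_le_self_of_le_one hh.le h1 (by omega)
  have hDh : ∀ e : ℝ, e ≤ a.K.h → 0 ≤ e →
      p.M * (e + a.K.Δt ^ (p.qt + 1)) ≤ D * a.K.h := by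
    intro e he he0
    calc p.M * (e + a.K.Δt ^ (p.qt + 1)) ≤ |p.M| * (a.K.h + |p.CΔ| * a.K.h) :=
          mul_le_mul (le_abs_self _) (add_le_add he hΔp) (by positivity) (abs_nonneg _)
      _ = D * a.K.h := by rw [hD]; ring
  have hAh : slope p * (A * a.K.h) = (|p.Cφ| + D + D) * a.K.h := by
    rw [hA]; field_simp
  have hIb : ∀ t ∈ a.K.I, a.x ∈ a.K.bg := fun t ht => (a.mem_U ht).1
  have hlin : ∀ t ∈ a.K.I, |a.K.φlin a.x t - a.K.φ a.x t| ≤ (|p.Cφ| + D) * a.K.h := by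
    intro t ht
    have e1 := Config.abs_φlin_sub_φ_le htri hφ hdis a.meshU ht a.mem
    have e2 := hDh _ hpow' (by positivity)
    have e3 := mul_le_mul_of_nonneg_right (le_abs_self p.Cφ) hh.le
    linarith
  -- The blend differs from its second argument by (1 − b) times the difference of both, so blending
  -- never increases the offset.
  have hconv : ∀ t ∈ a.K.I, ∀ u v w : ℝ, u = (1 - a.K.b a.x t) * v + a.K.b a.x t * w →
      |u - w| ≤ |v - w| := by
    intro t ht u v w hu
    have hb := a.adm.b_mem (hIb t ht) ht
    have e : u - w = (1 - a.K.b a.x t) * (v - w) := by rw [hu]; ring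
    rw [e, abs_mul, abs_of_nonneg (by linarith [hb.2])]
    exact mul_le_of_le_one_left (abs_nonneg _) (by linarith [hb.1])
  have hder : ∀ t ∈ a.K.I, ∀ y ∈ closedBall a.x (R * a.K.h),
      ‖fderiv ℝ (fun y => a.K.φ y t) y - fderiv ℝ (fun y => a.K.φ y t) a.x‖ ≤
        |p.M| * R * a.K.h := by
    intro t ht y hy
    have e1 := norm_fderiv_sub_le_of_ball hφ ht (convex_closedBall _ _) hcb hxc hy
    rw [mem_closedBall, dist_eq_norm] at hy
    calc _ ≤ p.M * ‖y - a.x‖ := e1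
      _ ≤ |p.M| * (R * a.K.h) :=
        mul_le_mul (le_abs_self _) hy (norm_nonneg _) (abs_nonneg _)
      _ = _ := by ring
  have hbg : ∀ t ∈ a.K.I, ∀ y ∈ closedBall a.x (R * a.K.h), y ∈ a.K.bg := fun t ht y hy =>
    (Config.interior_Ubar_subset_U ht (hcb hy)).1
  have hsemi : ∀ i, ∀ y ∈ closedBall a.x (R * a.K.h),
      ‖fderiv ℝ (a.K.φdti i) y - fderiv ℝ (fun y => a.K.φ y (a.K.node i)) y‖ ≤ D * a.K.h :=
    fun i y hy => (a.adm.φdti_sub_φ_bounds i (hcb hy)).2.1.trans (hDh _ hpow (by positivity))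
  have hext : ∀ i, ∀ y ∈ closedBall a.x (R * a.K.h),
      ‖fderiv ℝ (a.K.φdti i) y - fderiv ℝ (a.K.ext a.T i) y‖ ≤
        |p.M| * (1 + R) ^ p.qs * a.K.h := by
    intro i y hy
    refine (a.adm.φdti_sub_ext_bounds a.meshU i a.mem hR0 hcb hy).2.trans ?_
    gcongr
    exact le_abs_self _
  refine ⟨h1, hΔ1, hΔp, hball, hRρ', fun t ht => ?_, fun i => ?_, fun i sd => ?_,
    hGhi⟩
  · refine (hroot t ht (fun y => a.K.φ y t) (a.K.G a.x t) (a.K.rhs a.x t) a.K.bg ?_ ?_ ?_).2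
    · intro y hy
      refine ⟨(Config.contDiffOn_φ_interior hφ ht).hasFDerivAt_of_isOpen isOpen_interior (hcb hy),
        ?_, hbg t ht y hy⟩
      refine (hder t ht y hy).trans (mul_le_mul_of_nonneg_right ?_ hh.le)
      rw [hC]
      have : 0 ≤ |p.M| * (1 + R) ^ p.qs := by positivity
      linarith
    · rw [sub_self, norm_zero]
      positivity
    · rw [hAh]
      refine (hconv t ht _ _ _ rfl).trans ((hlin t ht).trans ?_)
      gcongr
      linarith
  · have ht := a.K.node_mem a.adm.time_lt i
    refine hroot _ ht (a.K.φdti i) (a.K.Gdti i a.x) (a.K.rhsdti i a.x) a.K.bg ?_ ?_ ?_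
    · intro y hy
      refine ⟨(Config.contDiffOn_φdti_interior a.adm.semiDiscrete i).hasFDerivAt_of_isOpen
        isOpen_interior (hcb hy), ?_, hbg _ ht y hy⟩
      have e1 := hsemi i y hy
      have e2 := hder _ ht y hy
      refine (norm_sub_le_norm_sub_add_norm_sub _ (fderiv ℝ (fun y => a.K.φ y (a.K.node i)) y)
        _).trans ((add_le_add e1 e2).trans ?_)
      rw [← add_mul]
      refine mul_le_mul_of_nonneg_right ?_ hh.le
      rw [hC]
      have : 0 ≤ |p.M| * (1 + R) ^ p.qs := by positivity
      linarith
    · rw [Config.Gdti, Config.G, norm_gradient_sub]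
      refine (hsemi i a.x hxc).trans (mul_le_mul_of_nonneg_right ?_ hh.le)
      rw [hC]
      have : 0 ≤ |p.M| * (1 + R) ^ p.qs + |p.M| * R := by positivity
      linarith
    · rw [hAh]
      refine (hconv _ ht _ _ _ rfl).trans ?_
      have e1 := hlin _ ht
      rw [Config.φlin_node a.adm.time_lt] at e1
      have e2 := (a.adm.φdti_sub_φ_bounds i hxO).1.trans (hDh _ hpow' (by positivity))
      rw [abs_sub_comm] at e2
      have e3 := abs_sub_le (a.K.φlini i a.x) (a.K.φ a.x (a.K.node i)) (a.K.φdti i a.x)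
      linarith
  · have ht := a.K.node_mem a.adm.time_lt i
    have hGd : ‖a.K.Ghi a.bl a.T i sd a.x - a.K.G a.x (a.K.node i)‖ ≤ C * a.K.h := by
      have e1 := (hGhi i sd).trans (mul_le_mul_of_nonneg_left hpow hCG)
      have e2 := hext i a.x hxc
      have e3 := hsemi i a.x hxc
      rw [← norm_gradient_sub, norm_sub_rev] at e2
      rw [← norm_gradient_sub] at e3
      have e4 := norm_sub_le_norm_sub_add_norm_sub (a.K.Ghi a.bl a.T i sd a.x)
        (gradient (a.K.ext a.T i) a.x) (a.K.G a.x (a.K.node i))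
      have e5 := norm_sub_le_norm_sub_add_norm_sub (gradient (a.K.ext a.T i) a.x)
        (gradient (a.K.φdti i) a.x) (a.K.G a.x (a.K.node i))
      have e6 : 0 ≤ |p.M| * R * a.K.h := by positivity
      rw [Config.G] at e5 e4 ⊢
      rw [hC]
      linarith
    refine hroot _ ht (a.K.ext a.T i) (a.K.Ghi a.bl a.T i sd a.x) (a.K.rhshi i a.x) univ ?_ hGd ?_
    · intro y hy
      refine ⟨(hasFDerivAt_eval _ _).differentiableAt.hasFDerivAt, ?_, mem_univ _⟩
      have e1 := hsemi i y hy
      have e2 := hder _ ht y hy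
      have e3 := hext i y hy
      rw [norm_sub_rev] at e3
      have e4 := norm_sub_le_norm_sub_add_norm_sub (fderiv ℝ (a.K.ext a.T i) y)
        (fderiv ℝ (a.K.φdti i) y) (fderiv ℝ (fun y => a.K.φ y (a.K.node i)) a.x)
      have e5 := norm_sub_le_norm_sub_add_norm_sub (fderiv ℝ (a.K.φdti i) y)
        (fderiv ℝ (fun y => a.K.φ y (a.K.node i)) y)
        (fderiv ℝ (fun y => a.K.φ y (a.K.node i)) a.x)
      have e6 : 0 ≤ CG * a.K.h := by positivity
      rw [hC]
      linarith
    · rw [hAh, ← hdis.eq_poly a.T a.mesh i a.x a.mem]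
      refine (hconv _ ht _ _ _ rfl).trans ?_
      have e1 := hlin _ ht
      rw [Config.φlin_node a.adm.time_lt] at e1
      have e2 := (Config.abs_φ_sub_φh_le hφ hdis a.meshU ht a.mem).trans
        (hDh _ hpow' (by positivity))
      rw [Config.φh_node a.adm.time_lt] at e2
      have e3 := abs_sub_le (a.K.φlini i a.x) (a.K.φ a.x (a.K.node i)) (a.K.φhi i a.x)
      linarith

end SpaceTimeMapping

namespace SpaceTimeMapping

open Filter Topology

/-! ### Comparison of the mappings at the time nodes -/

namespace Config

variable {p : Params} (K : Config p)

/-- The order of the errors of the mappings. -/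
noncomputable def tol (n : ℕ) : ℝ := K.h ^ n + K.Δt ^ (p.qt + 1)

variable {K}

theorem Admissible.contDiffOn_b {bl : Blending} (hK : K.Admissible bl) :
    ContDiffOn ℝ p.l (Function.uncurry K.b) (K.bg ×ˢ K.I) ∧
      ∀ m ≤ p.l, ∀ z ∈ K.bg ×ˢ K.I,
        ‖iteratedFDerivWithin ℝ m (Function.uncurry K.b) (K.bg ×ˢ K.I) z‖ ≤ |p.Cb| := by
  have hb := hK.blending
  cases bl with
  | finiteElement =>
    simp only [IsBlending] at hb
    have : Function.uncurry K.b = 0 := by ext z; exact hb z.1 z.2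
    rw [this]
    refine ⟨contDiffOn_const, fun m _ z _ => ?_⟩
    rw [show (0 : E p.d × ℝ → ℝ) = fun _ => 0 from rfl, iteratedFDerivWithin_fun_zero]
    simp
  | smooth => exact ⟨hb.2.2.2.1, fun m hm z hz => (hb.2.2.2.2 m hm z hz).trans (le_abs_self _)⟩

end Config

namespace Facts

variable {p : Params} {A ρ CG : ℝ} {a : Loc p}

theorem tol_nonneg (a : Loc p) (n : ℕ) : 0 ≤ a.K.tol n :=
  add_nonneg (pow_nonneg a.adm.h_pos.le _) (pow_nonneg a.adm.Δt_pos.le _)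

theorem A_nonneg (hF : Facts A ρ CG a) : 0 ≤ A := by
  have h1 := (abs_nonneg _).trans (hF.semi 0).2.abs_le
  exact nonneg_of_mul_nonneg_left h1 a.adm.h_pos

theorem radius_lt (hF : Facts A ρ CG a) : A * (|p.Cφ| + 1) * a.K.h < ρ := by
  refine lt_of_le_of_lt ?_ hF.radius
  have := hF.A_nonneg
  have := a.adm.h_pos
  gcongr
  linarith

theorem abs_stepLen_le (hF : Facts A ρ CG a) {t : ℝ} (ht : t ∈ a.K.I) :
    |a.K.stepLen a.x t| ≤ A * a.K.h := (hF.ideal t ht).abs_le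

theorem abs_stepLenDti_le (hF : Facts A ρ CG a) (i : Fin (p.qt + 1)) :
    |a.K.stepLenDti i a.x| ≤ A * a.K.h := (hF.semi i).2.abs_le

theorem mem_closedBall_of_le {α : ℝ} {V : E p.d} (hα : |α| ≤ A * a.K.h)
    (hV : ‖V‖ ≤ |p.Cφ| + 1) :
    a.x + α • V ∈ closedBall a.x (A * (|p.Cφ| + 1) * a.K.h) := by
  rw [mem_closedBall, dist_eq_norm, add_sub_cancel_left, norm_smul, Real.norm_eq_abs]
  calc |α| * ‖V‖ ≤ A * a.K.h * (|p.Cφ| + 1) :=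
        mul_le_mul hα hV (norm_nonneg _) ((abs_nonneg _).trans hα)
    _ = _ := by ring

theorem mem_ball_of_le (hF : Facts A ρ CG a) {α : ℝ} {V : E p.d} (hα : |α| ≤ A * a.K.h)
    (hV : ‖V‖ ≤ |p.Cφ| + 1) : a.x + α • V ∈ Metric.ball a.x ρ :=
  closedBall_subset_ball hF.radius_lt (Facts.mem_closedBall_of_le hα hV)

theorem norm_G_le {t : ℝ} (ht : t ∈ a.K.I) : ‖a.K.G a.x t‖ ≤ |p.Cφ| + 1 := by
  have := a.adm.levelSet.grad_upper t ht a.x (a.mem_U ht)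
  linarith [le_abs_self p.Cφ]

theorem closedBall_subset (hF : Facts A ρ CG a) :
    closedBall a.x (A * (|p.Cφ| + 1) * a.K.h) ⊆ interior a.K.Ubar :=
  (closedBall_subset_ball hF.radius_lt).trans hF.ball

end Facts

/-- Comparison of the step lengths and of the mappings at the time nodes. -/
theorem exists_nodal_comparison (p : Params) {A ρ CG : ℝ} (hA : 0 ≤ A) (hρ : 0 < ρ)
    (hCG : 0 ≤ CG) : ∃ C, 0 ≤ C ∧ ∀ a : Loc p, Facts A ρ CG a → ∀ i,
      |a.K.stepLen a.x (a.K.node i) - a.K.stepLenDti i a.x| ≤ C * a.K.tol (p.qs + 1) ∧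
      ‖a.K.Ψ a.x (a.K.node i) - a.K.Ψdti i a.x‖ ≤ C * a.K.tol (p.qs + 1) ∧
      ∀ sd, ‖a.K.Ψdti i a.x - a.K.Ψhi a.bl sd a.T i a.x‖ ≤ C * a.K.h ^ (p.qs + 1) := by
  set R : ℝ := A * (|p.Cφ| + 1) with hR
  have hR0 : 0 ≤ R := by positivity
  have hs := slope_pos p
  set L : ℝ := |p.Cφ| + |p.M| * (1 + |p.CΔ|) with hL
  have hL0 : 0 ≤ L := by positivity
  set C₁ : ℝ := (2 * |p.M| + |p.Cφ| * (A * |p.M|)) / slope p with hC₁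
  have hC₁0 : 0 ≤ C₁ := by positivity
  set D : ℝ := |p.M| * (1 + R) ^ (p.qs + 1) with hD
  have hD0 : 0 ≤ D := by positivity
  set D' : ℝ := CG + |p.M| * (1 + R) ^ p.qs with hD'
  have hD'0 : 0 ≤ D' := by positivity
  set C₂ : ℝ := (2 * D + L * (A * D')) / slope p with hC₂
  have hC₂0 : 0 ≤ C₂ := by positivity
  set C : ℝ := C₁ + (C₁ * (|p.Cφ| + 1) + A * |p.M|) + (C₂ * (|p.Cφ| + 1) + A * D') with hC
  have hp1 : 0 ≤ C₁ * (|p.Cφ| + 1) + A * |p.M| := by positivity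
  have hp2 : 0 ≤ C₂ * (|p.Cφ| + 1) + A * D' := by positivity
  refine ⟨C, by positivity, fun a hF i => ?_⟩
  have hh := a.adm.h_pos
  have hΔ := a.adm.Δt_pos
  have h1 := hF.h_le
  have ht := a.K.node_mem a.adm.time_lt i
  have hφ := a.adm.levelSet
  have hcb := hF.closedBall_subset
  have hxO : a.x ∈ interior a.K.Ubar := hF.ball (mem_ball_self hρ)
  have hbx : a.x ∈ a.K.bg := (a.mem_U ht).1
  have hb := a.adm.b_mem hbx ht
  set η := a.K.tol (p.qs + 1) with hη
  have hη0 : 0 ≤ η := Facts.tol_nonneg a _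
  -- The search directions agree only to order h^(q_s) + Δt^(q_t+1); the step length contributes the
  -- missing factor h.
  have hhη : a.K.h * (a.K.h ^ p.qs + a.K.Δt ^ (p.qt + 1)) ≤ η := by
    have : a.K.h * a.K.Δt ^ (p.qt + 1) ≤ a.K.Δt ^ (p.qt + 1) :=
      mul_le_of_le_one_left (by positivity) h1
    have e : a.K.h * a.K.h ^ p.qs = a.K.h ^ (p.qs + 1) := by ring
    rw [hη, Config.tol, mul_add, e]
    linarith
  obtain ⟨hVd, hsemi⟩ := hF.semi i
  have hideal := hF.ideal _ ht
  have hVG : ‖a.K.Gdti i a.x - a.K.G a.x (a.K.node i)‖ ≤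
      |p.M| * (a.K.h ^ p.qs + a.K.Δt ^ (p.qt + 1)) := by
    rw [Config.Gdti, Config.G, norm_gradient_sub]
    exact (a.adm.φdti_sub_φ_bounds i hxO).2.1.trans
      (mul_le_mul_of_nonneg_right (le_abs_self _) (by positivity))
  have hsub : ∀ y ∈ interior a.K.Ubar, |a.K.φ y (a.K.node i) - a.K.φdti i y| ≤ |p.M| * η := by
    intro y hy
    rw [abs_sub_comm]
    exact (a.adm.φdti_sub_φ_bounds i hy).1.trans
      (mul_le_mul_of_nonneg_right (le_abs_self _) hη0)
  have hdn := hsemi.abs_le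
  have hin2 := Facts.mem_closedBall_of_le hdn hVd
  have hin1 := Facts.mem_closedBall_of_le hdn (Facts.norm_G_le ht)
  have cmp1 := root_comparison (f₁ := fun y => a.K.φ y (a.K.node i)) (f₂ := a.K.φdti i)
    (a := |p.M| * η) (b := A * |p.M| * η) (L := |p.Cφ|) hs
    (hideal.low _ _ hideal.abs_le hdn) hideal.eq hsemi.eq ?_ (hsub _ (hcb hin2)) ?_ ?_
    (abs_nonneg _)
  rotate_left
  -- At a node both right-hand sides contain the same φ^lin, although this is only a first order
  -- approximation; just the difference of the level set functions, weighted by b, survives.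
  · have e : a.K.rhs a.x (a.K.node i) - a.K.rhsdti i a.x =
        a.K.b a.x (a.K.node i) * (a.K.φ a.x (a.K.node i) - a.K.φdti i a.x) := by
      rw [Config.rhs, Config.rhsdti, Config.φlin_node a.adm.time_lt]
      ring
    rw [e, abs_mul, abs_of_nonneg hb.1]
    exact (mul_le_of_le_one_left (abs_nonneg _) hb.2).trans (hsub _ hxO)
  · have e1 := Config.abs_φ_sub_le a.adm.triangulation hφ ht (convex_closedBall _ _)
      (hcb.trans (Config.interior_Ubar_subset_U ht)) hin2 hin1
    refine e1.trans ?_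
    rw [dist_eq_norm, add_sub_add_left_eq_sub, ← smul_sub, norm_smul, Real.norm_eq_abs]
    exact mul_le_mul_of_nonneg_right (le_abs_self _) (by positivity)
  · calc _ ≤ A * a.K.h * (|p.M| * (a.K.h ^ p.qs + a.K.Δt ^ (p.qt + 1))) :=
          mul_le_mul hdn hVG (norm_nonneg _) (by positivity)
      _ = A * |p.M| * (a.K.h * (a.K.h ^ p.qs + a.K.Δt ^ (p.qt + 1))) := by ring
      _ ≤ _ := by gcongr
  have hc1 : (2 * (|p.M| * η) + |p.Cφ| * (A * |p.M| * η)) / slope p = C₁ * η := by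
    rw [hC₁]; ring
  rw [hc1] at cmp1
  refine ⟨cmp1.1.trans ?_, cmp1.2.trans ?_, fun sd => ?_⟩
  · gcongr
    rw [hC]; linarith
  · calc C₁ * η * ‖a.K.G a.x (a.K.node i)‖ + A * |p.M| * η
        ≤ C₁ * η * (|p.Cφ| + 1) + A * |p.M| * η := by
          gcongr
          exact Facts.norm_G_le ht
      _ = (C₁ * (|p.Cφ| + 1) + A * |p.M|) * η := by ring
      _ ≤ C * η := by
          gcongr
          rw [hC]; linarith
  · obtain ⟨hVh, hdis⟩ := hF.discrete i sd
    have hhn := hdis.abs_le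
    have hin3 := Facts.mem_closedBall_of_le hhn hVh
    have hin4 := Facts.mem_closedBall_of_le hhn hVd
    have hext := fun y (hy : y ∈ closedBall a.x (R * a.K.h)) =>
      a.adm.φdti_sub_ext_bounds a.meshU i a.mem hR0 hcb hy
    have hxc : a.x ∈ closedBall a.x (R * a.K.h) := mem_closedBall_self (by positivity)
    -- The comparison evaluates the polynomial at its own root, in general outside the element, so
    -- the bound is needed on the whole ball. No Δt enters, as both functions belong to the same
    -- node.
    have hDe : ∀ y ∈ closedBall a.x (R * a.K.h),
        |a.K.φdti i y - a.K.ext a.T i y| ≤ D * a.K.h ^ (p.qs + 1) := fun y hy =>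
      (hext y hy).1.trans (by rw [hD]; gcongr; exact le_abs_self _)
    have hVV : ‖a.K.Ghi a.bl a.T i sd a.x - a.K.Gdti i a.x‖ ≤ D' * a.K.h ^ p.qs := by
      have e1 := hF.Ghi_close i sd
      have e2 := (hext a.x hxc).2
      rw [← norm_gradient_sub, norm_sub_rev] at e2
      have e3 := norm_sub_le_norm_sub_add_norm_sub (a.K.Ghi a.bl a.T i sd a.x)
        (gradient (a.K.ext a.T i) a.x) (gradient (a.K.φdti i) a.x)
      have e4 : p.M * (1 + R) ^ p.qs * a.K.h ^ p.qs ≤ |p.M| * (1 + R) ^ p.qs * a.K.h ^ p.qs := by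
        gcongr
        exact le_abs_self _
      rw [Config.Gdti, hD']
      linarith
    have hLip : ∀ y ∈ closedBall a.x (R * a.K.h), ∀ z ∈ closedBall a.x (R * a.K.h),
        |a.K.φdti i y - a.K.φdti i z| ≤ L * ‖y - z‖ := by
      intro y hy z hz
      refine (convex_closedBall a.x (R * a.K.h)).norm_image_sub_le_of_norm_fderiv_le (𝕜 := ℝ)
        (fun w hw => ((Config.contDiffOn_φdti_interior a.adm.semiDiscrete i).hasFDerivAt_of_isOpen
          isOpen_interior (hcb hw)).differentiableAt) (fun w hw => ?_) hz hy
      have e1 := (a.adm.φdti_sub_φ_bounds i (hcb hw)).2.1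
      have e2 := Config.norm_fderiv_slice_le hφ ht (Config.interior_Ubar_subset_U ht (hcb hw))
      have e3 := norm_le_norm_sub_add (fderiv ℝ (a.K.φdti i) w)
        (fderiv ℝ (fun y => a.K.φ y (a.K.node i)) w)
      have e4 : p.M * (a.K.h ^ p.qs + a.K.Δt ^ (p.qt + 1)) ≤ |p.M| * (1 + |p.CΔ|) := by
        refine mul_le_mul (le_abs_self _) ?_ (by positivity) (abs_nonneg _)
        have e5 : a.K.h ^ p.qs ≤ 1 := pow_le_one₀ hh.le h1
        have e6 : |p.CΔ| * a.K.h ≤ |p.CΔ| := mul_le_of_le_one_right (abs_nonneg _) h1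
        linarith [hF.Δt_pow_le]
      rw [hL]
      linarith [le_abs_self p.Cφ]
    have cmp2 := root_comparison (f₁ := a.K.φdti i) (f₂ := a.K.ext a.T i)
      (a := D * a.K.h ^ (p.qs + 1)) (b := A * D' * a.K.h ^ (p.qs + 1)) (L := L) hs
      (hsemi.low _ _ hsemi.abs_le hhn) hsemi.eq hdis.eq ?_ (hDe _ hin3) ?_ ?_ hL0
    rotate_left
    · have e : a.K.rhsdti i a.x - a.K.rhshi i a.x =
          a.K.b a.x (a.K.node i) * (a.K.φdti i a.x - a.K.ext a.T i a.x) := by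
        rw [Config.rhsdti, Config.rhshi, a.adm.discrete.eq_poly a.T a.mesh i a.x a.mem]
        ring
      rw [e, abs_mul, abs_of_nonneg hb.1]
      exact (mul_le_of_le_one_left (abs_nonneg _) hb.2).trans (hDe _ hxc)
    · refine (hLip _ hin3 _ hin4).trans (le_of_eq ?_)
      rw [add_sub_add_left_eq_sub, ← smul_sub, norm_smul, Real.norm_eq_abs]
    · calc _ ≤ A * a.K.h * (D' * a.K.h ^ p.qs) :=
            mul_le_mul hhn hVV (norm_nonneg _) (by positivity)
        _ = A * D' * a.K.h ^ (p.qs + 1) := by ring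
    have hc2 : (2 * (D * a.K.h ^ (p.qs + 1)) + L * (A * D' * a.K.h ^ (p.qs + 1))) / slope p =
        C₂ * a.K.h ^ (p.qs + 1) := by
      rw [hC₂]; ring
    rw [hc2] at cmp2
    rw [Config.Ψhi, Config.rootshi_eq]
    refine cmp2.2.trans ?_
    calc C₂ * a.K.h ^ (p.qs + 1) * ‖a.K.Gdti i a.x‖ + A * D' * a.K.h ^ (p.qs + 1)
        ≤ C₂ * a.K.h ^ (p.qs + 1) * (|p.Cφ| + 1) + A * D' * a.K.h ^ (p.qs + 1) := by
          gcongr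
      _ = (C₂ * (|p.Cφ| + 1) + A * D') * a.K.h ^ (p.qs + 1) := by ring
      _ ≤ C * a.K.h ^ (p.qs + 1) := by
          gcongr
          rw [hC]; linarith

end SpaceTimeMapping

namespace SpaceTimeMapping

open Filter Topology

/-! ### Roots, products and difference quotients of approximable families -/

namespace Appr

variable {ι : Type} {Δ η : ι → ℝ} {W : Type} [NormedAddCommGroup W] [NormedSpace ℝ W]

open Classical in
-- Serves to switch off the indices for which the iteration in `root` does not contract.
theorem ite_zero (hη : ∀ i, 0 ≤ η i) {f : ι → ℝ → W} (hf : Appr Δ η f) (P : ι → Prop) :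
    Appr Δ η (fun i s => if P i then f i s else 0) := by
  obtain ⟨κ, hκ, e, C, hC, hf⟩ := hf
  refine ⟨κ, hκ, e, C, hC, fun i => ?_⟩
  by_cases hP : P i
  · simpa only [hP, if_true] using hf i
  · refine ⟨0, fun a => by simpa using hC, fun s _ => ?_⟩
    simpa [hP] using mul_nonneg hC (hη i)

/-- Roots of a family of functions that are nearly affine with a constant slope. -/
theorem root (hS : Scale Δ η) {f : ι → ℝ → ℝ → ℝ} {r : ι → ℝ → ℝ} {c₀ R θ : ι → ℝ} {c K : ℝ}
    {N : ℕ} (hc : 0 < c) (hc₀ : ∀ i, c ≤ c₀ i) (hθ0 : ∀ i, 0 ≤ θ i)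
    (hr : ∀ i, ∀ s ∈ Icc 0 (Δ i), |r i s| ≤ R i)
    (hlin : ∀ i, ∀ s ∈ Icc 0 (Δ i), ∀ α, |α| ≤ 2 * R i →
      |f i s α - c₀ i * (α - r i s)| ≤ c₀ i * (θ i * |α - r i s|))
    (hf : ∀ α : ι → ℝ → ℝ, Appr Δ η α → (∀ i, ∀ s ∈ Icc 0 (Δ i), |α i s| ≤ 2 * R i) →
      Appr Δ η (fun i s => f i s (α i s)))
    (hθ : ∀ i, θ i ^ N * R i ≤ K * η i) : Appr Δ η r := by
  classical
  -- Chord iteration α ↦ α − f(α)/c₀ started at 0. Each step multiplies the error by θ, and while θ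
  -- ≤ 1 the iterates stay within 2R because the error stays within R. For θ > 1 the iterate is set
  -- to 0.
  have key : ∀ k : ℕ, ∃ α : ι → ℝ → ℝ, Appr Δ η α ∧ ∀ i, ∀ s ∈ Icc 0 (Δ i),
      (θ i ≤ 1 → |α i s - r i s| ≤ θ i ^ k * R i) ∧ (¬ θ i ≤ 1 → α i s = 0) := by
    intro k
    induction k with
    | zero =>
      refine ⟨fun _ _ => 0, const (C := 0) (by simp) hS.η_nonneg, fun i s hs => ⟨fun _ => ?_,
        fun _ => rfl⟩⟩
      simpa using hr i s hs
    | succ k ih =>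
      obtain ⟨α, hα, hαr⟩ := ih
      have hα2 : ∀ i, ∀ s ∈ Icc 0 (Δ i), |α i s| ≤ 2 * R i := by
        intro i s hs
        have h0 := hr i s hs
        have hR : 0 ≤ R i := (abs_nonneg _).trans h0
        by_cases h1 : θ i ≤ 1
        · have h2 := (hαr i s hs).1 h1
          have h3 : θ i ^ k * R i ≤ R i := mul_le_of_le_one_left hR (pow_le_one₀ (hθ0 i) h1)
          have h4 := abs_sub_abs_le_abs_sub (α i s) (r i s)
          linarith
        · rw [(hαr i s hs).2 h1, abs_zero]
          positivity
      have hinv : Appr Δ η (fun i (_ : ℝ) => (c₀ i)⁻¹) := const (C := c⁻¹) (fun i => by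
        rw [Real.norm_eq_abs, abs_of_pos (inv_pos.2 (hc.trans_le (hc₀ i)))]
        exact inv_anti₀ hc (hc₀ i)) hS.η_nonneg
      refine ⟨_, (hα.sub hS (hinv.mul hS (hf α hα hα2))).ite_zero hS.η_nonneg (fun i => θ i ≤ 1),
        fun i s hs => ⟨fun h1 => ?_, fun h1 => by simp [h1]⟩⟩
      have hci : 0 < c₀ i := hc.trans_le (hc₀ i)
      simp only [h1, if_true]
      have e : α i s - (c₀ i)⁻¹ * f i s (α i s) - r i s =
          -((c₀ i)⁻¹ * (f i s (α i s) - c₀ i * (α i s - r i s))) := by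
        field_simp
        ring
      rw [e, abs_neg, abs_mul, abs_of_pos (inv_pos.2 hci), inv_mul_le_iff₀ hci]
      refine (hlin i s hs _ (hα2 i s hs)).trans ?_
      rw [pow_succ, mul_comm (θ i ^ k), mul_assoc]
      have := (hαr i s hs).1 h1
      have := hθ0 i
      gcongr
  obtain ⟨α, hα, hαr⟩ := key N
  refine hα.of_near (C := K) hS.η_nonneg fun i s hs => le_trans ?_ (hθ i)
  rw [norm_sub_rev, Real.norm_eq_abs]
  -- Without contraction the bound is trivial: |r| ≤ R ≤ θ^N R.
  by_cases h1 : θ i ≤ 1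
  · exact (hαr i s hs).1 h1
  · rw [(hαr i s hs).2 h1, zero_sub, abs_neg]
    have h0 := hr i s hs
    exact h0.trans (le_mul_of_one_le_left ((abs_nonneg _).trans h0)
      (one_le_pow₀ (not_le.1 h1).le))

/-- A small factor compensates for a lower accuracy of the other factor. -/
theorem smul_of_small {η' : ι → ℝ} (hS : Scale Δ η) {f : ι → ℝ → ℝ} {g : ι → ℝ → W} {R : ι → ℝ}
    {K : ℝ} (hf : Appr Δ η f) (hR : ∀ i, ∀ s ∈ Icc 0 (Δ i), |f i s| ≤ R i)
    (hg : Appr Δ η' g) (hK : ∀ i, R i * η' i ≤ K * η i) :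
    Appr Δ η (fun i s => f i s • g i s) := by
  obtain ⟨κ, hκ, e, C, hC, hg⟩ := hg
  choose c hc hg using hg
  -- The approximating polynomials of `g` belong to the class for every tolerance. Replacing `g` by
  -- them costs R η', which is absorbed into η.
  have hq : Appr Δ η (fun i s => ∑ a, s ^ e a • c i a) :=
    ⟨κ, hκ, e, C, hC, fun i => ⟨c i, hc i, fun s _ => by
      simpa using mul_nonneg hC (hS.η_nonneg i)⟩⟩
  refine (hf.smul hS hq).of_near (C := C * K) hS.η_nonneg fun i s hs => ?_
  rw [← smul_sub, norm_smul, Real.norm_eq_abs]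
  calc |f i s| * ‖g i s - ∑ a, s ^ e a • c i a‖ ≤ R i * (C * η' i) :=
        mul_le_mul (hR i s hs) (hg i s hs) (norm_nonneg _) ((abs_nonneg _).trans (hR i s hs))
    _ = C * (R i * η' i) := by ring
    _ ≤ C * (K * η i) := mul_le_mul_of_nonneg_left (hK i) hC
    _ = C * K * η i := by ring

end Appr

/-- Difference quotients of a regular family. -/
theorem Reg.difference_quotient {ι : Type} {F : Type} [NormedAddCommGroup F] [NormedSpace ℝ F]
    {B B' : ι → Set F} {W : Type} [NormedAddCommGroup W] [NormedSpace ℝ W]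
    (hB : ∀ i, Convex ℝ (B i)) (hB' : ∀ i, Convex ℝ (B' i)) {ω : ι → F}
    (hBB : ∀ i, B' i ⊆ B i) (hω : ∀ i, ∀ z ∈ B' i, z + ω i ∈ B i) (n : ℕ) {g : ι → F → W}
    (hg : Reg B (n + 1) g) :
    Reg B' n (fun i z => ‖ω i‖⁻¹ • (g i (z + ω i) - g i z)) := by
  have hbd : ∀ {k : ℕ} {V : Type} [NormedAddCommGroup V] [NormedSpace ℝ V] {f : ι → F → V},
      Reg B k f → ∃ M, 0 ≤ M ∧ ∀ i, ∀ z ∈ B' i, ‖‖ω i‖⁻¹ • (f i (z + ω i) - f i z)‖ ≤ M := by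
    intro k V _ _ f hf
    obtain ⟨M, hM, h⟩ := hf.lipschitz hB
    refine ⟨M, hM, fun i z hz => ?_⟩
    have h1 := h i _ (hω i z hz) z (hBB i hz)
    rw [add_sub_cancel_left] at h1
    rw [norm_smul, norm_inv, norm_norm]
    rcases eq_or_ne ‖ω i‖ 0 with h0 | h0
    -- For ω = 0 the convention 0⁻¹ = 0 makes the quotient vanish, so no nondegeneracy is required.
    · simpa [h0] using hM
    · rw [inv_mul_le_iff₀ (lt_of_le_of_ne (norm_nonneg _) h0.symm)]
      linarith
  have hder : ∀ {V : Type} [NormedAddCommGroup V] [NormedSpace ℝ V] {f : ι → F → V}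
      {f' : ι → F → F →L[ℝ] V}, (∀ i, ∀ z ∈ B i, HasFDerivWithinAt (f i) (f' i z) (B i) z) →
      ∀ i, ∀ z ∈ B' i, HasFDerivWithinAt (fun z => ‖ω i‖⁻¹ • (f i (z + ω i) - f i z))
        (‖ω i‖⁻¹ • (f' i (z + ω i) - f' i z)) (B' i) z := by
    intro V _ _ f f' hf i z hz
    refine HasFDerivWithinAt.const_smul (HasFDerivWithinAt.sub ?_
      ((hf i z (hBB i hz)).mono (hBB i))) _
    have h1 : HasFDerivWithinAt (fun z : F => z + ω i) (ContinuousLinearMap.id ℝ F) (B' i) z :=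
      (hasFDerivWithinAt_id z _).add_const _
    have h2 := (hf i _ (hω i z hz)).comp z h1 (hω i)
    rwa [ContinuousLinearMap.comp_id] at h2
  induction n generalizing W with
  | zero =>
    obtain ⟨M, hM, hb⟩ := hbd hg
    obtain ⟨-, g', hd, hg'⟩ := hg
    obtain ⟨M', hM', hb'⟩ := hbd hg'
    refine ⟨M + M', by positivity, fun i z hz => ⟨(hb i z hz).trans (by linarith),
      fun z' hz' => ?_⟩⟩
    refine ((hB' i).norm_image_sub_le_of_norm_hasFDerivWithin_le (hder hd i) (hb' i) hz' hz).trans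
      ?_
    gcongr
    linarith
  | succ n ih =>
    obtain ⟨M, hM, hb⟩ := hbd hg
    obtain ⟨-, g', hd, hg'⟩ := hg
    exact ⟨⟨M, hb⟩, _, hder hd, ih hg'⟩

/-! ### Pairs of bounded families that are close to each other -/

/-- `f` and `f'` are bounded and differ by at most a multiple of `η`. -/
def Near {ι : Type} (η : ι → ℝ) {W : Type} [NormedAddCommGroup W] (f f' : ι → W) : Prop :=
  ∃ C, 0 ≤ C ∧ ∀ i, ‖f i‖ ≤ C ∧ ‖f' i‖ ≤ C ∧ ‖f i - f' i‖ ≤ C * η i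

namespace Near

variable {ι : Type} {η : ι → ℝ} {W : Type} [NormedAddCommGroup W]
  {W₁ : Type} [NormedAddCommGroup W₁] [NormedSpace ℝ W₁]
  {W₂ : Type} [NormedAddCommGroup W₂] [NormedSpace ℝ W₂]

theorem of_le {f f' : ι → W} {C₁ C₂ : ℝ} (hη : ∀ i, 0 ≤ η i) (hη' : ∀ i, η i ≤ 2)
    (h1 : ∀ i, ‖f i‖ ≤ C₁) (h2 : ∀ i, ‖f i - f' i‖ ≤ C₂ * η i) : Near η f f' := by
  refine ⟨|C₁| + 2 * |C₂|, by positivity, fun i => ?_⟩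
  have e1 := h1 i
  have e2 := h2 i
  have e3 := le_abs_self C₁
  have e4 : C₂ * η i ≤ |C₂| * η i := mul_le_mul_of_nonneg_right (le_abs_self _) (hη i)
  have e5 : |C₂| * η i ≤ |C₂| * 2 := mul_le_mul_of_nonneg_left (hη' i) (abs_nonneg _)
  have e6 := norm_le_insert (f i) (f' i)
  have e7 := mul_nonneg (abs_nonneg C₁) (hη i)
  have e8 := mul_nonneg (abs_nonneg C₂) (hη i)
  refine ⟨by linarith [abs_nonneg C₂], ?_, by linarith⟩
  linarith

theorem const (hη : ∀ i, 0 ≤ η i) (w : W) : Near η (fun _ => w) (fun _ => w) :=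
  ⟨‖w‖, norm_nonneg _, fun i => ⟨le_rfl, le_rfl, by
    simpa using mul_nonneg (norm_nonneg w) (hη i)⟩⟩

theorem bilin [NormedSpace ℝ W] (hη : ∀ i, 0 ≤ η i) (B : W →L[ℝ] W₁ →L[ℝ] W₂) {f f' : ι → W}
    {g g' : ι → W₁}
    (hf : Near η f f') (hg : Near η g g') :
    Near η (fun i => B (f i) (g i)) (fun i => B (f' i) (g' i)) := by
  obtain ⟨C, hC, hf⟩ := hf
  obtain ⟨D, hD, hg⟩ := hg
  have h0 : 0 ≤ ‖B‖ * C * D := by positivity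
  refine ⟨2 * (‖B‖ * C * D), by positivity, fun i => ?_⟩
  obtain ⟨f1, f2, f3⟩ := hf i
  obtain ⟨g1, g2, g3⟩ := hg i
  refine ⟨?_, ?_, ?_⟩
  · have : ‖B (f i) (g i)‖ ≤ ‖B‖ * C * D := (B.le_opNorm₂ _ _).trans (by gcongr)
    linarith
  · have : ‖B (f' i) (g' i)‖ ≤ ‖B‖ * C * D := (B.le_opNorm₂ _ _).trans (by gcongr)
    linarith
  · have e : B (f i) (g i) - B (f' i) (g' i) = B (f i - f' i) (g i) + B (f' i) (g i - g' i) := by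
      simp
    have e1 : ‖B (f i - f' i) (g i)‖ ≤ ‖B‖ * (C * η i) * D :=
      (B.le_opNorm₂ _ _).trans (by have := hη i; gcongr)
    have e2 : ‖B (f' i) (g i - g' i)‖ ≤ ‖B‖ * C * (D * η i) :=
      (B.le_opNorm₂ _ _).trans (by gcongr)
    rw [e]
    refine (norm_add_le _ _).trans ((add_le_add e1 e2).trans (le_of_eq (by ring)))

theorem add {f f' g g' : ι → W} (hf : Near η f f') (hg : Near η g g') :
    Near η (fun i => f i + g i) (fun i => f' i + g' i) := by
  obtain ⟨C, hC, hf⟩ := hf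
  obtain ⟨D, hD, hg⟩ := hg
  refine ⟨C + D, by positivity, fun i => ?_⟩
  obtain ⟨f1, f2, f3⟩ := hf i
  obtain ⟨g1, g2, g3⟩ := hg i
  refine ⟨norm_add_le_of_le f1 g1, norm_add_le_of_le f2 g2, ?_⟩
  rw [add_sub_add_comm, add_mul]
  exact norm_add_le_of_le f3 g3

theorem sub {f f' g g' : ι → W} (hf : Near η f f') (hg : Near η g g') :
    Near η (fun i => f i - g i) (fun i => f' i - g' i) := by
  obtain ⟨C, hC, hf⟩ := hf
  obtain ⟨D, hD, hg⟩ := hg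
  refine ⟨C + D, by positivity, fun i => ?_⟩
  obtain ⟨f1, f2, f3⟩ := hf i
  obtain ⟨g1, g2, g3⟩ := hg i
  refine ⟨norm_sub_le_of_le f1 g1, norm_sub_le_of_le f2 g2, ?_⟩
  rw [sub_sub_sub_comm, add_mul]
  exact norm_sub_le_of_le f3 g3

theorem inv (hη : ∀ i, 0 ≤ η i) {c : ℝ} (hc : 0 < c) {u u' : ι → ℝ} (h : Near η u u')
    (hu : ∀ i, c ≤ u i)
    (hu' : ∀ i, c ≤ u' i) : Near η (fun i => (u i)⁻¹) (fun i => (u' i)⁻¹) := by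
  obtain ⟨C, hC, h⟩ := h
  have hb : ∀ v : ℝ, c ≤ v → ‖v⁻¹‖ ≤ c⁻¹ := fun v hv => by
    rw [Real.norm_eq_abs, abs_of_pos (inv_pos.2 (hc.trans_le hv))]
    exact inv_anti₀ hc hv
  have h0 : 0 ≤ c⁻¹ * C * c⁻¹ := by positivity
  have h1 : 0 ≤ c⁻¹ := by positivity
  refine ⟨c⁻¹ + c⁻¹ * C * c⁻¹, by positivity, fun i => ⟨(hb _ (hu i)).trans (by linarith),
    (hb _ (hu' i)).trans (by linarith), ?_⟩⟩
  have e : (u i)⁻¹ - (u' i)⁻¹ = -((u i)⁻¹ * (u i - u' i) * (u' i)⁻¹) := by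
    have := hc.trans_le (hu i)
    have := hc.trans_le (hu' i)
    field_simp
    ring
  have hi := (h i).2.2
  have hηi := hη i
  rw [e, norm_neg, norm_mul, norm_mul]
  calc ‖(u i)⁻¹‖ * ‖u i - u' i‖ * ‖(u' i)⁻¹‖ ≤ c⁻¹ * (C * η i) * c⁻¹ := by
        gcongr
        · exact hb _ (hu i)
        · exact hb _ (hu' i)
    _ ≤ (c⁻¹ + c⁻¹ * C * c⁻¹) * η i := by
        nlinarith [mul_nonneg h1 hηi]

end Near

end SpaceTimeMapping

namespace SpaceTimeMapping

open Filter Topology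

/-! ### Approximation of the ideal mapping by polynomials in time -/

/-- The Riesz isomorphism that turns derivatives into gradients. -/
noncomputable def riesz (d : ℕ) : (E d →L[ℝ] ℝ) →L[ℝ] E d :=
  LinearMap.mkContinuous
    { toFun := fun ℓ => (InnerProductSpace.toDual ℝ (E d)).symm ℓ
      map_add' := fun ℓ ℓ' => map_add _ ℓ ℓ'
      map_smul' := fun c ℓ => by simp } 1
    (fun ℓ => by simp)

theorem riesz_fderiv {d : ℕ} (f : E d → ℝ) (x : E d) : riesz d (fderiv ℝ f x) = gradient f x := rfl

/-- At the end points of the time interval the space-time derivative exists only within the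
cylinder; a spatial slice is open, so there it becomes a full derivative. -/
theorem hasFDerivAt_slice {d : ℕ} {W : Type*} [NormedAddCommGroup W] [NormedSpace ℝ W]
    {O : Set (E d)} {I : Set ℝ} (hO : IsOpen O) {g : E d × ℝ → W} {g' : E d × ℝ →L[ℝ] W} {y : E d}
    {t : ℝ} (hy : y ∈ O) (ht : t ∈ I) (h : HasFDerivWithinAt g g' (O ×ˢ I) (y, t)) :
    HasFDerivAt (fun y => g (y, t)) (g'.comp (ContinuousLinearMap.inl ℝ (E d) ℝ)) y := by
  have h1 : HasFDerivAt (fun y : E d => (y, t)) (ContinuousLinearMap.inl ℝ (E d) ℝ) y :=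
    hasFDerivAt_prodMk_left y t
  have h2 : MapsTo (fun y : E d => (y, t)) O (O ×ˢ I) := fun y hy => ⟨hy, ht⟩
  exact (HasFDerivWithinAt.comp y h h1.hasFDerivWithinAt h2).hasFDerivAt (hO.mem_nhds hy)

/-- Points of active elements of fine meshes. -/
abbrev Fine (p : Params) (A ρ CG : ℝ) : Type := {a : Loc p // Facts A ρ CG a}

namespace Fine

variable {p : Params} {A ρ CG : ℝ}

/-- A space-time cylinder around a point. -/
def cyl (i : Fine p A ρ CG) : Set (E p.d × ℝ) := ball i.1.x ρ ×ˢ i.1.K.I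

theorem convex_cyl (i : Fine p A ρ CG) : Convex ℝ i.cyl :=
  (convex_ball _ _).prod (convex_Icc _ _)

theorem radius_pos (i : Fine p A ρ CG) : 0 < ρ := by
  refine lt_of_le_of_lt ?_ i.2.radius
  have := i.2.A_nonneg
  have := i.1.adm.h_pos
  positivity

theorem A_nonneg (i : Fine p A ρ CG) : 0 ≤ A := i.2.A_nonneg

theorem h_pos (i : Fine p A ρ CG) : 0 < i.1.K.h := i.1.adm.h_pos

theorem Δt_pos (i : Fine p A ρ CG) : 0 < i.1.K.Δt := i.1.adm.Δt_pos

theorem time_mem (i : Fine p A ρ CG) {s : ℝ} (hs : s ∈ Icc 0 i.1.K.Δt) : i.1.K.t₀ + s ∈ i.1.K.I :=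
  ⟨by linarith [hs.1], by
    have := hs.2
    rw [Config.Δt] at this
    linarith⟩

theorem t₀_mem (i : Fine p A ρ CG) : i.1.K.t₀ ∈ i.1.K.I := ⟨le_rfl, i.1.adm.time_lt.le⟩

theorem mem_cyl (i : Fine p A ρ CG) : (i.1.x, i.1.K.t₀) ∈ i.cyl :=
  ⟨mem_ball_self i.radius_pos, i.t₀_mem⟩

theorem ball_subset_bg (i : Fine p A ρ CG) : ball i.1.x ρ ⊆ i.1.K.bg := fun _ hy =>
  (Config.interior_Ubar_subset_U i.t₀_mem (i.2.ball hy)).1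

theorem tol_nonneg (i : Fine p A ρ CG) (n : ℕ) : 0 ≤ i.1.K.tol n := Facts.tol_nonneg i.1 n

/-- Families of functions of time that are uniformly approximable by polynomials up to the
tolerance `h ^ n + Δt ^ (q_t + 1)`. -/
abbrev TimeAppr (n : ℕ) {W : Type} [NormedAddCommGroup W] [NormedSpace ℝ W]
    (f : Fine p A ρ CG → ℝ → W) : Prop :=
  Appr (fun i : Fine p A ρ CG => i.1.K.Δt) (fun i => i.1.K.tol n) f

theorem scale (p : Params) (A ρ CG : ℝ) (n : ℕ) :
    Scale (fun i : Fine p A ρ CG => i.1.K.Δt) (fun i => i.1.K.tol n) where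
  Δ_nonneg i := i.Δt_pos.le
  Δ_le i := i.2.Δt_le
  η_nonneg i := i.tol_nonneg n
  η_le i := by
    have h1 : i.1.K.h ^ n ≤ 1 := pow_le_one₀ i.h_pos.le i.2.h_le
    have h2 : i.1.K.Δt ^ (p.qt + 1) ≤ 1 := pow_le_one₀ i.Δt_pos.le i.2.Δt_le
    rw [Config.tol]
    linarith

/-- Taylor remainders and contraction factors mix h and Δt. By (h + Δt)^k ≤ 2^k (h^k + Δt^k) they
fit into the tolerance once k exceeds both orders, which explains the regularity `le_l`. -/
theorem add_pow_le_tol (i : Fine p A ρ CG) {k : ℕ} (hk : max p.qs p.qt + 1 ≤ k) :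
    (i.1.K.h + i.1.K.Δt) ^ k ≤ 2 ^ k * i.1.K.tol (p.qs + 1) := by
  have hh := i.h_pos.le
  have hΔ := i.Δt_pos.le
  have h1 : i.1.K.h ^ k ≤ i.1.K.h ^ (p.qs + 1) :=
    pow_le_pow_of_le_one hh i.2.h_le ((by omega : p.qs + 1 ≤ max p.qs p.qt + 1).trans hk)
  have h2 : i.1.K.Δt ^ k ≤ i.1.K.Δt ^ (p.qt + 1) :=
    pow_le_pow_of_le_one hΔ i.2.Δt_le ((by omega : p.qt + 1 ≤ max p.qs p.qt + 1).trans hk)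
  calc (i.1.K.h + i.1.K.Δt) ^ k ≤ (2 * max i.1.K.h i.1.K.Δt) ^ k := by
        gcongr
        rw [two_mul]
        exact add_le_add (le_max_left _ _) (le_max_right _ _)
    _ = 2 ^ k * max i.1.K.h i.1.K.Δt ^ k := mul_pow _ _ _
    _ ≤ 2 ^ k * (i.1.K.h ^ k + i.1.K.Δt ^ k) := by
        gcongr
        rcases le_total i.1.K.h i.1.K.Δt with h | h
        · rw [max_eq_right h]
          exact le_add_of_nonneg_left (by positivity)
        · rw [max_eq_left h]
          exact le_add_of_nonneg_right (by positivity)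
    _ ≤ _ := by
        rw [Config.tol]
        gcongr

/-! ### Uniform regularity of the data on space-time cylinders -/

theorem reg_φ (p : Params) (A ρ CG : ℝ) :
    Reg (fun i : Fine p A ρ CG => i.cyl) (p.l - 1) (fun i => Function.uncurry i.1.K.φ) := by
  have hsub : ∀ i : Fine p A ρ CG, i.cyl ⊆ interior i.1.K.Ubar ×ˢ i.1.K.I := fun i =>
    prod_mono i.2.ball subset_rfl
  refine Reg.of_bounds (S := fun i : Fine p A ρ CG => interior i.1.K.Ubar ×ˢ i.1.K.I)
    (fun i => isOpen_interior.uniqueDiffOn.prod (uniqueDiffOn_Icc i.1.adm.time_lt)) hsub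
    (abs_nonneg p.M) _ (fun i => i.1.adm.levelSet.regular.1) (fun i m hm z hz => ?_)
    (fun i z hz z' hz' => ?_)
  · exact (i.1.adm.levelSet.regular.2.1 m hm z (hsub i hz)).trans (le_abs_self _)
  · exact (i.1.adm.levelSet.regular.2.2 _ (hsub i) i.convex_cyl z hz z' hz').trans
      (mul_le_mul_of_nonneg_right (le_abs_self _) (norm_nonneg _))

theorem reg_b (p : Params) (A ρ CG : ℝ) :
    Reg (fun i : Fine p A ρ CG => i.cyl) (p.l - 1) (fun i => Function.uncurry i.1.K.b) := by
  have hsub : ∀ i : Fine p A ρ CG, i.cyl ⊆ i.1.K.bg ×ˢ i.1.K.I := fun i =>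
    prod_mono i.ball_subset_bg subset_rfl
  have hU : ∀ i : Fine p A ρ CG, UniqueDiffOn ℝ (i.1.K.bg ×ˢ i.1.K.I) := fun i =>
    i.1.adm.triangulation.isOpen.uniqueDiffOn.prod (uniqueDiffOn_Icc i.1.adm.time_lt)
  have hl : p.l - 1 + 1 = p.l := by have := p.le_l; omega
  refine Reg.of_bounds (S := fun i : Fine p A ρ CG => i.1.K.bg ×ˢ i.1.K.I) hU hsub
    (abs_nonneg p.Cb) _ (fun i => i.1.adm.contDiffOn_b.1.of_le (by norm_cast; omega))
    (fun i m hm z hz => i.1.adm.contDiffOn_b.2 m (by omega) z (hsub i hz))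
    (fun i z hz z' hz' => ?_)
  have hd := i.1.adm.contDiffOn_b.1.differentiableOn_iteratedFDerivWithin (m := p.l - 1)
    (by norm_cast; omega) (hU i)
  refine i.convex_cyl.norm_image_sub_le_of_norm_hasFDerivWithin_le
    (fun w hw => (hd w (hsub i hw)).hasFDerivWithinAt.mono (hsub i)) (fun w hw => ?_) hz' hz
  rw [norm_fderivWithin_iteratedFDerivWithin, hl]
  exact i.1.adm.contDiffOn_b.2 _ le_rfl _ (hsub i hw)

/-- Regularity of the space-time derivatives of `φ` that represent the spatial derivatives. -/
theorem exists_deriv_φ (p : Params) (A ρ CG : ℝ) :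
    ∃ m, max p.qs p.qt ≤ m + 1 ∧
      Reg (fun i : Fine p A ρ CG => i.cyl) (m + 2) (fun i => Function.uncurry i.1.K.φ) ∧
      Reg (fun i : Fine p A ρ CG => i.cyl) (m + 2) (fun i => Function.uncurry i.1.K.b) ∧
      ∃ (g₁ : Fine p A ρ CG → E p.d × ℝ → (E p.d × ℝ →L[ℝ] ℝ))
        (g₂ : Fine p A ρ CG → E p.d × ℝ → (E p.d × ℝ →L[ℝ] (E p.d × ℝ →L[ℝ] ℝ))),
        Reg (fun i : Fine p A ρ CG => i.cyl) (m + 1) g₁ ∧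
        Reg (fun i : Fine p A ρ CG => i.cyl) m g₂ ∧
        ∀ (i : Fine p A ρ CG), ∀ y ∈ ball i.1.x ρ, ∀ t ∈ i.1.K.I,
          HasFDerivAt (fun y => i.1.K.φ y t)
            ((g₁ i (y, t)).comp (ContinuousLinearMap.inl ℝ (E p.d) ℝ)) y ∧
          HasFDerivAt (fderiv ℝ (fun y => i.1.K.φ y t))
            (((ContinuousLinearMap.compL ℝ (E p.d) (E p.d × ℝ) ℝ).flip
              (ContinuousLinearMap.inl ℝ (E p.d) ℝ)).comp
              ((g₂ i (y, t)).comp (ContinuousLinearMap.inl ℝ (E p.d) ℝ))) y := by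
  have hl := p.le_l
  have hq := p.one_le_qs
  -- m = l − 3. The first derivative then has a Taylor remainder of order m + 2 ≥ max(q_s, q_t) + 1,
  -- while the second derivative is one order short.
  obtain ⟨m, hm⟩ : ∃ m, p.l - 1 = m + 2 := ⟨p.l - 3, by omega⟩
  have h0 := reg_φ p A ρ CG
  have hb := reg_b p A ρ CG
  rw [hm] at h0 hb
  refine ⟨m, by omega, h0, hb, ?_⟩
  obtain ⟨-, g₁, hd₁, h1⟩ := h0
  have h1' := h1
  obtain ⟨-, g₂, hd₂, h2⟩ := h1
  refine ⟨g₁, g₂, h1', h2, fun i y hy t ht => ?_⟩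
  have key : ∀ y ∈ ball i.1.x ρ, HasFDerivAt (fun y => i.1.K.φ y t)
      ((g₁ i (y, t)).comp (ContinuousLinearMap.inl ℝ (E p.d) ℝ)) y := fun y hy =>
    hasFDerivAt_slice isOpen_ball hy ht (hd₁ i (y, t) ⟨hy, ht⟩)
  refine ⟨key y hy, ?_⟩
  have h3 := hasFDerivAt_slice isOpen_ball hy ht (hd₂ i (y, t) ⟨hy, ht⟩)
  have h4 := ((ContinuousLinearMap.compL ℝ (E p.d) (E p.d × ℝ) ℝ).flip
    (ContinuousLinearMap.inl ℝ (E p.d) ℝ)).hasFDerivAt.comp y h3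
  refine h4.congr_of_eventuallyEq ?_
  filter_upwards [isOpen_ball.mem_nhds hy] with z hz
  rw [(key z hz).fderiv]
  rfl

theorem norm_fderiv_sub_le (p : Params) (A ρ CG : ℝ) : ∃ L, 0 ≤ L ∧ ∀ i : Fine p A ρ CG,
    ∀ y ∈ ball i.1.x ρ, ∀ t ∈ i.1.K.I,
      ‖fderiv ℝ (fun y => i.1.K.φ y t) y - fderiv ℝ (fun y => i.1.K.φ y i.1.K.t₀) i.1.x‖ ≤
        L * (‖y - i.1.x‖ + i.1.K.Δt) := by
  obtain ⟨m, -, -, -, g₁, g₂, h1, -, hd⟩ := exists_deriv_φ p A ρ CG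
  obtain ⟨L, hL, h⟩ := h1.lipschitz convex_cyl
  refine ⟨L, hL, fun i y hy t ht => ?_⟩
  rw [(hd i y hy t ht).1.fderiv, (hd i _ i.mem_cyl.1 _ i.t₀_mem).1.fderiv,
    ← ContinuousLinearMap.sub_comp]
  refine (ContinuousLinearMap.opNorm_comp_le _ _).trans ((mul_le_of_le_one_right (norm_nonneg _)
    (ContinuousLinearMap.norm_inl_le_one ℝ (E p.d) ℝ)).trans ?_)
  refine (h i (y, t) ⟨hy, ht⟩ _ i.mem_cyl).trans (mul_le_mul_of_nonneg_left ?_ hL)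
  rw [Prod.mk_sub_mk, Prod.norm_mk]
  refine max_le (le_add_of_nonneg_right i.Δt_pos.le) (le_add_of_nonneg_of_le (norm_nonneg _) ?_)
  rw [Real.norm_eq_abs, abs_of_nonneg (by linarith [ht.1]), Config.Δt]
  linarith [ht.2]

/-- Regular space-time functions along curves near a point. -/
theorem timeAppr_comp {n : ℕ} (hn : max p.qs p.qt ≤ n) {W : Type} [NormedAddCommGroup W]
    [NormedSpace ℝ W] {g : Fine p A ρ CG → E p.d × ℝ → W} (hg : Reg (fun i => i.cyl) n g)
    {w : Fine p A ρ CG → ℝ → E p.d} {C : ℝ} (hw : TimeAppr (p.qs + 1) w)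
    (hC : ∀ i, ∀ s ∈ Icc 0 i.1.K.Δt, ‖w i s‖ ≤ C * i.1.K.h)
    (hρ : ∀ i, ∀ s ∈ Icc 0 i.1.K.Δt, ‖w i s‖ < ρ) :
    TimeAppr (p.qs + 1) (fun i s => g i (i.1.x + w i s, i.1.K.t₀ + s)) := by
  have hS := scale p A ρ CG (p.qs + 1)
  have h1 := hg.appr_comp hS convex_cyl (z := fun i => (i.1.x, i.1.K.t₀)) mem_cyl
    (hw.prodMk hS (Appr.time hS.η_nonneg)) (K := (|C| + 1) ^ (n + 1) * 2 ^ (n + 1))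
    (fun i s hs => ⟨by simpa using hρ i s hs, i.time_mem hs⟩) (fun i s hs => ?_)
  · exact h1.congr fun i s _ => rfl
  · have hh := i.h_pos
    have hΔ := i.Δt_pos
    have e1 : ‖(w i s, s)‖ ≤ (|C| + 1) * (i.1.K.h + i.1.K.Δt) := by
      rw [Prod.norm_mk]
      refine max_le ?_ ?_
      · refine (hC i s hs).trans (mul_le_mul ((le_abs_self C).trans (by linarith)) (by linarith)
          hh.le (by positivity))
      · rw [Real.norm_eq_abs, abs_of_nonneg hs.1]
        have := hs.2
        have : 0 ≤ |C| * (i.1.K.h + i.1.K.Δt) := by positivity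
        linarith
    calc ‖(w i s, s)‖ ^ (n + 1) ≤ ((|C| + 1) * (i.1.K.h + i.1.K.Δt)) ^ (n + 1) := by gcongr
      _ = (|C| + 1) ^ (n + 1) * (i.1.K.h + i.1.K.Δt) ^ (n + 1) := mul_pow _ _ _
      _ ≤ (|C| + 1) ^ (n + 1) * (2 ^ (n + 1) * i.1.K.tol (p.qs + 1)) := by
          gcongr
          exact i.add_pow_le_tol (by omega)
      _ = _ := by ring

theorem timeAppr_comp_const {n : ℕ} (hn : max p.qs p.qt ≤ n) {W : Type} [NormedAddCommGroup W]
    [NormedSpace ℝ W] {g : Fine p A ρ CG → E p.d × ℝ → W} (hg : Reg (fun i => i.cyl) n g) :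
    TimeAppr (p.qs + 1) (fun i s => g i (i.1.x, i.1.K.t₀ + s)) := by
  have hS := scale p A ρ CG (p.qs + 1)
  refine (timeAppr_comp hn hg (w := fun _ _ => 0) (C := 0)
    (Appr.const (w := fun _ => (0 : E p.d)) (C := 0) (by simp) hS.η_nonneg) (by simp)
    (fun i _ _ => by simpa using i.radius_pos)).congr fun i s _ => by simp

theorem timeAppr_φ (p : Params) (A ρ CG : ℝ) :
    TimeAppr (p.qs + 1) (fun (i : Fine p A ρ CG) s => i.1.K.φ i.1.x (i.1.K.t₀ + s)) := by
  obtain ⟨m, hm, h0, -⟩ := exists_deriv_φ p A ρ CG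
  exact timeAppr_comp_const (by omega) h0

theorem timeAppr_b (p : Params) (A ρ CG : ℝ) :
    TimeAppr (p.qs + 1) (fun (i : Fine p A ρ CG) s => i.1.K.b i.1.x (i.1.K.t₀ + s)) := by
  obtain ⟨m, hm, -, hb, -⟩ := exists_deriv_φ p A ρ CG
  exact timeAppr_comp_const (by omega) hb

theorem timeAppr_fderiv (p : Params) (A ρ CG : ℝ) :
    TimeAppr (p.qs + 1) (fun (i : Fine p A ρ CG) s =>
      fderiv ℝ (fun y => i.1.K.φ y (i.1.K.t₀ + s)) i.1.x) := by
  obtain ⟨m, hm, -, -, g₁, g₂, h1, -, hd⟩ := exists_deriv_φ p A ρ CG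
  have hS := scale p A ρ CG (p.qs + 1)
  refine ((timeAppr_comp_const hm h1).clm hS
    ((ContinuousLinearMap.compL ℝ (E p.d) (E p.d × ℝ) ℝ).flip
      (ContinuousLinearMap.inl ℝ (E p.d) ℝ))).congr fun i s hs => ?_
  exact (hd i _ i.mem_cyl.1 _ (i.time_mem hs)).1.fderiv

theorem timeAppr_G (p : Params) (A ρ CG : ℝ) :
    TimeAppr (p.qs + 1) (fun (i : Fine p A ρ CG) s => i.1.K.G i.1.x (i.1.K.t₀ + s)) :=
  (timeAppr_fderiv p A ρ CG).clm (scale p A ρ CG _) (riesz p.d)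

theorem dist_vertex_le (i : Fine p A ρ CG) (j : Fin (p.d + 1)) : ‖i.1.T j - i.1.x‖ ≤ i.1.K.h := by
  rw [← dist_eq_norm]
  exact i.1.adm.triangulation.dist_le i.1.mesh (vertex_mem_hull _ _) i.1.mem

theorem h_lt (i : Fine p A ρ CG) : i.1.K.h < ρ := by
  refine lt_of_le_of_lt ?_ i.2.radius
  have h1 := i.A_nonneg
  have h2 := i.h_pos
  refine le_mul_of_one_le_left h2.le ?_
  nlinarith [abs_nonneg p.Cφ]

/-- On the element φ^lin is a convex combination, with weights independent of time, of the vertex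
values of φ_h. Replacing φ_h by φ costs only the tolerance, and φ at a fixed vertex is regular in
time. -/
theorem timeAppr_φlin (p : Params) (A ρ CG : ℝ) :
    TimeAppr (p.qs + 1) (fun (i : Fine p A ρ CG) s => i.1.K.φlin i.1.x (i.1.K.t₀ + s)) := by
  obtain ⟨m, hm, h0, -⟩ := exists_deriv_φ p A ρ CG
  have hS := scale p A ρ CG (p.qs + 1)
  have h1 : ∀ j, TimeAppr (p.qs + 1) (fun (i : Fine p A ρ CG) s =>
      i.1.K.φ (i.1.T j) (i.1.K.t₀ + s)) := fun j => by
    refine (timeAppr_comp (by omega) h0 (w := fun i _ => i.1.T j - i.1.x) (C := 1)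
      (Appr.const (C := 1) (fun i => (i.dist_vertex_le j).trans i.2.h_le) hS.η_nonneg)
      (fun i _ _ => by simpa using i.dist_vertex_le j)
      (fun i _ _ => (i.dist_vertex_le j).trans_lt i.h_lt)).congr fun i s _ => ?_
    simp
  have h2 : ∀ j, TimeAppr (p.qs + 1) (fun (i : Fine p A ρ CG) _ => i.1.T.coord j i.1.x) := fun j =>
    Appr.const (C := 1) (fun i => by
      have := (mem_hull_iff i.1.T i.1.x).1 i.1.mem j
      rw [Real.norm_eq_abs, abs_of_nonneg this]
      exact coord_le_one i.1.mem j) hS.η_nonneg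
  have h3 := Appr.sum hS Finset.univ fun j _ => (h2 j).mul hS (h1 j)
  refine h3.of_near (C := |p.M|) hS.η_nonneg fun i s hs => ?_
  have ht := i.time_mem hs
  rw [i.1.adm.triangulation.φlin_eq i.1.mesh _ i.1.mem, linInterp, ← Finset.sum_sub_distrib]
  have h4 : ∀ j ∈ Finset.univ, ‖i.1.T.coord j i.1.x * i.1.K.φh (i.1.T j) (i.1.K.t₀ + s) -
      i.1.T.coord j i.1.x * i.1.K.φ (i.1.T j) (i.1.K.t₀ + s)‖ ≤
      i.1.T.coord j i.1.x * (|p.M| * i.1.K.tol (p.qs + 1)) := by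
    intro j _
    have := (mem_hull_iff i.1.T i.1.x).1 i.1.mem j
    rw [← mul_sub, norm_mul, Real.norm_eq_abs, abs_of_nonneg this, norm_sub_rev]
    refine mul_le_mul_of_nonneg_left ?_ this
    exact (Config.abs_φ_sub_φh_le i.1.adm.levelSet i.1.adm.discrete i.1.meshU ht
      (vertex_mem_hull _ _)).trans
      (mul_le_mul_of_nonneg_right (le_abs_self _) (i.tol_nonneg _))
  refine (norm_sum_le_of_le _ h4).trans (le_of_eq ?_)
  rw [← Finset.sum_mul, sum_coord, one_mul]

theorem timeAppr_rhs (p : Params) (A ρ CG : ℝ) :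
    TimeAppr (p.qs + 1) (fun (i : Fine p A ρ CG) s => i.1.K.rhs i.1.x (i.1.K.t₀ + s)) := by
  have hS := scale p A ρ CG (p.qs + 1)
  have hb := timeAppr_b p A ρ CG
  have h1 : TimeAppr (p.qs + 1) (fun (_ : Fine p A ρ CG) _ => (1 : ℝ)) :=
    Appr.const (C := 1) (by simp) hS.η_nonneg
  exact (((h1.sub hS hb).mul hS (timeAppr_φlin p A ρ CG)).add
    (hb.mul hS (timeAppr_φ p A ρ CG)))

theorem norm_shift_le (i : Fine p A ρ CG) {t α : ℝ} (ht : t ∈ i.1.K.I)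
    (hα : |α| ≤ 2 * (A * i.1.K.h)) :
    ‖α • i.1.K.G i.1.x t‖ ≤ 2 * A * (|p.Cφ| + 1) * i.1.K.h ∧ ‖α • i.1.K.G i.1.x t‖ < ρ := by
  have h1 : ‖α • i.1.K.G i.1.x t‖ ≤ 2 * A * (|p.Cφ| + 1) * i.1.K.h := by
    rw [norm_smul, Real.norm_eq_abs]
    calc |α| * ‖i.1.K.G i.1.x t‖ ≤ 2 * (A * i.1.K.h) * (|p.Cφ| + 1) :=
          mul_le_mul hα (Facts.norm_G_le ht) (norm_nonneg _) ((abs_nonneg _).trans hα)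
      _ = _ := by ring
  refine ⟨h1, h1.trans_lt (lt_of_le_of_lt ?_ i.2.radius)⟩
  have := i.h_pos
  gcongr
  linarith

theorem timeAppr_shift {n : ℕ} (hn : max p.qs p.qt ≤ n) {W : Type} [NormedAddCommGroup W]
    [NormedSpace ℝ W] {g : Fine p A ρ CG → E p.d × ℝ → W} (hg : Reg (fun i => i.cyl) n g)
    {α : Fine p A ρ CG → ℝ → ℝ} (hα : TimeAppr (p.qs + 1) α)
    (hαA : ∀ i, ∀ s ∈ Icc 0 i.1.K.Δt, |α i s| ≤ 2 * (A * i.1.K.h)) :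
    TimeAppr (p.qs + 1) (fun i s =>
      g i (i.1.x + α i s • i.1.K.G i.1.x (i.1.K.t₀ + s), i.1.K.t₀ + s)) :=
  timeAppr_comp hn hg (hα.smul (scale p A ρ CG _) (timeAppr_G p A ρ CG))
    (fun i s hs => (i.norm_shift_le (i.time_mem hs) (hαA i s hs)).1)
    (fun i s hs => (i.norm_shift_le (i.time_mem hs) (hαA i s hs)).2)

/-- Freezing the slope at (x, t₀) makes an error O(h + Δt), which is the contraction rate of the
chord iteration for the step length. -/
theorem slope_near (p : Params) (A ρ CG : ℝ) : ∃ L, 0 ≤ L ∧ ∀ i : Fine p A ρ CG,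
    ∀ t ∈ i.1.K.I, ∀ α : ℝ, |α| ≤ 2 * (A * i.1.K.h) →
      |fderiv ℝ (fun y => i.1.K.φ y t) (i.1.x + α • i.1.K.G i.1.x t) (i.1.K.G i.1.x t) -
        ‖i.1.K.G i.1.x i.1.K.t₀‖ ^ 2| ≤ L * (i.1.K.h + i.1.K.Δt) := by
  obtain ⟨L, hL, hlip⟩ := norm_fderiv_sub_le p A ρ CG
  set c : ℝ := |p.Cφ| + 1 with hc
  have hc1 : 1 ≤ c := by rw [hc]; linarith [abs_nonneg p.Cφ]
  refine ⟨2 * (c * (L * (2 * |A| * c + 1))), by positivity, fun i t ht α hα => ?_⟩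
  have hh := i.h_pos
  have hΔ := i.Δt_pos
  set ℓ₀ := fderiv ℝ (fun y => i.1.K.φ y i.1.K.t₀) i.1.x with hℓ₀
  set ℓ := fderiv ℝ (fun y => i.1.K.φ y t) (i.1.x + α • i.1.K.G i.1.x t) with hℓ
  set G := i.1.K.G i.1.x t with hG
  set G₀ := i.1.K.G i.1.x i.1.K.t₀ with hG₀
  obtain ⟨n1, n2⟩ := i.norm_shift_le ht hα
  have hA := i.A_nonneg
  have e1 : ‖ℓ - ℓ₀‖ ≤ L * (2 * |A| * c + 1) * (i.1.K.h + i.1.K.Δt) := by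
    have := hlip i (i.1.x + α • G) (by simpa using n2) t ht
    rw [add_sub_cancel_left] at this
    refine this.trans ?_
    rw [mul_assoc, abs_of_nonneg hA]
    refine mul_le_mul_of_nonneg_left ?_ hL
    have h3 : 0 ≤ 2 * A * c * i.1.K.Δt := by positivity
    rw [← hc] at n1
    linarith
  have e2 : ‖G - G₀‖ ≤ L * (2 * |A| * c + 1) * (i.1.K.h + i.1.K.Δt) := by
    rw [hG, hG₀, Config.G, Config.G]
    have := hlip i i.1.x i.mem_cyl.1 t ht
    rw [sub_self, norm_zero, zero_add] at this
    have e : ‖gradient (fun y => i.1.K.φ y t) i.1.x - gradient (fun y => i.1.K.φ y i.1.K.t₀) i.1.x‖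
        = ‖fderiv ℝ (fun y => i.1.K.φ y t) i.1.x - ℓ₀‖ := norm_gradient_sub _ _ _
    rw [e]
    refine this.trans ?_
    rw [mul_assoc]
    refine mul_le_mul_of_nonneg_left ?_ hL
    have h3 : 0 ≤ 2 * |A| * c * (i.1.K.h + i.1.K.Δt) := by positivity
    linarith
  have e3 : ‖ℓ₀‖ ≤ c := by
    have := Config.norm_fderiv_slice_le i.1.adm.levelSet i.t₀_mem (i.1.mem_U i.t₀_mem)
    rw [hc]
    linarith [le_abs_self p.Cφ]
  have e4 : ‖G‖ ≤ c := Facts.norm_G_le ht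
  have e : ℓ G - ‖G₀‖ ^ 2 = (ℓ - ℓ₀) G + ℓ₀ (G - G₀) := by
    rw [← fderiv_apply_G]
    simp only [sub_apply, map_sub]
    ring
  rw [e]
  have h5 : |(ℓ - ℓ₀) G| ≤ L * (2 * |A| * c + 1) * (i.1.K.h + i.1.K.Δt) * c :=
    ((ℓ - ℓ₀).le_opNorm G).trans (by gcongr)
  have h6 : |ℓ₀ (G - G₀)| ≤ c * (L * (2 * |A| * c + 1) * (i.1.K.h + i.1.K.Δt)) :=
    (ℓ₀.le_opNorm _).trans (by gcongr)
  refine (abs_add_le _ _).trans ((add_le_add h5 h6).trans (le_of_eq (by ring)))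

theorem le_sq_norm_G (i : Fine p A ρ CG) : p.cφ ^ 2 ≤ ‖i.1.K.G i.1.x i.1.K.t₀‖ ^ 2 :=
  pow_le_pow_left₀ p.cφ_pos.le
    (i.1.adm.levelSet.grad_lower _ i.t₀_mem _ (i.1.mem_U i.t₀_mem)) 2

/-- The step length is approximable by polynomials in time. -/
theorem timeAppr_stepLen (p : Params) (A ρ CG : ℝ) :
    TimeAppr (p.qs + 1) (fun (i : Fine p A ρ CG) s => i.1.K.stepLen i.1.x (i.1.K.t₀ + s)) := by
  have hS := scale p A ρ CG (p.qs + 1)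
  obtain ⟨L, hL, hslope⟩ := slope_near p A ρ CG
  obtain ⟨m, hm, h0, -⟩ := exists_deriv_φ p A ρ CG
  have hc : 0 < p.cφ ^ 2 := pow_pos p.cφ_pos 2
  set N := max p.qs p.qt + 1 with hN
  -- The frozen slope is |∇φ(x,t₀)|² and θ is proportional to h + Δt, so max(q_s, q_t) + 1
  -- iterations reach the tolerance.
  refine Appr.root hS (f := fun i s α => i.1.K.φ (i.1.x + α • i.1.K.G i.1.x (i.1.K.t₀ + s))
      (i.1.K.t₀ + s) - i.1.K.rhs i.1.x (i.1.K.t₀ + s))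
    (c₀ := fun i => ‖i.1.K.G i.1.x i.1.K.t₀‖ ^ 2) (R := fun i => A * i.1.K.h)
    (θ := fun i => (p.cφ ^ 2)⁻¹ * (L * (i.1.K.h + i.1.K.Δt)))
    (K := ((p.cφ ^ 2)⁻¹ * L) ^ N * 2 ^ N * |A|) (N := N) hc le_sq_norm_G ?_ ?_ ?_ ?_ ?_
  · intro i
    have := i.h_pos
    have := i.Δt_pos
    positivity
  · exact fun i s hs => i.2.abs_stepLen_le (i.time_mem hs)
  · intro i s hs α hα
    have ht := i.time_mem hs
    set t := i.1.K.t₀ + s with ht'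
    set G := i.1.K.G i.1.x t with hG
    set r := i.1.K.stepLen i.1.x t with hr
    set c₀ := ‖i.1.K.G i.1.x i.1.K.t₀‖ ^ 2 with hc₀
    have hA : 0 ≤ A * i.1.K.h := mul_nonneg i.A_nonneg i.h_pos.le
    have hr2 : |r| ≤ 2 * (A * i.1.K.h) := (i.2.abs_stepLen_le ht).trans (by linarith)
    have hroot : i.1.K.φ (i.1.x + r • G) t = i.1.K.rhs i.1.x t := (i.2.ideal t ht).eq
    -- Mean value inequality for β ↦ φ(x + βG, t) − c₀β between the root and α; its derivative is
    -- the deviation from the frozen slope.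
    have hder : ∀ β ∈ Icc (-(2 * (A * i.1.K.h))) (2 * (A * i.1.K.h)), HasDerivWithinAt
        (fun β => i.1.K.φ (i.1.x + β • G) t - c₀ * β)
        (fderiv ℝ (fun y => i.1.K.φ y t) (i.1.x + β • G) G - c₀)
        (Icc (-(2 * (A * i.1.K.h))) (2 * (A * i.1.K.h))) β := by
      intro β hβ
      have hb : i.1.x + β • G ∈ ball i.1.x ρ := by
        simpa using (i.norm_shift_le ht (abs_le.2 hβ)).2
      have h1 : HasFDerivAt (fun y => i.1.K.φ y t)
          (fderiv ℝ (fun y => i.1.K.φ y t) (i.1.x + β • G)) (i.1.x + β • G) :=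
        (Config.contDiffOn_φ_interior i.1.adm.levelSet ht).hasFDerivAt_of_isOpen
          isOpen_interior (i.2.ball hb)
      have h2 : HasDerivAt (fun β : ℝ => i.1.x + β • G) G β := by
        simpa using ((hasDerivAt_id β).smul_const G).const_add i.1.x
      have h3 := (h1.comp_hasDerivAt β h2).sub ((hasDerivAt_id β).const_mul c₀)
      simp only [mul_one] at h3
      exact h3.hasDerivWithinAt
    have hmv := (convex_Icc _ _).norm_image_sub_le_of_norm_hasDerivWithin_le hder
      (fun β hβ => hslope i t ht β (abs_le.2 hβ)) (abs_le.1 hr2) (abs_le.1 hα)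
    have e : i.1.K.φ (i.1.x + α • G) t - i.1.K.rhs i.1.x t - c₀ * (α - r) =
        i.1.K.φ (i.1.x + α • G) t - c₀ * α - (i.1.K.φ (i.1.x + r • G) t - c₀ * r) := by
      rw [hroot]; ring
    rw [e]
    refine hmv.trans ?_
    rw [← mul_assoc, Real.norm_eq_abs]
    refine mul_le_mul_of_nonneg_right ?_ (abs_nonneg _)
    have h4 : 0 ≤ L * (i.1.K.h + i.1.K.Δt) :=
      mul_nonneg hL (add_nonneg i.h_pos.le i.Δt_pos.le)
    have h5 : 1 ≤ c₀ * (p.cφ ^ 2)⁻¹ := by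
      rw [← div_eq_mul_inv, one_le_div hc]
      exact i.le_sq_norm_G
    rw [← mul_assoc]
    exact le_mul_of_one_le_left h4 h5
  · exact fun α hα hαA => (timeAppr_shift (by omega) h0 hα hαA).sub hS (timeAppr_rhs p A ρ CG)
  · intro i
    have h1 := i.add_pow_le_tol (k := N) le_rfl
    have h2 : A * i.1.K.h ≤ |A| :=
      (mul_le_of_le_one_right i.A_nonneg i.2.h_le).trans (le_abs_self A)
    have h3 : 0 ≤ A * i.1.K.h := mul_nonneg i.A_nonneg i.h_pos.le
    have h4 := i.tol_nonneg (p.qs + 1)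
    calc ((p.cφ ^ 2)⁻¹ * (L * (i.1.K.h + i.1.K.Δt))) ^ N * (A * i.1.K.h)
        = ((p.cφ ^ 2)⁻¹ * L) ^ N * (i.1.K.h + i.1.K.Δt) ^ N * (A * i.1.K.h) := by
          rw [← mul_assoc (p.cφ ^ 2)⁻¹, mul_pow _ (i.1.K.h + i.1.K.Δt)]
      _ ≤ ((p.cφ ^ 2)⁻¹ * L) ^ N * (2 ^ N * i.1.K.tol (p.qs + 1)) * |A| := by gcongr
      _ = _ := by ring

/-- The point x is subtracted because the coefficients must be bounded uniformly, whereas positions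
are not. Later it drops out, as the Lagrange basis sums to 1. -/
theorem timeAppr_Ψ (p : Params) (A ρ CG : ℝ) :
    TimeAppr (p.qs + 1) (fun (i : Fine p A ρ CG) s => i.1.K.Ψ i.1.x (i.1.K.t₀ + s) - i.1.x) := by
  refine ((timeAppr_stepLen p A ρ CG).smul (scale p A ρ CG _) (timeAppr_G p A ρ CG)).congr
    fun i s _ => ?_
  rw [Config.Ψ, add_sub_cancel_left]
  rfl

end Fine

theorem norm_sum_smul_sub_sum_smul_le {W : Type*} [NormedAddCommGroup W] [NormedSpace ℝ W] {n : ℕ}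
    {c : Fin n → ℝ} {u v : Fin n → W} {Λ ε : ℝ} (hΛ : 0 ≤ Λ) (hc : ∀ i, |c i| ≤ Λ)
    (h : ∀ i, ‖u i - v i‖ ≤ ε) : ‖∑ i, c i • u i - ∑ i, c i • v i‖ ≤ n * (Λ * ε) := by
  rw [← Finset.sum_sub_distrib]
  have h1 : ∀ i ∈ Finset.univ, ‖c i • u i - c i • v i‖ ≤ Λ * ε := by
    intro i _
    rw [← smul_sub, norm_smul, Real.norm_eq_abs]
    exact mul_le_mul (hc i) (h i) (norm_nonneg _) hΛ
  refine (norm_sum_le_of_le _ h1).trans (le_of_eq ?_)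
  simp

/-- The distances between the three mappings. -/
theorem exists_mapping_error (p : Params) {A ρ CG : ℝ} (hA : 0 ≤ A) (hρ : 0 < ρ)
    (hCG : 0 ≤ CG) : ∃ C, 0 ≤ C ∧ ∀ a : Loc p, Facts A ρ CG a → ∀ t ∈ a.K.I, ∀ sd,
      ‖a.K.Ψh a.bl sd a.T a.x t - a.K.Ψ a.x t‖ ≤ C * a.K.tol (p.qs + 1) ∧
      ‖a.K.Ψdt a.x t - a.K.Ψ a.x t‖ ≤ C * a.K.tol (p.qs + 1) ∧
      ‖a.K.Ψdt a.x t - a.K.Ψh a.bl sd a.T a.x t‖ ≤ C * a.K.h ^ (p.qs + 1) := by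
  obtain ⟨Λ, hΛ, hell⟩ := exists_ell_bound p
  obtain ⟨C₁, hC₁, hnod⟩ := exists_nodal_comparison p hA hρ hCG
  have happ := Fine.timeAppr_Ψ p A ρ CG
  obtain ⟨C₂, hC₂, hint⟩ := Appr.interpolation_error (K := fun i : Fine p A ρ CG => i.1.K)
    (Fine.scale p A ρ CG (p.qs + 1)) (fun i => i.1.adm.time_lt)
    (fun i => by
      rw [Config.tol]
      exact le_add_of_nonneg_left (pow_nonneg i.h_pos.le _))
    (f := fun i t => i.1.K.Ψ i.1.x t - i.1.x) happ
  set n : ℝ := ((p.qt + 1 : ℕ) : ℝ) with hn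
  have hn0 : 0 ≤ n := by positivity
  have hD : 0 ≤ n * (Λ * C₁) := by positivity
  refine ⟨2 * (n * (Λ * C₁)) + C₂, by positivity, fun a hF t ht sd => ?_⟩
  have hη := Facts.tol_nonneg a (p.qs + 1)
  have hh : 0 ≤ a.K.h ^ (p.qs + 1) := pow_nonneg a.adm.h_pos.le _
  have hhη : a.K.h ^ (p.qs + 1) ≤ a.K.tol (p.qs + 1) :=
    le_add_of_nonneg_right (pow_nonneg a.adm.Δt_pos.le _)
  have hsum : ∀ (u v : Fin (p.qt + 1) → E p.d) (ε : ℝ), (∀ i, ‖u i - v i‖ ≤ C₁ * ε) →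
      ‖∑ i, a.K.ell i t • u i - ∑ i, a.K.ell i t • v i‖ ≤ n * (Λ * C₁) * ε := by
    intro u v ε h
    refine (norm_sum_smul_sub_sum_smul_le hΛ (fun i => hell a.K a.adm.time_lt t ht i) h).trans
      (le_of_eq (by rw [hn]; ring))
  have e1 : ‖a.K.Ψdt a.x t - a.K.Ψh a.bl sd a.T a.x t‖ ≤ n * (Λ * C₁) * a.K.h ^ (p.qs + 1) :=
    hsum _ _ _ fun i => (hnod a hF i).2.2 sd
  have e2 : ‖a.K.Ψdt a.x t - ∑ i, a.K.ell i t • a.K.Ψ a.x (a.K.node i)‖ ≤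
      n * (Λ * C₁) * a.K.tol (p.qs + 1) := hsum _ _ _ fun i => by
    rw [norm_sub_rev]
    exact (hnod a hF i).2.1
  have e3 : ‖∑ i, a.K.ell i t • a.K.Ψ a.x (a.K.node i) - a.K.Ψ a.x t‖ ≤
      C₂ * a.K.tol (p.qs + 1) := by
    have h1 := hint ⟨a, hF⟩ t ht
    simp only [smul_sub, Finset.sum_sub_distrib, ← Finset.sum_smul] at h1
    rw [a.K.sum_ell a.adm.time_lt, one_smul] at h1
    simpa using h1
  have e4 := norm_sub_le_norm_sub_add_norm_sub (a.K.Ψdt a.x t)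
    (∑ i, a.K.ell i t • a.K.Ψ a.x (a.K.node i)) (a.K.Ψ a.x t)
  have e5 := norm_sub_le_norm_sub_add_norm_sub (a.K.Ψh a.bl sd a.T a.x t) (a.K.Ψdt a.x t)
    (a.K.Ψ a.x t)
  rw [norm_sub_rev] at e1
  have e6 := mul_le_mul_of_nonneg_left hhη hD
  have e7 := mul_nonneg hD hη
  have e8 := mul_nonneg hD hh
  have e9 := mul_nonneg hC₂ hh
  refine ⟨by linarith, by linarith, ?_⟩
  rw [norm_sub_rev]
  linarith

end SpaceTimeMapping

namespace SpaceTimeMapping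

open Filter Topology

/-! ### Derivatives of the mappings -/

theorem norm_smul_le_mul {W : Type*} [NormedAddCommGroup W] [NormedSpace ℝ W] {r R M : ℝ} {D : W}
    (hr : |r| ≤ R) (hD : ‖D‖ ≤ M) : ‖r • D‖ ≤ R * M := by
  rw [norm_smul, Real.norm_eq_abs]
  exact mul_le_mul hr hD (norm_nonneg _) ((abs_nonneg _).trans hr)

theorem norm_smul_sub_smul_le {W : Type*} [NormedAddCommGroup W] [NormedSpace ℝ W] (r r' : ℝ)
    (D D' : W) : ‖r • D - r' • D'‖ ≤ |r - r'| * ‖D‖ + |r'| * ‖D' - D‖ := by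
  have e : r • D - r' • D' = (r - r') • D - r' • (D' - D) := by module
  rw [e]
  refine (norm_sub_le _ _).trans (le_of_eq ?_)
  rw [norm_smul, norm_smul, Real.norm_eq_abs, Real.norm_eq_abs]

theorem sum_sub_const_smul {W κ : Type*} [AddCommGroup W] [Module ℝ W] [Fintype κ] {w : κ → W}
    (hw : ∑ j, w j = 0) (u : κ → ℝ) (c : ℝ) : ∑ j, (u j - c) • w j = ∑ j, u j • w j := by
  simp only [sub_smul, Finset.sum_sub_distrib, ← Finset.smul_sum, hw, smul_zero, sub_zero]

/-- The derivative of a mapping `y ↦ y + r(y) ∇f(y)` with `f(y + r(y) ∇f(y)) = g(y)` in terms of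
the derivatives `ℓ`, `ℓ'` of `f` at the point and at its image, of `e = r D²f` and of the
derivative `γ` of `g`. -/
noncomputable def mapDeriv {d : ℕ} (ℓ ℓ' : E d →L[ℝ] ℝ) (e : E d →L[ℝ] E d →L[ℝ] ℝ)
    (γ : E d →L[ℝ] ℝ) : E d →L[ℝ] E d :=
  ContinuousLinearMap.id ℝ (E d) +
    ((ℓ' (riesz d ℓ))⁻¹ •
      (γ - ℓ'.comp (ContinuousLinearMap.id ℝ (E d) + (riesz d).comp e))).smulRight
      (riesz d ℓ) + (riesz d).comp e

/-- The search direction is a gradient, so second derivatives of f are needed at x, but at the image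
point only first ones. -/
theorem hasFDerivAt_add_smul_gradient {d : ℕ} {f g r : E d → ℝ} {x : E d} {γ : E d →L[ℝ] ℝ}
    {c : ℝ} (hc : 0 < c)
    (hf : HasFDerivAt f (fderiv ℝ f (x + r x • gradient f x)) (x + r x • gradient f x))
    (hf2 : HasFDerivAt (fderiv ℝ f) (fderiv ℝ (fderiv ℝ f) x) x) (hg : HasFDerivAt g γ x)
    (hroot : ∀ᶠ y in 𝓝 x, f (y + r y • gradient f y) = g y)
    (hlow : ∀ᶠ y in 𝓝 x, c * |r y - r x| ≤
      |f (y + r y • gradient f y) - f (y + r x • gradient f y)|)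
    (hu : c ≤ fderiv ℝ f (x + r x • gradient f x) (gradient f x)) :
    HasFDerivAt (fun y => y + r y • gradient f y)
      (mapDeriv (fderiv ℝ f x) (fderiv ℝ f (x + r x • gradient f x))
        (r x • fderiv ℝ (fderiv ℝ f) x) γ) x := by
  have hV : HasFDerivAt (gradient f) ((riesz d).comp (fderiv ℝ (fderiv ℝ f) x)) x :=
    (riesz d).hasFDerivAt.comp x hf2
  have hr := hasFDerivAt_root hc hf hV hg hroot hlow (hc.trans_le hu).ne'
  have h := (hasFDerivAt_id x).add (hr.smul hV)
  refine h.congr_fderiv ?_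
  rw [mapDeriv, ContinuousLinearMap.comp_smul, riesz_fderiv]
  abel

/-- The formula is made of bilinear operations and one reciprocal. The latter is a separate
hypothesis, since it needs a positive lower bound. -/
theorem Appr.mapDeriv {ι : Type} {Δ η : ι → ℝ} (hS : Scale Δ η) {d : ℕ}
    {ℓ ℓ' γ : ι → ℝ → E d →L[ℝ] ℝ} {e : ι → ℝ → E d →L[ℝ] E d →L[ℝ] ℝ}
    (hℓ : Appr Δ η ℓ) (hℓ' : Appr Δ η ℓ') (he : Appr Δ η e) (hγ : Appr Δ η γ)
    (hu : Appr Δ η fun i s => (ℓ' i s (riesz d (ℓ i s)))⁻¹) :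
    Appr Δ η fun i s => mapDeriv (ℓ i s) (ℓ' i s) (e i s) (γ i s) := by
  have hid : Appr Δ η fun (_ : ι) _ => ContinuousLinearMap.id ℝ (E d) :=
    Appr.const (w := fun _ => ContinuousLinearMap.id ℝ (E d)) (fun _ => le_rfl) hS.η_nonneg
  have hr : Appr Δ η fun (_ : ι) _ => riesz d :=
    Appr.const (w := fun _ => riesz d) (fun _ => le_rfl) hS.η_nonneg
  have hG := hℓ.clm hS (riesz d)
  have hJ := hr.comp hS he
  have hδ := hu.smul hS (hγ.sub hS (hℓ'.comp hS (hid.add hJ)))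
  exact (hid.add (hδ.smulRight hS hG)).add hJ

theorem Near.mapDeriv {ι : Type} {η : ι → ℝ} (hη : ∀ i, 0 ≤ η i) {d : ℕ} {c : ℝ} (hc : 0 < c)
    {ℓ₁ ℓ₂ ℓ₁' ℓ₂' γ₁ γ₂ : ι → E d →L[ℝ] ℝ} {e₁ e₂ : ι → E d →L[ℝ] E d →L[ℝ] ℝ}
    (hℓ : Near η ℓ₁ ℓ₂) (hℓ' : Near η ℓ₁' ℓ₂') (he : Near η e₁ e₂) (hγ : Near η γ₁ γ₂)
    (hu₁ : ∀ i, c ≤ ℓ₁' i (riesz d (ℓ₁ i))) (hu₂ : ∀ i, c ≤ ℓ₂' i (riesz d (ℓ₂ i))) :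
    Near η (fun i => mapDeriv (ℓ₁ i) (ℓ₁' i) (e₁ i) (γ₁ i))
      (fun i => mapDeriv (ℓ₂ i) (ℓ₂' i) (e₂ i) (γ₂ i)) := by
  have hid : Near η (fun _ => ContinuousLinearMap.id ℝ (E d))
      (fun _ => ContinuousLinearMap.id ℝ (E d)) := Near.const hη _
  have hG := Near.bilin hη (ContinuousLinearMap.id ℝ _) (Near.const hη (riesz d)) hℓ
  have hJ := Near.bilin hη (ContinuousLinearMap.compL ℝ (E d) (E d →L[ℝ] ℝ) (E d))
    (Near.const hη (riesz d)) he
  have hu := (Near.bilin hη (ContinuousLinearMap.id ℝ (E d →L[ℝ] ℝ)) hℓ' hG).inv hη hc hu₁ hu₂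
  have hδ := Near.bilin hη (ContinuousLinearMap.lsmul ℝ ℝ) hu
    (hγ.sub (Near.bilin hη (ContinuousLinearMap.compL ℝ (E d) (E d) ℝ) hℓ' (hid.add hJ)))
  exact (hid.add (Near.bilin hη (ContinuousLinearMap.smulRightL ℝ (E d) (E d)) hδ hG)).add hJ

/-! ### The derivative of the blended right-hand side -/

namespace Config

variable {p : Params} (K : Config p)

/-- The derivative of `φ^lin` on the element `T`. -/
noncomputable def Dlin (T : Simplex p.d) (t : ℝ) : E p.d →L[ℝ] ℝ :=
  ∑ j, K.φh (T j) t • coordCLM T j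

/-- The derivative on `T` of the blend of `φ^lin` with a function that has value `v` and
derivative `ℓ`. -/
noncomputable def rhsDeriv (T : Simplex p.d) (x : E p.d) (t v : ℝ) (ℓ : E p.d →L[ℝ] ℝ) :
    E p.d →L[ℝ] ℝ :=
  (1 - K.b x t) • K.Dlin T t + K.b x t • ℓ + (v - K.φlin x t) • fderiv ℝ (fun y => K.b y t) x

variable {K}

theorem IsTriangulation.hasFDerivAt_rhs (hK : K.IsTriangulation) {T : Simplex p.d}
    (hT : T ∈ K.mesh) {x : E p.d} (hx : x ∈ interior (hull T)) {t : ℝ}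
    (hb : DifferentiableAt ℝ (fun y => K.b y t) x) {f : E p.d → ℝ} {ℓ : E p.d →L[ℝ] ℝ}
    (hf : HasFDerivAt f ℓ x) :
    HasFDerivAt (fun y => (1 - K.b y t) * K.φlin y t + K.b y t * f y)
      (K.rhsDeriv T x t (f x) ℓ) x := by
  have hlin : HasFDerivAt (fun y => K.φlin y t) (K.Dlin T t) x := by
    refine (hasFDerivAt_linInterp T (fun y => K.φh y t) x).congr_of_eventuallyEq ?_
    filter_upwards [isOpen_interior.mem_nhds hx] with y hy
    exact hK.φlin_eq hT t (interior_subset hy)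
  have h := ((hb.hasFDerivAt.const_sub 1).mul hlin).add (hb.hasFDerivAt.mul hf)
  refine h.congr_fderiv ?_
  rw [rhsDeriv]
  module

end Config

namespace Fine

variable {p : Params} {A ρ CG : ℝ}

theorem timeAppr_mono {W : Type} [NormedAddCommGroup W] [NormedSpace ℝ W]
    {f : Fine p A ρ CG → ℝ → W} (hf : TimeAppr (p.qs + 1) f) : TimeAppr p.qs f :=
  hf.mono_tol (K := 1) (fun i => by
    rw [one_mul, Config.tol, Config.tol]
    gcongr ?_ + _
    exact pow_le_pow_of_le_one i.h_pos.le i.2.h_le (Nat.le_succ _)) fun i => i.tol_nonneg _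

theorem timeAppr_fderiv_image (p : Params) (A ρ CG : ℝ) :
    TimeAppr (p.qs + 1) (fun (i : Fine p A ρ CG) s =>
      fderiv ℝ (fun y => i.1.K.φ y (i.1.K.t₀ + s)) (i.1.K.Ψ i.1.x (i.1.K.t₀ + s))) := by
  obtain ⟨m, hm, -, -, g₁, g₂, h1, -, hd⟩ := exists_deriv_φ p A ρ CG
  have hS := scale p A ρ CG (p.qs + 1)
  have hα : ∀ i : Fine p A ρ CG, ∀ s ∈ Icc 0 i.1.K.Δt,
      |i.1.K.stepLen i.1.x (i.1.K.t₀ + s)| ≤ 2 * (A * i.1.K.h) := fun i s hs => by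
    have h1 := i.2.abs_stepLen_le (i.time_mem hs)
    have h2 : 0 ≤ A * i.1.K.h := mul_nonneg i.A_nonneg i.h_pos.le
    linarith
  refine ((timeAppr_shift hm h1 (timeAppr_stepLen p A ρ CG) hα).clm hS
    ((ContinuousLinearMap.compL ℝ (E p.d) (E p.d × ℝ) ℝ).flip
      (ContinuousLinearMap.inl ℝ (E p.d) ℝ))).congr fun i s hs => ?_
  exact (hd i _ (i.2.mem_ball_of_le (i.2.abs_stepLen_le (i.time_mem hs))
    (Facts.norm_G_le (i.time_mem hs))) _ (i.time_mem hs)).1.fderiv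

/-- D²φ alone is approximable only up to Δt^(m+1), which may be one order short. The step length
contributes a factor A h, and h Δt^(m+1) ≤ (h + Δt)^(m+2) is within the tolerance. For this reason
`mapDeriv` takes r D²f as one argument. -/
theorem timeAppr_stepLen_smul_fderiv_fderiv (p : Params) (A ρ CG : ℝ) :
    TimeAppr (p.qs + 1) (fun (i : Fine p A ρ CG) s => i.1.K.stepLen i.1.x (i.1.K.t₀ + s) •
      fderiv ℝ (fderiv ℝ (fun y => i.1.K.φ y (i.1.K.t₀ + s))) i.1.x) := by
  obtain ⟨m, hm, -, -, g₁, g₂, -, h2, hd⟩ := exists_deriv_φ p A ρ CG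
  have hS := scale p A ρ CG (p.qs + 1)
  have hS' : Scale (fun i : Fine p A ρ CG => i.1.K.Δt) (fun i => i.1.K.Δt ^ (m + 1)) :=
    ⟨hS.Δ_nonneg, hS.Δ_le, fun i => pow_nonneg i.Δt_pos.le _, fun i =>
      (pow_le_one₀ i.Δt_pos.le i.2.Δt_le).trans one_le_two⟩
  have hw : Appr (fun i : Fine p A ρ CG => i.1.K.Δt) (fun i => i.1.K.Δt ^ (m + 1))
      (fun _ s => ((0 : E p.d), s)) :=
    (Appr.const (w := fun _ => (0 : E p.d)) (C := 0) (by simp) hS'.η_nonneg).prodMk hS'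
      (Appr.time hS'.η_nonneg)
  have h3 := h2.appr_comp hS' convex_cyl (z := fun i => (i.1.x, i.1.K.t₀)) mem_cyl hw (K := 1)
    (fun i s hs => ⟨by simpa using i.radius_pos, i.time_mem hs⟩) (fun i s hs => by
      rw [one_mul, Prod.norm_mk, norm_zero, max_eq_right (norm_nonneg _), Real.norm_eq_abs,
        abs_of_nonneg hs.1]
      exact pow_le_pow_left₀ hs.1 hs.2 _)
  have hin : Appr (fun i : Fine p A ρ CG => i.1.K.Δt) (fun i => i.1.K.Δt ^ (m + 1))
      (fun _ _ => ContinuousLinearMap.inl ℝ (E p.d) ℝ) :=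
    Appr.const (w := fun _ => ContinuousLinearMap.inl ℝ (E p.d) ℝ) (fun _ => le_rfl) hS'.η_nonneg
  have hout : Appr (fun i : Fine p A ρ CG => i.1.K.Δt) (fun i => i.1.K.Δt ^ (m + 1))
      (fun _ _ => (ContinuousLinearMap.compL ℝ (E p.d) (E p.d × ℝ) ℝ).flip
        (ContinuousLinearMap.inl ℝ (E p.d) ℝ)) :=
    Appr.const (w := fun _ => (ContinuousLinearMap.compL ℝ (E p.d) (E p.d × ℝ) ℝ).flip
        (ContinuousLinearMap.inl ℝ (E p.d) ℝ)) (fun _ => le_rfl) hS'.η_nonneg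
  have h4 := hout.comp hS' (h3.comp hS' hin)
  have h5 : Appr (fun i : Fine p A ρ CG => i.1.K.Δt) (fun i => i.1.K.Δt ^ (m + 1))
      (fun i s => fderiv ℝ (fderiv ℝ (fun y => i.1.K.φ y (i.1.K.t₀ + s))) i.1.x) := by
    refine h4.congr fun i s hs => ?_
    rw [(hd i _ i.mem_cyl.1 _ (i.time_mem hs)).2.fderiv]
    simp
  refine Appr.smul_of_small hS (R := fun i => A * i.1.K.h) (K := |A| * 2 ^ (m + 2))
    (timeAppr_stepLen p A ρ CG) (fun i s hs => i.2.abs_stepLen_le (i.time_mem hs)) h5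
    fun i => ?_
  have hh := i.h_pos.le
  have hΔ := i.Δt_pos.le
  have hA := i.A_nonneg
  rw [abs_of_nonneg hA]
  calc A * i.1.K.h * i.1.K.Δt ^ (m + 1)
      ≤ A * ((i.1.K.h + i.1.K.Δt) * (i.1.K.h + i.1.K.Δt) ^ (m + 1)) := by
        rw [mul_assoc]
        gcongr <;> linarith
    _ = A * (i.1.K.h + i.1.K.Δt) ^ (m + 2) := by ring
    _ ≤ A * (2 ^ (m + 2) * i.1.K.tol (p.qs + 1)) := by
        gcongr
        exact i.add_pow_le_tol (by omega)
    _ = _ := by ring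

theorem exists_deriv_b (p : Params) (A ρ CG : ℝ) :
    ∃ n, max p.qs p.qt ≤ n ∧ ∃ b₁ : Fine p A ρ CG → E p.d × ℝ → (E p.d × ℝ →L[ℝ] ℝ),
      Reg (fun i : Fine p A ρ CG => i.cyl) n b₁ ∧ ∀ i : Fine p A ρ CG, ∀ t ∈ i.1.K.I,
        HasFDerivAt (fun y => i.1.K.b y t)
          ((b₁ i (i.1.x, t)).comp (ContinuousLinearMap.inl ℝ (E p.d) ℝ)) i.1.x := by
  obtain ⟨m, hm, -, hb, -⟩ := exists_deriv_φ p A ρ CG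
  obtain ⟨-, b₁, hd, h1⟩ := hb
  exact ⟨m + 1, hm, b₁, h1, fun i t ht =>
    hasFDerivAt_slice isOpen_ball i.mem_cyl.1 ht (hd i (i.1.x, t) ⟨i.mem_cyl.1, ht⟩)⟩

theorem differentiableAt_b (i : Fine p A ρ CG) {t : ℝ} (ht : t ∈ i.1.K.I) :
    DifferentiableAt ℝ (fun y => i.1.K.b y t) i.1.x := by
  obtain ⟨n, -, b₁, -, h⟩ := exists_deriv_b p A ρ CG
  exact (h i t ht).differentiableAt

theorem timeAppr_fderiv_b (p : Params) (A ρ CG : ℝ) :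
    TimeAppr (p.qs + 1) (fun (i : Fine p A ρ CG) s =>
      fderiv ℝ (fun y => i.1.K.b y (i.1.K.t₀ + s)) i.1.x) := by
  obtain ⟨n, hn, b₁, h1, hd⟩ := exists_deriv_b p A ρ CG
  refine ((timeAppr_comp_const hn h1).clm (scale p A ρ CG _)
    ((ContinuousLinearMap.compL ℝ (E p.d) (E p.d × ℝ) ℝ).flip
      (ContinuousLinearMap.inl ℝ (E p.d) ℝ))).congr fun i s hs => ?_
  exact (hd i _ (i.time_mem hs)).fderiv

theorem norm_smul_coordCLM_le (i : Fine p A ρ CG) (j : Fin (p.d + 1)) :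
    ‖i.1.T j - i.1.x‖ * ‖coordCLM i.1.T j‖ ≤ p.κ := by
  obtain ⟨c, r, hr, hb, hd⟩ := i.1.adm.triangulation.shape i.1.T i.1.mesh
  refine (mul_le_mul_of_nonneg_right ?_ (norm_nonneg _)).trans
    (diam_mul_norm_coordCLM_le i.1.T hr hb hd j)
  rw [← dist_eq_norm]
  exact dist_le_diam_of_mem (isCompact_hull _).isBounded (vertex_mem_hull _ _) i.1.mem

/-- The distance to a vertex may be arbitrarily small, so an approximation of the numerator cannot
simply be divided by it. The quotient is itself a regular function of time, one order below φ, which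
still suffices. -/
theorem timeAppr_difference_quotient (p : Params) (A ρ CG : ℝ) (j : Fin (p.d + 1)) :
    TimeAppr (p.qs + 1) (fun (i : Fine p A ρ CG) s => ‖i.1.T j - i.1.x‖⁻¹ •
      (i.1.K.φ (i.1.T j) (i.1.K.t₀ + s) - i.1.K.φ i.1.x (i.1.K.t₀ + s))) := by
  obtain ⟨m, hm, h0, -⟩ := exists_deriv_φ p A ρ CG
  have hS := scale p A ρ CG (p.qs + 1)
  have hB' : ∀ i : Fine p A ρ CG, Convex ℝ (({i.1.x} : Set (E p.d)) ×ˢ i.1.K.I) := fun i =>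
    (convex_singleton _).prod (convex_Icc _ _)
  have h1 := Reg.difference_quotient (B' := fun i : Fine p A ρ CG => {i.1.x} ×ˢ i.1.K.I)
    (ω := fun i => (i.1.T j - i.1.x, (0 : ℝ))) convex_cyl hB'
    (fun i => prod_mono (singleton_subset_iff.2 i.mem_cyl.1) subset_rfl)
    (fun i z hz => by
      obtain ⟨hz1, hz2⟩ := hz
      rw [mem_singleton_iff] at hz1
      refine ⟨?_, by simpa using hz2⟩
      rw [Prod.fst_add, hz1, mem_ball_iff_norm, add_sub_cancel_left]
      exact (i.dist_vertex_le j).trans_lt i.h_lt) (m + 1) h0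
  have hw : TimeAppr (p.qs + 1) (fun (_ : Fine p A ρ CG) s => ((0 : E p.d), s)) :=
    (Appr.const (w := fun _ => (0 : E p.d)) (C := 0) (by simp) hS.η_nonneg).prodMk hS
      (Appr.time hS.η_nonneg)
  have h2 := h1.appr_comp hS hB' (z := fun i => (i.1.x, i.1.K.t₀))
    (fun i => ⟨rfl, i.t₀_mem⟩) hw (K := 1) (fun i s hs => ⟨by simp, i.time_mem hs⟩)
    (fun i s hs => by
      rw [one_mul, Prod.norm_mk, norm_zero, max_eq_right (norm_nonneg _), Real.norm_eq_abs,
        abs_of_nonneg hs.1, Config.tol]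
      have e1 : s ^ (m + 1 + 1) ≤ i.1.K.Δt ^ (m + 1 + 1) := pow_le_pow_left₀ hs.1 hs.2 _
      have e2 : i.1.K.Δt ^ (m + 1 + 1) ≤ i.1.K.Δt ^ (p.qt + 1) :=
        pow_le_pow_of_le_one i.Δt_pos.le i.2.Δt_le (by omega)
      have e3 : 0 ≤ i.1.K.h ^ (p.qs + 1) := pow_nonneg i.h_pos.le _
      linarith)
  refine h2.congr fun i s _ => ?_
  simp [Prod.norm_mk, Function.uncurry]

/-- The gradients of the barycentric coordinates sum to zero, so φ_h(x) may be subtracted from the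
vertex values. Each term becomes a difference quotient times ‖T_j − x‖ ∇λ_j, which shape regularity
bounds. Passing from φ_h to φ costs the gradient error; here one power of h is lost. -/
theorem timeAppr_Dlin (p : Params) (A ρ CG : ℝ) :
    TimeAppr p.qs (fun (i : Fine p A ρ CG) s => i.1.K.Dlin i.1.T (i.1.K.t₀ + s)) := by
  have hS := scale p A ρ CG p.qs
  have h1 : ∀ j : Fin (p.d + 1), TimeAppr p.qs (fun (i : Fine p A ρ CG) _ =>
      ‖i.1.T j - i.1.x‖ • coordCLM i.1.T j) := fun j =>
    Appr.const (C := p.κ) (fun i => by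
      rw [norm_smul, norm_norm]
      exact i.norm_smul_coordCLM_le j) hS.η_nonneg
  have h2 := Appr.sum hS Finset.univ fun j _ =>
    (timeAppr_mono (timeAppr_difference_quotient p A ρ CG j)).smul hS (h1 j)
  refine h2.of_near (C := (p.d + 1 : ℕ) * (|p.M| * p.κ)) hS.η_nonneg fun i s hs => ?_
  have ht := i.time_mem hs
  set t := i.1.K.t₀ + s with htdef
  have e1 : i.1.K.Dlin i.1.T t =
      ∑ j, (i.1.K.φh (i.1.T j) t - i.1.K.φh i.1.x t) • coordCLM i.1.T j :=
    (sum_sub_const_smul (sum_coordCLM i.1.T) _ _).symm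
  rw [e1, ← Finset.sum_sub_distrib]
  have h3 : ∀ j ∈ Finset.univ, ‖(i.1.K.φh (i.1.T j) t - i.1.K.φh i.1.x t) • coordCLM i.1.T j -
      (‖i.1.T j - i.1.x‖⁻¹ • (i.1.K.φ (i.1.T j) t - i.1.K.φ i.1.x t)) •
        (‖i.1.T j - i.1.x‖ • coordCLM i.1.T j)‖ ≤ |p.M| * p.κ * i.1.K.tol p.qs := by
    intro j _
    have e2 : (‖i.1.T j - i.1.x‖⁻¹ • (i.1.K.φ (i.1.T j) t - i.1.K.φ i.1.x t)) •
        (‖i.1.T j - i.1.x‖ • coordCLM i.1.T j) =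
        (i.1.K.φ (i.1.T j) t - i.1.K.φ i.1.x t) • coordCLM i.1.T j := by
      rcases eq_or_ne (‖i.1.T j - i.1.x‖) 0 with h0 | h0
      · have : i.1.T j = i.1.x := sub_eq_zero.1 (norm_eq_zero.1 h0)
        simp [this]
      · rw [smul_smul, smul_eq_mul]
        congr 1
        field_simp
    rw [e2]
    refine le_of_eq_of_le (congrArg norm (sub_smul _ _ (coordCLM i.1.T j)).symm) ?_
    rw [norm_smul, Real.norm_eq_abs]
    have e3 := Config.abs_φ_sub_φh_sub_le i.1.adm.triangulation i.1.adm.levelSet i.1.adm.discrete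
      i.1.meshU ht (vertex_mem_hull i.1.T j) i.1.mem
    have e4 : |i.1.K.φh (i.1.T j) t - i.1.K.φh i.1.x t -
        (i.1.K.φ (i.1.T j) t - i.1.K.φ i.1.x t)| ≤
        |p.M| * i.1.K.tol p.qs * ‖i.1.T j - i.1.x‖ := by
      rw [abs_sub_comm, sub_sub_sub_comm, ← dist_eq_norm]
      exact e3.trans (mul_le_mul_of_nonneg_right
        (mul_le_mul_of_nonneg_right (le_abs_self _) (i.tol_nonneg _)) dist_nonneg)
    have h5 : 0 ≤ |p.M| * i.1.K.tol p.qs := mul_nonneg (abs_nonneg _) (i.tol_nonneg _)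
    calc _ ≤ |p.M| * i.1.K.tol p.qs * ‖i.1.T j - i.1.x‖ * ‖coordCLM i.1.T j‖ := by gcongr
      _ = |p.M| * i.1.K.tol p.qs * (‖i.1.T j - i.1.x‖ * ‖coordCLM i.1.T j‖) := by ring
      _ ≤ |p.M| * i.1.K.tol p.qs * p.κ := by
          gcongr
          exact i.norm_smul_coordCLM_le j
      _ = _ := by ring
  refine (norm_sum_le_of_le _ h3).trans (le_of_eq ?_)
  simp only [Finset.sum_const, Finset.card_univ, Fintype.card_fin, nsmul_eq_mul]
  ring

/-- The derivative of the right-hand side in the equation for the ideal mapping. -/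
noncomputable def γ (i : Fine p A ρ CG) (t : ℝ) : E p.d →L[ℝ] ℝ :=
  i.1.K.rhsDeriv i.1.T i.1.x t (i.1.K.φ i.1.x t) (fderiv ℝ (fun y => i.1.K.φ y t) i.1.x)

theorem timeAppr_γ (p : Params) (A ρ CG : ℝ) :
    TimeAppr p.qs (fun (i : Fine p A ρ CG) s => i.γ (i.1.K.t₀ + s)) := by
  have hS := scale p A ρ CG p.qs
  have h1 : TimeAppr p.qs (fun (_ : Fine p A ρ CG) _ => (1 : ℝ)) :=
    Appr.const (C := 1) (by simp) hS.η_nonneg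
  have hb := timeAppr_mono (timeAppr_b p A ρ CG)
  exact (((h1.sub hS hb).smul hS (timeAppr_Dlin p A ρ CG)).add
    (hb.smul hS (timeAppr_mono (timeAppr_fderiv p A ρ CG)))).add
    (((timeAppr_mono (timeAppr_φ p A ρ CG)).sub hS
      (timeAppr_mono (timeAppr_φlin p A ρ CG))).smul hS
      (timeAppr_mono (timeAppr_fderiv_b p A ρ CG)))

/-- The derivative of the ideal mapping. -/
noncomputable def DΨ (i : Fine p A ρ CG) (t : ℝ) : E p.d →L[ℝ] E p.d :=
  mapDeriv (fderiv ℝ (fun y => i.1.K.φ y t) i.1.x)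
    (fderiv ℝ (fun y => i.1.K.φ y t) (i.1.K.Ψ i.1.x t))
    (i.1.K.stepLen i.1.x t • fderiv ℝ (fderiv ℝ (fun y => i.1.K.φ y t)) i.1.x) (i.γ t)

theorem slope_le (i : Fine p A ρ CG) {t : ℝ} (ht : t ∈ i.1.K.I) :
    slope p ≤ fderiv ℝ (fun y => i.1.K.φ y t) (i.1.K.Ψ i.1.x t) (i.1.K.G i.1.x t) :=
  (i.2.ideal t ht).slope_le _ (i.2.abs_stepLen_le ht)

theorem timeAppr_DΨ (p : Params) (A ρ CG : ℝ) :
    TimeAppr p.qs (fun (i : Fine p A ρ CG) s => i.DΨ (i.1.K.t₀ + s)) := by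
  have hS := scale p A ρ CG p.qs
  have hS' := scale p A ρ CG (p.qs + 1)
  have hℓ := timeAppr_fderiv p A ρ CG
  have hℓ' := timeAppr_fderiv_image p A ρ CG
  obtain ⟨L, hL, hnear⟩ := slope_near p A ρ CG
  set N := max p.qs p.qt + 1 with hN
  -- The slope at the image stays within O(h + Δt) of |∇φ(x,t₀)|² and is bounded below, so the
  -- truncated geometric series applies.
  have hu : TimeAppr (p.qs + 1) (fun (i : Fine p A ρ CG) s =>
      (fderiv ℝ (fun y => i.1.K.φ y (i.1.K.t₀ + s)) (i.1.K.Ψ i.1.x (i.1.K.t₀ + s))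
        (riesz p.d (fderiv ℝ (fun y => i.1.K.φ y (i.1.K.t₀ + s)) i.1.x)))⁻¹) := by
    refine Appr.inv hS' (u₀ := fun i => ‖i.1.K.G i.1.x i.1.K.t₀‖ ^ 2)
      (θ := fun i => i.1.K.h + i.1.K.Δt) (C := L + (|p.Cφ| + 1) ^ 2) (K := 2 ^ N) (N := N)
      (slope_pos p) (hℓ'.apply hS' (hℓ.clm hS' (riesz p.d)))
      (fun i => le_trans ?_ i.le_sq_norm_G) (fun i s hs => i.slope_le (i.time_mem hs))
      (fun i s hs => ?_) (fun i => i.add_pow_le_tol le_rfl) (by positivity) (fun i => ?_)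
    · rw [slope]
      linarith [sq_nonneg p.cφ]
    · have h1 : 0 ≤ A * i.1.K.h := mul_nonneg i.A_nonneg i.h_pos.le
      have h2 := hnear i _ (i.time_mem hs) (i.1.K.stepLen i.1.x (i.1.K.t₀ + s))
        ((i.2.abs_stepLen_le (i.time_mem hs)).trans (by linarith))
      rw [abs_sub_comm]
      refine h2.trans (mul_le_mul_of_nonneg_right ?_ (add_nonneg i.h_pos.le i.Δt_pos.le))
      linarith [sq_nonneg (|p.Cφ| + 1)]
    · have := pow_le_pow_left₀ (norm_nonneg _) (Facts.norm_G_le (a := i.1) i.t₀_mem) 2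
      linarith
  exact Appr.mapDeriv hS (timeAppr_mono hℓ) (timeAppr_mono hℓ')
    (timeAppr_mono (timeAppr_stepLen_smul_fderiv_fderiv p A ρ CG)) (timeAppr_γ p A ρ CG)
    (timeAppr_mono hu)

/-- The derivative of the semi-discrete mapping at a time node. -/
noncomputable def DΨdti (i : Fine p A ρ CG) (k : Fin (p.qt + 1)) : E p.d →L[ℝ] E p.d :=
  mapDeriv (fderiv ℝ (i.1.K.φdti k) i.1.x) (fderiv ℝ (i.1.K.φdti k) (i.1.K.Ψdti k i.1.x))
    (i.1.K.stepLenDti k i.1.x • fderiv ℝ (fderiv ℝ (i.1.K.φdti k)) i.1.x)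
    (i.1.K.rhsDeriv i.1.T i.1.x (i.1.K.node k) (i.1.K.φdti k i.1.x)
      (fderiv ℝ (i.1.K.φdti k) i.1.x))

theorem Ψ_mem_closedBall (i : Fine p A ρ CG) {t : ℝ} (ht : t ∈ i.1.K.I) :
    i.1.K.Ψ i.1.x t ∈ closedBall i.1.x (A * (|p.Cφ| + 1) * i.1.K.h) :=
  Facts.mem_closedBall_of_le (i.2.abs_stepLen_le ht) (Facts.norm_G_le ht)

theorem Ψdti_mem_closedBall (i : Fine p A ρ CG) (k : Fin (p.qt + 1)) :
    i.1.K.Ψdti k i.1.x ∈ closedBall i.1.x (A * (|p.Cφ| + 1) * i.1.K.h) :=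
  Facts.mem_closedBall_of_le (i.2.abs_stepLenDti_le k) (i.2.semi k).1

theorem h_mul_le_tol (i : Fine p A ρ CG) :
    i.1.K.h * (i.1.K.h ^ (p.qs - 1) + i.1.K.Δt ^ (p.qt + 1)) ≤ i.1.K.tol p.qs := by
  have h1 : i.1.K.h * i.1.K.h ^ (p.qs - 1) = i.1.K.h ^ p.qs := by
    rw [← pow_succ', Nat.sub_add_cancel p.one_le_qs]
  have h2 : i.1.K.h * i.1.K.Δt ^ (p.qt + 1) ≤ i.1.K.Δt ^ (p.qt + 1) :=
    mul_le_of_le_one_left (pow_nonneg i.Δt_pos.le _) i.2.h_le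
  rw [mul_add, h1, Config.tol]
  linarith

theorem tol_succ_le (i : Fine p A ρ CG) : i.1.K.tol (p.qs + 1) ≤ i.1.K.tol p.qs := by
  rw [Config.tol, Config.tol]
  gcongr ?_ + _
  exact pow_le_pow_of_le_one i.h_pos.le i.2.h_le (Nat.le_succ _)

/-- Both derivatives are values of `mapDeriv`, so it suffices to compare the four arguments at each
node, using the nodal bounds on the step lengths and image points. -/
theorem near_DΨ (p : Params) {A ρ CG : ℝ} (hA : 0 ≤ A) (hρ : 0 < ρ) (hCG : 0 ≤ CG) :
    Near (fun i : Fine p A ρ CG × Fin (p.qt + 1) => i.1.1.K.tol p.qs)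
      (fun i => i.1.DΨ (i.1.1.K.node i.2)) (fun i => i.1.DΨdti i.2) := by
  obtain ⟨C, hC, hnod⟩ := exists_nodal_comparison p hA hρ hCG
  obtain ⟨Cγ, hCγ, hγ⟩ := (timeAppr_γ p A ρ CG).bounded (scale p A ρ CG _)
  obtain ⟨Cb, hCb, hb⟩ := (timeAppr_fderiv_b p A ρ CG).bounded (scale p A ρ CG _)
  have hη : ∀ i : Fine p A ρ CG × Fin (p.qt + 1), 0 ≤ i.1.1.K.tol p.qs := fun i =>
    i.1.tol_nonneg _
  have hη2 : ∀ i : Fine p A ρ CG × Fin (p.qt + 1), i.1.1.K.tol p.qs ≤ 2 := fun i =>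
    (scale p A ρ CG p.qs).η_le i.1
  have hn : ∀ i : Fine p A ρ CG × Fin (p.qt + 1), i.1.1.K.node i.2 ∈ i.1.1.K.I := fun i =>
    i.1.1.K.node_mem i.1.1.adm.time_lt i.2
  have hx : ∀ i : Fine p A ρ CG × Fin (p.qt + 1), i.1.1.x ∈ interior i.1.1.K.Ubar := fun i =>
    i.1.2.ball i.1.mem_cyl.1
  have hs : ∀ i : Fine p A ρ CG × Fin (p.qt + 1),
      i.1.1.K.node i.2 - i.1.1.K.t₀ ∈ Icc 0 i.1.1.K.Δt := fun i => by
    have := hn i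
    exact ⟨sub_nonneg.2 this.1, sub_le_sub_right this.2 _⟩
  have hMabs : ∀ u : ℝ, 0 ≤ u → p.M * u ≤ |p.M| * u := fun u hu =>
    mul_le_mul_of_nonneg_right (le_abs_self _) hu
  have hℓ : ∀ i : Fine p A ρ CG × Fin (p.qt + 1), ∀ y ∈ interior i.1.1.K.Ubar,
      ‖fderiv ℝ (fun y => i.1.1.K.φ y (i.1.1.K.node i.2)) y - fderiv ℝ (i.1.1.K.φdti i.2) y‖ ≤
        |p.M| * i.1.1.K.tol p.qs := fun i y hy => by
    rw [norm_sub_rev]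
    exact (i.1.1.adm.φdti_sub_φ_bounds i.2 hy).2.1.trans (hMabs _ (hη i))
  have hbd : ∀ i : Fine p A ρ CG × Fin (p.qt + 1), ∀ y ∈ interior i.1.1.K.Ubar,
      ‖fderiv ℝ (fun y => i.1.1.K.φ y (i.1.1.K.node i.2)) y‖ ≤ p.Cφ := fun i y hy =>
    Config.norm_fderiv_slice_le i.1.1.adm.levelSet (hn i)
      (Config.interior_Ubar_subset_U (hn i) hy)
  have hD2 : ∀ i : Fine p A ρ CG × Fin (p.qt + 1),
      ‖fderiv ℝ (fderiv ℝ (fun y => i.1.1.K.φ y (i.1.1.K.node i.2))) i.1.1.x‖ ≤ |p.M| := fun i => by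
    rw [norm_fderiv_fderiv]
    exact (i.1.1.adm.levelSet.D2_bound _ (hn i) _ (i.1.1.mem_U (hn i))).trans (le_abs_self _)
  refine Near.mapDeriv hη (slope_pos p) ?_ ?_ ?_ ?_ (fun i => i.1.slope_le (hn i))
    (fun i => (i.1.2.semi i.2).2.slope_le _ (i.1.2.abs_stepLenDti_le i.2))
  · exact Near.of_le hη hη2 (fun i => hbd i _ (hx i)) (fun i => hℓ i _ (hx i))
  · refine Near.of_le hη hη2 (C₂ := |p.M| * C + |p.M|)
      (fun i => hbd i _ (i.1.2.closedBall_subset (i.1.Ψ_mem_closedBall (hn i)))) (fun i => ?_)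
    -- The derivatives at the images differ by the distance of the two image points and by the error
    -- of φ_{Δt,i}; these are separated by inserting ∇φ at the semi-discrete image.
    have e1 := norm_fderiv_sub_le_of_ball i.1.1.adm.levelSet (hn i) (convex_closedBall _ _)
      i.1.2.closedBall_subset (i.1.Ψdti_mem_closedBall i.2) (i.1.Ψ_mem_closedBall (hn i))
    have e2 := hℓ i _ (i.1.2.closedBall_subset (i.1.Ψdti_mem_closedBall i.2))
    have e3 := (hnod i.1.1 i.1.2 i.2).2.1.trans (mul_le_mul_of_nonneg_left i.1.tol_succ_le hC)
    have e4 := hMabs _ (norm_nonneg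
      (i.1.1.K.Ψ i.1.1.x (i.1.1.K.node i.2) - i.1.1.K.Ψdti i.2 i.1.1.x))
    have e5 := mul_le_mul_of_nonneg_left e3 (abs_nonneg p.M)
    refine (norm_sub_le_norm_sub_add_norm_sub _ (fderiv ℝ
      (fun y => i.1.1.K.φ y (i.1.1.K.node i.2)) (i.1.1.K.Ψdti i.2 i.1.1.x)) _).trans ?_
    linarith
  · refine Near.of_le hη hη2 (C₁ := A * |p.M|) (C₂ := C * |p.M| + A * |p.M|) (fun i => ?_)
      (fun i => ?_)
    · refine norm_smul_le_mul (W := E p.d →L[ℝ] E p.d →L[ℝ] ℝ) ?_ ?_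
      · exact (i.1.2.abs_stepLen_le (hn i)).trans (mul_le_of_le_one_right hA i.1.2.h_le)
      · exact hD2 i
    · have e1 := (hnod i.1.1 i.1.2 i.2).1.trans (mul_le_mul_of_nonneg_left i.1.tol_succ_le hC)
      have e2 := i.1.2.abs_stepLenDti_le i.2
      have e3 := (i.1.1.adm.φdti_sub_φ_bounds i.2 (hx i)).2.2
      set D := fderiv ℝ (fderiv ℝ (fun y => i.1.1.K.φ y (i.1.1.K.node i.2))) i.1.1.x
      set D' := fderiv ℝ (fderiv ℝ (i.1.1.K.φdti i.2)) i.1.1.x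
      set r := i.1.1.K.stepLen i.1.1.x (i.1.1.K.node i.2)
      set r' := i.1.1.K.stepLenDti i.2 i.1.1.x
      have h0 : 0 ≤ i.1.1.K.h ^ (p.qs - 1) + i.1.1.K.Δt ^ (p.qt + 1) :=
        add_nonneg (pow_nonneg i.1.h_pos.le _) (pow_nonneg i.1.Δt_pos.le _)
      have h1 : |r - r'| * ‖D‖ ≤ C * i.1.1.K.tol p.qs * |p.M| :=
        mul_le_mul e1 (hD2 i) (norm_nonneg D) (mul_nonneg hC (hη i))
      -- Second derivatives agree only to order h^(q_s−1) + Δt^(q_t+1); the factor |r'| ≤ A h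
      -- restores the lost power.
      have h2 : |r'| * ‖D' - D‖ ≤ A * |p.M| * i.1.1.K.tol p.qs := by
        calc |r'| * ‖D' - D‖ ≤ A * i.1.1.K.h *
              (|p.M| * (i.1.1.K.h ^ (p.qs - 1) + i.1.1.K.Δt ^ (p.qt + 1))) :=
              mul_le_mul e2 (e3.trans (hMabs _ h0)) (norm_nonneg (D' - D))
                (mul_nonneg hA i.1.h_pos.le)
          _ = A * |p.M| *
              (i.1.1.K.h * (i.1.1.K.h ^ (p.qs - 1) + i.1.1.K.Δt ^ (p.qt + 1))) := by ring
          _ ≤ A * |p.M| * i.1.1.K.tol p.qs :=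
              mul_le_mul_of_nonneg_left i.1.h_mul_le_tol (by positivity)
      exact (norm_smul_sub_smul_le r r' D D').trans
        ((add_le_add h1 h2).trans (le_of_eq (by ring)))
  · refine Near.of_le hη hη2 (C₁ := Cγ) (C₂ := |p.M| + |p.M| * Cb) (fun i => ?_) (fun i => ?_)
    · have := hγ i.1 _ (hs i)
      rwa [add_sub_cancel] at this
    · have hbm := i.1.1.adm.b_mem (i.1.1.mem_U (hn i)).1 (hn i)
      have e1 := hℓ i _ (hx i)
      have e2 := (i.1.1.adm.φdti_sub_φ_bounds i.2 (hx i)).1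
      have e3 := hb i.1 _ (hs i)
      rw [add_sub_cancel] at e3
      rw [γ, Config.rhsDeriv, Config.rhsDeriv]
      set ℓ := fderiv ℝ (fun y => i.1.1.K.φ y (i.1.1.K.node i.2)) i.1.1.x
      set ℓ' := fderiv ℝ (i.1.1.K.φdti i.2) i.1.1.x
      set b := i.1.1.K.b i.1.1.x (i.1.1.K.node i.2)
      set Db := fderiv ℝ (fun y => i.1.1.K.b y (i.1.1.K.node i.2)) i.1.1.x
      set D := i.1.1.K.Dlin i.1.1.T (i.1.1.K.node i.2)
      set v := i.1.1.K.φ i.1.1.x (i.1.1.K.node i.2)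
      set v' := i.1.1.K.φdti i.2 i.1.1.x
      set w := i.1.1.K.φlin i.1.1.x (i.1.1.K.node i.2)
      -- The gradient of φ^lin is common to both right-hand sides and cancels.
      have e : (1 - b) • D + b • ℓ + (v - w) • Db - ((1 - b) • D + b • ℓ' + (v' - w) • Db) =
          b • (ℓ - ℓ') - (v' - v) • Db := by module
      rw [e]
      have h1 : ‖b • (ℓ - ℓ')‖ ≤ |p.M| * i.1.1.K.tol p.qs := by
        rw [norm_smul, Real.norm_eq_abs, abs_of_nonneg hbm.1]
        exact (mul_le_of_le_one_left (norm_nonneg _) hbm.2).trans e1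
      have h2 : ‖(v' - v) • Db‖ ≤ |p.M| * i.1.1.K.tol p.qs * Cb := by
        rw [norm_smul, Real.norm_eq_abs]
        refine mul_le_mul ?_ e3 (norm_nonneg _) (mul_nonneg (abs_nonneg _) (hη i))
        exact (e2.trans (hMabs _ (i.1.tol_nonneg (p.qs + 1)))).trans
          (mul_le_mul_of_nonneg_left i.1.tol_succ_le (abs_nonneg _))
      refine (norm_sub_le _ _).trans ((add_le_add h1 h2).trans (le_of_eq (by ring)))

/-- Differentiating the root requires its equation and slope bound in a neighbourhood. Nearby points
lie in the same element and configuration, so the same constants apply. -/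
theorem eventually_facts (i : Fine p A ρ CG)
    (hx : i.1.x ∈ interior (hull i.1.T)) (hall : ∀ b : Loc p, b.K = i.1.K → Facts A ρ CG b) :
    ∀ᶠ y in 𝓝 i.1.x, ∃ hy : y ∈ hull i.1.T,
      Facts A ρ CG ⟨i.1.K, i.1.bl, i.1.T, y, i.1.adm, i.1.active, hy⟩ := by
  filter_upwards [isOpen_interior.mem_nhds hx] with y hy
  exact ⟨interior_subset hy, hall _ rfl⟩

theorem hasFDerivAt_Ψ (i : Fine p A ρ CG)
    (hx : i.1.x ∈ interior (hull i.1.T)) (hall : ∀ b : Loc p, b.K = i.1.K → Facts A ρ CG b)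
    {t : ℝ} (ht : t ∈ i.1.K.I) :
    HasFDerivAt (fun y => i.1.K.Ψ y t) (i.DΨ t) i.1.x := by
  have hc := Config.contDiffOn_φ_interior i.1.adm.levelSet ht
  have hxO := i.2.ball i.mem_cyl.1
  refine hasFDerivAt_add_smul_gradient (f := fun y => i.1.K.φ y t)
    (r := fun y => i.1.K.stepLen y t) (g := fun y => i.1.K.rhs y t) (slope_pos p)
    (hc.hasFDerivAt_of_isOpen isOpen_interior
      (i.2.closedBall_subset (i.Ψ_mem_closedBall ht)))
    (hc.hasFDerivAt_fderiv_of_isOpen isOpen_interior hxO)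
    (i.1.adm.triangulation.hasFDerivAt_rhs i.1.mesh hx (i.differentiableAt_b ht)
      (hc.hasFDerivAt_of_isOpen isOpen_interior hxO)) ?_ ?_ (i.slope_le ht)
  · filter_upwards [i.eventually_facts hx hall] with y ⟨hy, hF⟩
    exact (hF.ideal t ht).eq
  · filter_upwards [i.eventually_facts hx hall] with y ⟨hy, hF⟩
    exact (hF.ideal t ht).low _ _ (hF.abs_stepLen_le ht) (i.2.abs_stepLen_le ht)

theorem hasFDerivAt_Ψdti (i : Fine p A ρ CG)
    (hx : i.1.x ∈ interior (hull i.1.T)) (hall : ∀ b : Loc p, b.K = i.1.K → Facts A ρ CG b)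
    (k : Fin (p.qt + 1)) :
    HasFDerivAt (i.1.K.Ψdti k) (i.DΨdti k) i.1.x := by
  have hc := Config.contDiffOn_φdti_interior i.1.adm.semiDiscrete k
  have hxO := i.2.ball i.mem_cyl.1
  have hrhs := i.1.adm.triangulation.hasFDerivAt_rhs i.1.mesh hx
    (i.differentiableAt_b (i.1.K.node_mem i.1.adm.time_lt k))
    (hc.hasFDerivAt_of_isOpen isOpen_interior hxO)
  simp only [Config.φlin_node i.1.adm.time_lt] at hrhs
  refine hasFDerivAt_add_smul_gradient (f := i.1.K.φdti k)
    (r := fun y => i.1.K.stepLenDti k y) (g := fun y => i.1.K.rhsdti k y) (slope_pos p)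
    (hc.hasFDerivAt_of_isOpen isOpen_interior
      (i.2.closedBall_subset (i.Ψdti_mem_closedBall k)))
    (hc.hasFDerivAt_fderiv_of_isOpen isOpen_interior hxO) hrhs ?_ ?_
    ((i.2.semi k).2.slope_le _ (i.2.abs_stepLenDti_le k))
  · filter_upwards [i.eventually_facts hx hall] with y ⟨hy, hF⟩
    exact (hF.semi k).2.eq
  · filter_upwards [i.eventually_facts hx hall] with y ⟨hy, hF⟩
    exact (hF.semi k).2.low _ _ (hF.abs_stepLenDti_le k) (i.2.abs_stepLenDti_le k)

end Fine

/-- The distance between the derivatives of the semi-discrete and the ideal mapping. -/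
theorem exists_gradient_error (p : Params) {A ρ CG : ℝ} (hA : 0 ≤ A) (hρ : 0 < ρ)
    (hCG : 0 ≤ CG) : ∃ C, 0 ≤ C ∧ ∀ a : Loc p, (∀ b : Loc p, b.K = a.K → Facts A ρ CG b) →
      a.x ∈ interior (hull a.T) → ∀ t ∈ a.K.I,
        DifferentiableAt ℝ (fun y => a.K.Ψdt y t) a.x ∧
        DifferentiableAt ℝ (fun y => a.K.Ψ y t) a.x ∧
        ‖fderiv ℝ (fun y => a.K.Ψdt y t - a.K.Ψ y t) a.x‖ ≤ C * a.K.tol p.qs := by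
  obtain ⟨Λ, hΛ, hell⟩ := exists_ell_bound p
  obtain ⟨C₁, hC₁, hnod⟩ := Fine.near_DΨ p hA hρ hCG
  obtain ⟨C₂, hC₂, hint⟩ := Appr.interpolation_error (K := fun i : Fine p A ρ CG => i.1.K)
    (Fine.scale p A ρ CG p.qs) (fun i => i.1.adm.time_lt)
    (fun i => by
      rw [Config.tol]
      exact le_add_of_nonneg_left (pow_nonneg i.h_pos.le _))
    (f := fun i t => i.DΨ t) (Fine.timeAppr_DΨ p A ρ CG)
  refine ⟨(p.qt + 1 : ℕ) * (Λ * C₁) + C₂, by positivity, fun a hall hx t ht => ?_⟩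
  set i : Fine p A ρ CG := ⟨a, hall a rfl⟩ with hi
  have h1 : HasFDerivAt (fun y => a.K.Ψ y t) (i.DΨ t) a.x := i.hasFDerivAt_Ψ hx hall ht
  have h2 : HasFDerivAt (fun y => a.K.Ψdt y t) (∑ k, a.K.ell k t • i.DΨdti k) a.x :=
    HasFDerivAt.fun_sum fun k _ => (i.hasFDerivAt_Ψdti hx hall k).const_smul (a.K.ell k t)
  refine ⟨h2.differentiableAt, h1.differentiableAt, ?_⟩
  rw [(h2.fun_sub h1).fderiv]
  have e1 : ‖∑ k, a.K.ell k t • i.DΨ (a.K.node k) - i.DΨ t‖ ≤ C₂ * a.K.tol p.qs := hint i t ht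
  have e2 : ‖∑ k, a.K.ell k t • i.DΨdti k - ∑ k, a.K.ell k t • i.DΨ (a.K.node k)‖ ≤
      (p.qt + 1 : ℕ) * (Λ * (C₁ * a.K.tol p.qs)) :=
    norm_sum_smul_sub_sum_smul_le hΛ (fun k => hell a.K a.adm.time_lt t ht k) fun k => by
      rw [norm_sub_rev]
      exact (hnod (i, k)).2.2
  refine (norm_sub_le_norm_sub_add_norm_sub _ (∑ k, a.K.ell k t • i.DΨ (a.K.node k)) _).trans ?_
  linarith

end SpaceTimeMapping

/-! ### The main theorem -/

open SpaceTimeMapping in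
theorem mainTheorem6 (p : Params) :
    ∃ C h₀ : ℝ, 0 < C ∧ 0 < h₀ ∧
      ∀ (K : Config p) (bl : Blending) (sd : SearchDir), K.Admissible bl → K.h ≤ h₀ →
        ∀ T ∈ K.active bl,
          (∀ x ∈ hull T,
            (∀ t ∈ K.I, ∃! a, IsLeastAbs (K.roots x t) a) ∧
            (∀ i, ∃! a, IsLeastAbs (K.rootsdti i x) a) ∧
            (∀ i, ∃! a, IsLeastAbs (K.rootshi bl sd T i x) a)) ∧
          (∀ x ∈ hull T, ∀ t ∈ K.I,
            ‖K.Ψh bl sd T x t - K.Ψ x t‖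
              ≤ C * (K.h ^ (p.qs + 1) + K.Δt ^ (p.qt + 1)) ∧
            ‖K.Ψdt x t - K.Ψ x t‖
              ≤ C * (K.h ^ (p.qs + 1) + K.Δt ^ (p.qt + 1)) ∧
            ‖K.Ψdt x t - K.Ψh bl sd T x t‖ ≤ C * K.h ^ (p.qs + 1)) ∧
          (∀ x ∈ interior (hull T), ∀ t ∈ K.I,
            DifferentiableAt ℝ (fun y => K.Ψdt y t) x ∧
            DifferentiableAt ℝ (fun y => K.Ψ y t) x ∧
            ‖fderiv ℝ (fun y => K.Ψdt y t - K.Ψ y t) x‖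
              ≤ C * (K.h ^ p.qs + K.Δt ^ (p.qt + 1))) := by
  obtain ⟨A, ρ, CG, hA, hρ, hCG, hfacts⟩ := exists_facts p
  obtain ⟨C₁, hC₁, hval⟩ := exists_mapping_error p hA hρ hCG
  obtain ⟨C₂, hC₂, hgrad⟩ := exists_gradient_error p hA hρ hCG
  -- Unpacking the filter of vanishing mesh size yields a threshold depending on the fixed
  -- parameters alone.
  rw [small, Metric.nhds_basis_ball.comap _ |>.eventually_iff] at hfacts
  obtain ⟨δ, hδ, hfacts⟩ := hfacts
  refine ⟨C₁ + C₂ + 1, δ / 2, by positivity, by positivity, fun K bl sd hK hh T hT => ?_⟩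
  have hF : ∀ a : Loc p, a.K = K → Facts A ρ CG a := fun a ha => hfacts (by
    rw [mem_preimage, mem_ball, dist_zero_right, ha, Real.norm_eq_abs, abs_of_pos hK.h_pos]
    linarith)
  have hmono : ∀ {c u : ℝ}, c ≤ C₁ + C₂ + 1 → 0 ≤ u → c * u ≤ (C₁ + C₂ + 1) * u :=
    fun hc hu => mul_le_mul_of_nonneg_right hc hu
  have hh0 : 0 ≤ K.h ^ (p.qs + 1) := pow_nonneg hK.h_pos.le _
  refine ⟨fun x hx => ?_, fun x hx t ht => ?_, fun x hx t ht => ?_⟩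
  · have hf := hF ⟨K, bl, T, x, hK, hT, hx⟩ rfl
    refine ⟨fun t ht => (hf.ideal t ht).existsUnique, fun i => (hf.semi i).2.existsUnique,
      fun i => ?_⟩
    rw [K.rootshi_eq]
    exact (hf.discrete i sd).2.existsUnique
  · set a : Loc p := ⟨K, bl, T, x, hK, hT, hx⟩
    obtain ⟨h1, h2, h3⟩ := hval a (hF a rfl) t ht sd
    have h0 := Facts.tol_nonneg a (p.qs + 1)
    exact ⟨h1.trans (hmono (by linarith) h0), h2.trans (hmono (by linarith) h0),
      h3.trans (hmono (by linarith) hh0)⟩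
  · set a : Loc p := ⟨K, bl, T, x, hK, hT, interior_subset hx⟩
    obtain ⟨h1, h2, h3⟩ := hgrad a hF hx t ht
    exact ⟨h1, h2, h3.trans (hmono (by linarith) (Facts.tol_nonneg a p.qs))⟩
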